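/- Let $\Gamma=(V,E,(w_v)_{v\in V})$ be a plumbing graph, i.e. a finite tree with vertex set $V$, edge set $E$ and integral weights $w_v\in\mathbb Z$, whose linking matrix $W$ ($W_{vv}=w_v$; $W_{vv'}=1$ if $\{v,v'\}\in E$ and $W_{vv'}=0$ otherwise, for $v\ne v'$) is negative definite. Let $k$ be a positive integer. Write $\mathbf e(z)=e^{2\pi\sqrt{-1}z}$, $\zeta_n=\mathbf e(1/n)$, $\delta=(\deg v)_{v\in V}\in\mathbb Z^V$, $Q(x)=-{}^t x W^{-1}x$ for $x\in\mathbb R^V$, and $F_v(z)=(z-z^{-1})^{2-\deg v}$. For $q=\mathbf e(\tau)$ with $\operatorname{Im}\tau>0$ put $q^\alpha=\mathbf e(\alpha\tau)$. For $b\in\mathbb Z^V/2W(\mathbb Z^V)$ let $$\Theta_{Q,b}(q;z)=\sum_{l\in 2W(\mathbb Z^V)+b}q^{Q(l)/4}\prod_{v\in V}z_v^{l_v},\qquad \widehat Z_b(q)=q^{-\sum_v(w_v+3)/4}\;\mathrm{v.p.}\!\int_{|z_v|=1,\,v\in V}\Theta_{Q,b}(q;z)\prod_{v\in V}F_v(z_v)\frac{dz_v}{2\pi\sqrt{-1}\,z_v},$$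 where $\mathrm{v.p.}\int$ denotes the limit as $\varepsilon\to+0$ of the mean of the $2^{|V|}$ integrals over the tori $|z_v|=1\pm\varepsilon$ ($v\in V$, signs chosen independently). The series $\Theta_{Q,b}(q;z)$ converges absolutely for all $z\in(\mathbb C\smallsetminus\{0\})^V$, and the limit defining the principal value exists. Let $$\varphi_{\Gamma,k}\bigl((t_v)_{v\in V}\bigr)=\sum_{\mu\in\mathbb Z^V/2k\mathbb Z^V}\mathbf e\Bigl(\tfrac1{4k}{}^t\mu W\mu\Bigr)\prod_{v\in V}F_v\bigl(\zeta_{2k}^{\mu_v}e^{t_v}\bigr)=\sum_{m\in\mathbb Z^V}B_m\prod_{v\in V}t_v^{m_v}$$ be the Laurent expansion at the origin. For $f(x)=e^{-Q(x)/4}$ on $\mathbb R^V$ and $m\in\mathbb Z^V$ let $f^{(m)}$ be the mixed derivative of $f$ of order $m$, where a derivative of order $-1$ in $x_v$ means $g\mapsto-\int_{x_v}^\infty g\,dx_v$ and a derivative of order $-n$ means the $n$-fold iterate of it, and let $\varphi_{\Gamma,k}\odot f(t)=\sum_{m\in\mathbb Z^V}B_m f^{(m)}(0)\,t^{\sum_v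 m_v}\in\mathbb C((t))$. Then, as $t\to+0$, at $q=\zeta_ke^{-t}$, that is $q^\alpha=\mathbf e(\alpha/k)e^{-\alpha t}$, $$\sum_{\substack{a\in\mathbb Z^V/W(\mathbb Z^V),\\ b\in(2\mathbb Z^V+\delta)/2W(\mathbb Z^V)}}\mathbf e\bigl(-k\,{}^t aW^{-1}a-{}^t aW^{-1}b\bigr)\,\widehat Z_b(q)\,q^{\sum_v(w_v+3)/4}\Big|_{q=\zeta_ke^{-t}}\;\sim\;\frac{\zeta_8^{|V|}\sqrt{|\det W|}}{\sqrt{2k}^{\,|V|}}\;\varphi_{\Gamma,k}\odot\bigl(e^{-Q(x)/4}\bigr)(\sqrt t).$$ Here $g(t)\sim\sum_{n\ge-L}c_n\sqrt t^{\,n}$ means that for every $M>0$ there are $K,\varepsilon>0$ with $\bigl|g(t)-\sum_{-L\le n\le M}c_n\sqrt t^{\,n}\bigr|\le K\sqrt t^{\,M}$ for all $t\in(0,\varepsilon)$. -/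

import Mathlib

open scoped Topology

noncomputable section

namespace GPPV

/-- The normalized exponential `𝐞(z) = exp(2πiz)`; in particular `ζ_n = 𝐞(1/n)`. -/
def e (z : ℂ) : ℂ := Complex.exp (2 * Real.pi * Complex.I * z)

/-- The factor `F(z) = (z - z⁻¹)^(2 - d)` attached to a vertex of degree `d`. It is a rational
function, so it can be evaluated in every field: below it is evaluated at complex numbers and at
formal Laurent series. -/
def vertexFactor {K : Type*} [Field K] (d : ℕ) (z : K) : K := (z - z⁻¹) ^ (2 - (d : ℤ))

section Graph

variable {V : Type*} [Fintype V] [DecidableEq V]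

/-- The linking matrix of the graph `G` with vertex weights `w`. -/
def linkingMatrix (G : SimpleGraph V) [DecidableRel G.Adj] (w : V → ℤ) : Matrix V V ℤ :=
  Matrix.diagonal w + G.adjMatrix ℤ

/-- The bilinear form `ᵗx W⁻¹ y` on `ℝ^V`. -/
def invForm (W : Matrix V V ℤ) (x y : V → ℝ) : ℝ :=
  x ⬝ᵥ ((W.map (Int.cast : ℤ → ℝ))⁻¹.mulVec y)

/-- The quadratic form `Q(x) = -ᵗx W⁻¹ x` on `ℝ^V`. -/
def Q (W : Matrix V V ℤ) (x : V → ℝ) : ℝ := -invForm W x x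

/-- An integral vector as a real vector. -/
def toReal (l : V → ℤ) : V → ℝ := fun v => (l v : ℝ)

/-- The finite group `ℤ^V / W(ℤ^V)`. -/
abbrev Coker (W : Matrix V V ℤ) : Type _ := (V → ℤ) ⧸ LinearMap.range W.mulVecLin

/-- The residue class of an integral vector in `ℤ^V / W(ℤ^V)`. -/
abbrev toCoker (W : Matrix V V ℤ) (l : V → ℤ) : Coker W := Submodule.Quotient.mk l

/-- The general term `q^(Q(l)/4) ∏ z_v^(l_v)` of the theta series, where `q = 𝐞(τ)` and
`q^α = 𝐞(ατ)`. -/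
def thetaTerm (W : Matrix V V ℤ) (τ : ℂ) (z : V → ℂ) (l : V → ℤ) : ℂ :=
  e ((Q W (toReal l) / 4 : ℝ) * τ) * ∏ v, z v ^ l v

/-- The theta function `Θ_{Q,b}(q; z)`, `q = 𝐞(τ)`: the sum over all `l` in the class
`b ∈ ℤ^V / 2W(ℤ^V)`. -/
def theta (W : Matrix V V ℤ) (b : Coker (2 • W)) (τ : ℂ) (z : V → ℂ) : ℂ :=
  ∑' l : {l : V → ℤ // toCoker (2 • W) l = b}, thetaTerm W τ z l

/-- The integral `∫_{|z_v| = r_v, v ∈ V} g(z) ∏ dz_v / (2πi z_v)`, with the circles parametrized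
by `z_v = r_v 𝐞(θ_v)`, `0 ≤ θ_v ≤ 1`, so that `dz_v / (2πi z_v) = dθ_v`. -/
def torusIntegral (r : V → ℝ) (g : (V → ℂ) → ℂ) : ℂ :=
  ∫ θ in Set.Icc (0 : V → ℝ) 1, g (fun v => (r v : ℂ) * e (θ v))

/-- The mean of the integrals over the tori `|z_v| = 1 ± ε`, over all choices of the signs. -/
def symmetricIntegral (g : (V → ℂ) → ℂ) (ε : ℝ) : ℂ :=
  (1 / 2) ^ Fintype.card V * ∑ s : V → ℤˣ, torusIntegral (fun v => 1 + ((s v : ℤ) : ℝ) * ε) g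

/-- The Cauchy principal value `v.p. ∫_{|z_v| = 1, v ∈ V} g(z) ∏ dz_v / (2πi z_v)`. -/
def principalValue (g : (V → ℂ) → ℂ) : ℂ :=
  Filter.limUnder (𝓝[>] (0 : ℝ)) (symmetricIntegral g)

/-- The integrand `Θ_{Q,b}(q; z) ∏ F_v(z_v)` of the GPPV invariant, `q = 𝐞(τ)`. -/
def integrand (G : SimpleGraph V) [DecidableRel G.Adj] (w : V → ℤ)
    (b : Coker (2 • linkingMatrix G w)) (τ : ℂ) (z : V → ℂ) : ℂ :=
  theta (linkingMatrix G w) b τ z * ∏ v, vertexFactor (G.degree v) (z v)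

/-- The exponent `∑_v (w_v + 3) / 4`. -/
def weightExponent (w : V → ℤ) : ℂ := ∑ v, ((w v : ℂ) + 3) / 4

/-- The GPPV invariant of the weighted graph `(G, w)` and the class `b`, as a function of `τ`
where `q = 𝐞(τ)` and `q^α = 𝐞(ατ)`. -/
def Zhat (G : SimpleGraph V) [DecidableRel G.Adj] (w : V → ℤ)
    (b : Coker (2 • linkingMatrix G w)) (τ : ℂ) : ℂ :=
  e (-(weightExponent w * τ)) * principalValue (integrand G w b τ)

/-- The degree vector `δ`. -/
def degreeVector (G : SimpleGraph V) [DecidableRel G.Adj] : V → ℤ := fun v => (G.degree v : ℤ)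

/-- The subset `(2ℤ^V + δ) / 2W(ℤ^V)` of `ℤ^V / 2W(ℤ^V)`. -/
def degreeClasses (G : SimpleGraph V) [DecidableRel G.Adj] (w : V → ℤ) :
    Set (Coker (2 • linkingMatrix G w)) :=
  {b | ∃ n : V → ℤ, b = toCoker (2 • linkingMatrix G w) (2 • n + degreeVector G)}

/-- The Gauss weight `𝐞(-k ᵗa W⁻¹ a - ᵗa W⁻¹ b)`. For `a ∈ ℤ^V` and `b ∈ 2ℤ^V + δ` it depends
only on the classes of `a` and `b`. -/
def gaussWeight (W : Matrix V V ℤ) (k : ℕ) (a b : V → ℤ) : ℂ :=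
  e ((-(k * invForm W (toReal a) (toReal a)) - invForm W (toReal a) (toReal b) : ℝ))

/-- The Gauss-weighted sum
`∑_{a, b} 𝐞(-k ᵗa W⁻¹ a - ᵗa W⁻¹ b) q^(∑ (w_v + 3)/4) Ẑ_b(q)` at `q = 𝐞(τ)`, where `a` runs over
`ℤ^V / W(ℤ^V)` and `b` over `(2ℤ^V + δ) / 2W(ℤ^V)`. -/
def weightedSum (G : SimpleGraph V) [DecidableRel G.Adj] (w : V → ℤ) (k : ℕ) (τ : ℂ) : ℂ :=
  ∑ᶠ (a : Coker (linkingMatrix G w)) (b : Coker (2 • linkingMatrix G w))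
    (_ : b ∈ degreeClasses G w),
    gaussWeight (linkingMatrix G w) k (Quotient.out a) (Quotient.out b) *
      (Zhat G w b τ * e (weightExponent w * τ))

/-- The order embedding `n ↦ n • e_v` of `ℤ` into `ℤ^V`. -/
def singleEmbedding (v : V) : ℤ ↪o (V → ℤ) where
  toFun n := Pi.single v n
  inj' := Pi.single_injective (M := fun _ : V => ℤ) v
  map_rel_iff' := by
    intro a b
    exact Pi.single_le_single

/-- A Laurent series in one variable, regarded as a Laurent series in the variable `t_v` among
variables `t_u`, `u ∈ V`. -/
def inVariable (v : V) (φ : LaurentSeries ℂ) : HahnSeries (V → ℤ) ℂ :=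
  HahnSeries.embDomain (singleEmbedding v) φ

/-- The Laurent series `c e^t`. -/
def constMulExp (c : ℂ) : LaurentSeries ℂ :=
  HahnSeries.C c * ((PowerSeries.exp ℂ : PowerSeries ℂ) : LaurentSeries ℂ)

/-- The Laurent expansion at the origin, in the variables `t_v`, of the meromorphic function
`φ_{Γ,k}(t) = ∑_{μ ∈ ℤ^V / 2kℤ^V} 𝐞(ᵗμ W μ / 4k) ∏_v F_v(ζ_{2k}^(μ_v) e^(t_v))`;
the summand depends only on the class of `μ`, and `0 ≤ μ_v < 2k` are chosen as representatives. -/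
def phi (G : SimpleGraph V) [DecidableRel G.Adj] (w : V → ℤ) (k : ℕ) :
    HahnSeries (V → ℤ) ℂ :=
  ∑ μ : V → Fin (2 * k),
    HahnSeries.C (e (((fun v => ((μ v : ℕ) : ℤ)) ⬝ᵥ
        (linkingMatrix G w).mulVec (fun v => ((μ v : ℕ) : ℤ)) : ℤ) / (4 * k))) *
      ∏ v, inVariable v
        (vertexFactor (G.degree v) (constMulExp (e (1 / (2 * k)) ^ (μ v : ℕ))))

/-- The partial derivative `∂f/∂x_v`. -/
def partialDeriv (v : V) (f : (V → ℝ) → ℂ) : (V → ℝ) → ℂ :=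
  fun x => deriv (fun s : ℝ => f (Function.update x v s)) (x v)

/-- The partial antiderivative `-∫_{x_v}^∞ f(x) dx_v`, that is, `∂^(-1) f/∂x_v^(-1)`. -/
def partialAntideriv (v : V) (f : (V → ℝ) → ℂ) : (V → ℝ) → ℂ :=
  fun x => -∫ s in Set.Ioi (x v), f (Function.update x v s)

/-- The mixed derivative `f^(m)` for `m ∈ ℤ^V`, with antiderivatives in the variables `x_v` with
`m_v < 0`. (The operators for different variables commute on smooth functions of rapid decay, so
the order of the variables is immaterial.) -/
def mixedDeriv (m : V → ℤ) (f : (V → ℝ) → ℂ) : (V → ℝ) → ℂ :=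
  (Finset.univ : Finset V).toList.foldr (fun v g => (partialAntideriv v)^[(-m v).toNat] g)
    ((Finset.univ : Finset V).toList.foldr (fun v g => (partialDeriv v)^[(m v).toNat] g) f)

/-- The coefficient of `t^n` in the Hadamard product
`φ ⊙ f (t) = ∑_{m ∈ ℤ^V} B_m f^(m)(0) t^(∑ m_v)`, where `φ = ∑ B_m ∏ t_v^(m_v)`. -/
def hadamardCoeff (φ : HahnSeries (V → ℤ) ℂ) (f : (V → ℝ) → ℂ) (n : ℤ) : ℂ :=
  ∑ᶠ (m : V → ℤ) (_ : ∑ v, m v = n), φ.coeff m * mixedDeriv m f 0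

end Graph

/-- Poincaré's asymptotic expansion `g(t) ∼ ∑_{m ≥ -L} a_m s(t)^m` as `t → +0`, in powers of
`s(t)`. The sequence `a` is indexed by all integers and vanishes below `-L`. -/
def HasAsymptoticExpansion (g : ℝ → ℂ) (s : ℝ → ℝ) (a : ℤ → ℂ) : Prop :=
  ∃ L : ℕ, 0 < L ∧ (∀ m : ℤ, m < -(L : ℤ) → a m = 0) ∧
    ∀ M : ℝ, 0 < M → ∃ K : ℝ, 0 < K ∧ ∃ ε : ℝ, 0 < ε ∧ ∀ t ∈ Set.Ioo 0 ε,
      ‖g t - ∑ m ∈ Finset.Icc (-(L : ℤ)) ⌊M⌋, a m * ((s t : ℝ) : ℂ) ^ m‖ ≤ K * s t ^ M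

end GPPV

end

set_option linter.unusedSectionVars false

noncomputable section

namespace GPPV
open MeasureTheory Complex


/-! ### Sums and integrals of products over `V`; Gaussian majorants -/

section Products
variable {V : Type*} [Fintype V]

/-! Put A = -W, r = √t, and write B_m for the Laurent coefficients of φ. The weighted sum is first
written exactly as a finite combination of Gaussian contour integrals. These are expanded in powers
of r, and the coefficients are then shown not to depend on the choice of contours. Acyclicity of the
graph enters only at this last point.

Exact formula. On a torus |z_v| = 1 ± ε each F_v has a convergent Laurent series that depends only
on the sign s_v. So the torus integral is a series over l free of ε (`torusIntegral_integrand`), and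
the principal value is the mean over s of these series. At q = ζ_k e^(-t) the factor q^(Q(l)/4)
splits into the root of unity 𝐞(Q(l)/4k) and e^(-tQ(l)/4). Reciprocity of Gauss sums
(`quadratic_reciprocity`), obtained by comparing leading singularities in the theta inversion
formula, turns the sum over a into a sum over μ mod 2k; this produces both the constant of the
theorem and the phases of φ. Finally e^(-tQ(l)/4) is a Gaussian average of e^(i r l·ζ) over ζ ∈ ℝ^V
+ is, and summing over l under the integral resums the Laurent series to ∏ F_v(ζ_{2k}^(μ_v) e^(i r
ζ_v)) (`weightedSum_eq_contourIntegral`).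

Expansion. Since Im ζ_v = ±1, the integrand is bounded by a power of r⁻¹, and F_v may be replaced by
a Laurent polynomial in T = i r ζ_v with an error uniform up to e^|x|
(`exists_norm_vertexFactor_sub_le`). The coefficient of r^N is therefore a sum of B_m times the
Gaussian moment of ∏ (iζ_v)^(m_v) over |m| = N (`exists_contour_expansion`). If all contours lie in
the upper half-plane (s = 1), these moments are the mixed derivatives of e^(-Q/4) at 0 up to
normalization, because dividing by iζ_v is the antiderivative vanishing at +∞
(`mixedDeriv_gaussian`).

Sign independence. Changing s_v affects a moment only if m_v = -p < 0. The change is a residue at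
ζ_v = 0, a polynomial of degree < p in ∑ A_vu ζ_u over the neighbours u of v, and it leaves v
decoupled from the other variables (`exists_moment_flip`). A monomial of it involves at most p - 1 ≤
deg v - 3 neighbours, so some branch C of the tree at v is untouched. If B_m ≠ 0 and m_v < 0, then
∑_{x ∈ C} m_x is odd (`odd_sum_of_phiCoeff_ne_zero`): negating μ on C preserves the Gauss phase and
multiplies the Laurent coefficients by a sign. Hence the reflection ζ ↦ -ζ on C, which is now
decoupled, reverses the contribution (`moment_flipOn`). By induction on C the contribution is also
insensitive to the signs on C, so it equals its own negative and vanishes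
(`constrainedSum_eq_zero`). -/

theorem pi_count_int : Measure.pi (fun _ : V => (Measure.count : Measure ℤ)) = Measure.count := by
  refine Measure.ext_of_singleton (fun l => ?_)
  rw [Measure.pi_singleton]
  simp

theorem hasSum_prod_pi {f : V → ℤ → ℂ} (hf : ∀ v, Summable (fun n => ‖f v n‖)) :
    HasSum (fun l : V → ℤ => ∏ v, f v (l v)) (∏ v, ∑' n, f v n) := by
  have h1 : ∀ v, Integrable (f v) Measure.count := fun v => by
    rw [integrable_count_iff]; exact hf v
  have h2 := Integrable.fintype_prod h1
  rw [pi_count_int, integrable_count_iff] at h2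
  have h3 := integral_fintype_prod_eq_prod (𝕜 := ℂ) f (μ := fun _ => Measure.count)
  rw [pi_count_int, integral_countable (by rwa [integrable_count_iff])] at h3
  have h4 : ∀ v, ∫ x, f v x ∂Measure.count = ∑' n, f v n := fun v => by
    rw [integral_countable (h1 v)]; simp
  simp only [h4] at h3
  simp at h3
  rw [← h3]
  exact h2.of_norm.hasSum

theorem summable_norm_prod_pi {f : V → ℤ → ℂ} (hf : ∀ v, Summable (fun n => ‖f v n‖)) :
    Summable (fun l : V → ℤ => ‖∏ v, f v (l v)‖) := by
  have h1 : ∀ v, Integrable (f v) Measure.count := fun v => by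
    rw [integrable_count_iff]; exact hf v
  have h2 := Integrable.fintype_prod h1
  rwa [pi_count_int, integrable_count_iff] at h2

theorem summable_prod_pi_real {f : V → ℤ → ℝ} (h0 : ∀ v n, 0 ≤ f v n)
    (hf : ∀ v, Summable (f v)) : Summable (fun l : V → ℤ => ∏ v, f v (l v)) := by
  have := summable_norm_prod_pi (f := fun v n => (f v n : ℂ)) (fun v => by
    simpa [abs_of_nonneg (h0 _ _)] using hf v)
  refine this.congr (fun l => ?_)
  rw [norm_prod]
  simp [abs_of_nonneg (h0 _ _)]

/-- Completing the square. The spare `-|x|` on the right leaves a geometric majorant for sums over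
ℤ. -/
theorem quadratic_bound {c : ℝ} (hc : 0 < c) (a x : ℝ) :
    -c * x ^ 2 + a * |x| ≤ (a + 1) ^ 2 / (4 * c) - |x| := by
  have : 0 ≤ (2 * c * |x| - (a + 1)) ^ 2 / (4 * c) := by positivity
  have h2 : (2 * c * |x| - (a + 1)) ^ 2 / (4 * c) = c * |x| ^ 2 - (a + 1) * |x| + (a + 1) ^ 2 / (4 * c) := by
    field_simp; ring
  rw [h2, sq_abs] at this
  linarith

theorem summable_exp_neg_abs : Summable (fun n : ℤ => Real.exp (-|(n : ℝ)|)) := by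
  have h : Summable (fun n : ℕ => Real.exp (-|((n : ℤ) : ℝ)|)) := by
    refine (summable_geometric_of_lt_one (Real.exp_pos (-1)).le
      (by simp : Real.exp (-1) < 1)).congr (fun n => ?_)
    rw [← Real.exp_nat_mul]; simp
  refine Summable.of_nat_of_neg h ?_
  simpa using h

theorem summable_gaussian_int {c : ℝ} (hc : 0 < c) (a : ℝ) :
    Summable (fun n : ℤ => Real.exp (-c * (n : ℝ) ^ 2 + a * |(n : ℝ)|)) := by
  refine Summable.of_nonneg_of_le (fun _ => (Real.exp_pos _).le) (fun n => ?_)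
    (summable_exp_neg_abs.mul_left (Real.exp ((a + 1) ^ 2 / (4 * c))))
  rw [← Real.exp_add]
  exact Real.exp_le_exp.2 (by linarith [quadratic_bound hc a n])

theorem summable_gaussian_pi {c : ℝ} (hc : 0 < c) (a : ℝ) :
    Summable (fun l : V → ℤ => Real.exp (-c * ∑ v, (l v : ℝ) ^ 2 + a * ∑ v, |(l v : ℝ)|)) := by
  refine (summable_prod_pi_real (f := fun (_ : V) (n : ℤ) => Real.exp (-c * (n : ℝ) ^ 2 + a * |(n : ℝ)|))
    (fun _ _ => (Real.exp_pos _).le) (fun v => summable_gaussian_int hc a)).congr (fun l => ?_)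
  rw [← Real.exp_sum, Finset.sum_add_distrib, Finset.mul_sum, Finset.mul_sum]

theorem integrable_gaussian_real {c : ℝ} (hc : 0 < c) (a : ℝ) :
    Integrable (fun x : ℝ => Real.exp (-c * x ^ 2 + a * |x|)) := by
  have h : ∀ b : ℝ, Integrable (fun x : ℝ => Real.exp (-c * x ^ 2 + b * x)) := fun b => by
    have := (integrable_cexp_quadratic (b := (c : ℂ)) (by simpa using hc) b 0).norm
    refine this.congr (Filter.Eventually.of_forall fun x => ?_)
    simp only [Complex.norm_exp]
    congr 1
    norm_cast
    simp
  refine ((h a).add (h (-a))).mono' (by fun_prop) (Filter.Eventually.of_forall fun x => ?_)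
  rw [Real.norm_of_nonneg (Real.exp_pos _).le]
  simp only [Pi.add_apply]
  rcases abs_cases x with ⟨h, _⟩ | ⟨h, _⟩ <;> rw [h]
  · linarith [Real.exp_pos (-c * x ^ 2 + -a * x)]
  · rw [show a * -x = -a * x by ring]; linarith [Real.exp_pos (-c * x ^ 2 + a * x)]

theorem integrable_gaussian_pi {c : ℝ} (hc : 0 < c) (a : ℝ) :
    Integrable (fun x : V → ℝ => Real.exp (-c * ∑ v, x v ^ 2 + a * ∑ v, |x v|)) := by
  have := Integrable.fintype_prod (𝕜 := ℝ) (ι := V) (μ := fun _ => volume)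
    (f := fun _ (x : ℝ) => Real.exp (-c * x ^ 2 + a * |x|)) (fun v => integrable_gaussian_real hc a)
  refine this.congr (Filter.Eventually.of_forall fun x => ?_)
  simp only
  rw [← Real.exp_sum, Finset.sum_add_distrib, Finset.mul_sum, Finset.mul_sum]

end Products

/-! ### Positive definite forms and Gaussian integrals -/

section Forms
variable {V : Type*} [Fintype V]

/-- The complex bilinear form attached to a real matrix. -/
def cform (A : Matrix V V ℝ) (z w : V → ℂ) : ℂ := ∑ i, ∑ j, (A i j : ℂ) * z i * w j

theorem cform_ofReal (A : Matrix V V ℝ) (x y : V → ℝ) :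
    cform A (fun v => (x v : ℂ)) (fun v => (y v : ℂ)) = ((x ⬝ᵥ A.mulVec y : ℝ) : ℂ) := by
  simp only [cform, dotProduct, Matrix.mulVec, Finset.mul_sum]
  push_cast
  exact Finset.sum_congr rfl fun i _ => Finset.sum_congr rfl fun j _ => by ring

theorem cform_add_left (A : Matrix V V ℝ) (x y z : V → ℂ) :
    cform A (x + y) z = cform A x z + cform A y z := by
  simp only [cform, ← Finset.sum_add_distrib, Pi.add_apply]
  exact Finset.sum_congr rfl fun i _ => Finset.sum_congr rfl fun j _ => by ring

theorem cform_add_right (A : Matrix V V ℝ) (x y z : V → ℂ) :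
    cform A x (y + z) = cform A x y + cform A x z := by
  simp only [cform, ← Finset.sum_add_distrib, Pi.add_apply]
  exact Finset.sum_congr rfl fun i _ => Finset.sum_congr rfl fun j _ => by ring

theorem cform_smul_left (A : Matrix V V ℝ) (c : ℂ) (y z : V → ℂ) :
    cform A (c • y) z = c * cform A y z := by
  simp only [cform, Finset.mul_sum, Pi.smul_apply, smul_eq_mul]
  exact Finset.sum_congr rfl fun i _ => Finset.sum_congr rfl fun j _ => by ring

theorem cform_smul_right (A : Matrix V V ℝ) (c : ℂ) (y z : V → ℂ) :
    cform A y (c • z) = c * cform A y z := by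
  simp only [cform, Finset.mul_sum, Pi.smul_apply, smul_eq_mul]
  exact Finset.sum_congr rfl fun i _ => Finset.sum_congr rfl fun j _ => by ring

theorem cform_comm {A : Matrix V V ℝ} (hA : A.IsSymm) (z w : V → ℂ) :
    cform A z w = cform A w z := by
  simp only [cform]
  rw [Finset.sum_comm]
  exact Finset.sum_congr rfl fun i _ => Finset.sum_congr rfl fun j _ => by
    rw [← hA.apply i j]; ring

@[fun_prop]
theorem continuous_cform {X : Type*} [TopologicalSpace X] (A : Matrix V V ℝ) {f g : X → V → ℂ}
    (hf : Continuous f) (hg : Continuous g) : Continuous (fun x => cform A (f x) (g x)) := by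
  unfold cform
  fun_prop

open scoped MatrixOrder in
theorem exists_factor [DecidableEq V] {A : Matrix V V ℝ} (hA : A.PosDef) :
    ∃ B : Matrix V V ℝ, A = B.transpose * B ∧ IsUnit B.det := by
  obtain ⟨B, hB⟩ := CStarAlgebra.nonneg_iff_eq_star_mul_self.mp hA.posSemidef.nonneg
  rw [Matrix.star_eq_conjTranspose, Matrix.conjTranspose_eq_transpose_of_trivial] at hB
  refine ⟨B, hB, ?_⟩
  have := hA.det_pos
  rw [hB, Matrix.det_mul, Matrix.det_transpose] at this
  exact isUnit_iff_ne_zero.2 (by rintro h; simp [h] at this)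

/-- With A = ᵗB B, apply Cauchy–Schwarz to each row of x = B⁻¹(Bx). -/
theorem exists_coercive {A : Matrix V V ℝ} (hA : A.PosDef) :
    ∃ c > 0, ∀ x : V → ℝ, c * ∑ v, x v ^ 2 ≤ x ⬝ᵥ A.mulVec x := by
  classical
  obtain ⟨B, hB, hu⟩ := exists_factor hA
  set M := ∑ i, ∑ j, (B⁻¹ i j) ^ 2 with hM
  have hM0 : 0 ≤ M := by positivity
  refine ⟨(M + 1)⁻¹, by positivity, fun x => ?_⟩
  have h1 : x ⬝ᵥ A.mulVec x = ∑ v, (B.mulVec x v) ^ 2 := by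
    rw [hB, ← Matrix.mulVec_mulVec, Matrix.dotProduct_mulVec, Matrix.vecMul_transpose]
    simp [dotProduct, sq]
  have h2 : B⁻¹.mulVec (B.mulVec x) = x := by
    rw [Matrix.mulVec_mulVec, Matrix.nonsing_inv_mul _ hu, Matrix.one_mulVec]
  have h3 : ∑ v, x v ^ 2 ≤ M * ∑ v, (B.mulVec x v) ^ 2 := by
    conv_lhs => rw [← h2]
    rw [hM, Finset.sum_mul]
    refine Finset.sum_le_sum fun i _ => ?_
    exact Finset.sum_mul_sq_le_sq_mul_sq _ _ _
  rw [h1, inv_mul_le_iff₀ (by positivity)]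
  have : 0 ≤ ∑ v, (B.mulVec x v) ^ 2 := by positivity
  nlinarith

/-- The substitution x = B⁻¹u, where A = ᵗB B, reduces to the standard Gaussian with Jacobian (det
A)^(-1/2). The linear term is complex so that one formula serves both Fourier transforms and shifted
contours. -/
theorem integral_gaussian_linear [DecidableEq V] {A : Matrix V V ℝ} (hA : A.PosDef) {p : ℂ}
    (hp : 0 < p.re) (c : V → ℂ) :
    ∫ x : V → ℝ, cexp (-p * cform A (fun v => (x v : ℂ)) (fun v => (x v : ℂ)) + ∑ v, c v * x v) =
      (Real.pi / p) ^ (Fintype.card V / 2 : ℂ) * ((Real.sqrt A.det)⁻¹ : ℝ) *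
        cexp (cform A⁻¹ c c / (4 * p)) := by
  obtain ⟨B, hB, hu⟩ := exists_factor hA
  have hdet : (B⁻¹).det ≠ 0 := (Matrix.isUnit_nonsing_inv_det B hu).ne_zero
  set g : (V → ℝ) → ℂ := fun x =>
    cexp (-p * cform A (fun v => (x v : ℂ)) (fun v => (x v : ℂ)) + ∑ v, c v * x v) with hg
  have hgc : Continuous g := by rw [hg]; fun_prop
  have hmap := Real.map_matrix_volume_pi_eq_smul_volume_pi hdet
  have h1 : ∫ x, g x ∂(Measure.map (Matrix.toLin' B⁻¹) volume) = ∫ u, g (B⁻¹.mulVec u) := by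
    rw [integral_map]
    · rfl
    · exact (LinearMap.continuous_of_finiteDimensional _).aemeasurable
    · exact hgc.aestronglyMeasurable
  rw [hmap, integral_smul_measure] at h1
  have hsq : |(B⁻¹.det)| = (Real.sqrt A.det)⁻¹ := by
    rw [hB, Matrix.det_mul, Matrix.det_transpose, Real.sqrt_mul_self_eq_abs,
      Matrix.det_nonsing_inv, Ring.inverse_eq_inv', abs_inv]
  have h2 : ∫ x, g x = ((Real.sqrt A.det)⁻¹ : ℝ) • ∫ u, g (B⁻¹.mulVec u) := by
    rw [← h1, ENNReal.toReal_ofReal (by positivity), smul_smul, ← hsq, abs_inv,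
      mul_inv_cancel₀ (by positivity), one_smul]
  have h3 : ∀ u : V → ℝ, g (B⁻¹.mulVec u) =
      cexp (-p * ∑ i, (u i : ℂ) ^ 2 + ∑ i, (∑ k, c k * (B⁻¹ k i : ℂ)) * u i) := fun u => by
    rw [hg]
    simp only
    rw [cform_ofReal]
    congr 2
    · congr 1
      rw [hB, ← Matrix.mulVec_mulVec, Matrix.dotProduct_mulVec, Matrix.vecMul_transpose,
        Matrix.mulVec_mulVec, Matrix.mul_nonsing_inv _ hu, Matrix.one_mulVec]
      simp [dotProduct, sq]
    · simp only [Matrix.mulVec, dotProduct]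
      push_cast
      simp only [Finset.mul_sum, Finset.sum_mul]
      rw [Finset.sum_comm]
      exact Finset.sum_congr rfl fun i _ => Finset.sum_congr rfl fun j _ => by ring
  rw [h2]
  simp only [h3]
  rw [GaussianFourier.integral_cexp_neg_mul_sum_add hp]
  have h4 : ∑ i, (∑ k, c k * (B⁻¹ k i : ℂ)) ^ 2 = cform A⁻¹ c c := by
    have : A⁻¹ = B⁻¹ * (B⁻¹).transpose := by
      rw [hB, Matrix.mul_inv_rev, Matrix.transpose_nonsing_inv]
    rw [this]
    simp only [cform, Matrix.mul_apply, Matrix.transpose_apply]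
    push_cast
    simp only [sq, Finset.sum_mul, Finset.mul_sum]
    rw [Finset.sum_comm]
    refine Finset.sum_congr rfl fun i _ => ?_
    rw [Finset.sum_comm]
    exact Finset.sum_congr rfl fun j _ => Finset.sum_congr rfl fun k _ => by ring
  rw [h4, Complex.real_smul]
  ring

end Forms


/-! ### Poisson summation, theta inversion and its leading singularity -/

section Poisson
variable {V : Type*} [Fintype V]

theorem isOpenQuotientMap_torus :
    IsOpenQuotientMap (fun (x : V → ℝ) (i : V) => (x i : UnitAddCircle)) := by
  exact IsOpenQuotientMap.piMap (fun _ : V => QuotientAddGroup.isOpenQuotientMap_mk)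

theorem exists_int_of_coe_eq {x y : ℝ} (h : (x : UnitAddCircle) = y) : ∃ n : ℤ, y = x + n := by
  obtain ⟨n, hn⟩ := QuotientAddGroup.eq.1 h
  refine ⟨n, ?_⟩
  simp only [zsmul_eq_mul, mul_one] at hn
  linarith

/-- The unit cube translated by an integral vector. -/
def cube (l : V → ℤ) : Set (V → ℝ) := {x | ∀ i, x i ∈ Set.Ioc (l i : ℝ) (l i + 1)}

theorem measurableSet_cube (l : V → ℤ) : MeasurableSet (cube l) :=
  MeasurableSet.univ_pi' (fun _ => measurableSet_Ioc)

theorem hasSum_integral_cube {E : Type*} [NormedAddCommGroup E] [NormedSpace ℝ E] {f : (V → ℝ) → E}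
    (hf : Integrable f) :
    HasSum (fun l : V → ℤ => ∫ x in cube (0 : V → ℤ), f (x + fun v => (l v : ℝ))) (∫ x, f x) := by
  have hd : Pairwise (Function.onFun Disjoint (cube (V := V))) := by
    intro l m hlm
    refine Set.disjoint_left.2 fun x hx hy => hlm (funext fun i => ?_)
    have h1 := hx i
    have h2 := hy i
    simp only [Set.mem_Ioc] at h1 h2
    have a1 : (l i : ℝ) < m i + 1 := by linarith
    have a2 : (m i : ℝ) < l i + 1 := by linarith
    norm_cast at a1 a2
    omega
  have hU : (⋃ l, cube (V := V) l) = Set.univ := by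
    refine Set.eq_univ_of_forall fun x => Set.mem_iUnion.2 ⟨fun i => ⌈x i⌉ - 1, fun i => ?_⟩
    have h1 := Int.ceil_lt_add_one (x i)
    have h2 := Int.le_ceil (x i)
    simp only [Set.mem_Ioc]
    push_cast
    constructor <;> linarith
  have := hasSum_integral_iUnion (f := f) (μ := volume) (fun l => measurableSet_cube l) hd
    (by rw [hU]; exact hf.integrableOn)
  rw [hU, setIntegral_univ] at this
  convert this using 2 with l
  have hmp : MeasurePreserving (fun x : V → ℝ => x + fun v => (l v : ℝ)) volume volume :=
    measurePreserving_add_right _ _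
  rw [← hmp.setIntegral_preimage_emb (measurableEmbedding_addRight _) f (cube l)]
  congr 2
  ext x
  simp [cube]
  refine forall_congr' fun i => ?_
  constructor <;> rintro ⟨h1, h2⟩ <;> constructor <;> linarith

/-- The periodization of g is continuous by the local domination `hb` and descends to the torus. Its
Fourier coefficients unfold to the Fourier transform of g, and since these are summable the Fourier
series converges to it at every point. -/
theorem poisson_summation {g : (V → ℝ) → ℂ} (hg : Continuous g) (hi : Integrable g)
    (hb : ∀ R : ℝ, ∃ u : (V → ℤ) → ℝ, Summable u ∧ ∀ x : V → ℝ, (∀ v, |x v| ≤ R) → ∀ l : V → ℤ,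
      ‖g (x + fun v => (l v : ℝ))‖ ≤ u l)
    (hs : Summable fun n : V → ℤ => ‖∫ x, cexp (-(2 * Real.pi * I * ∑ v, (n v : ℂ) * x v)) * g x‖)
    (b : V → ℝ) :
    ∑' l : V → ℤ, g (b + fun v => (l v : ℝ)) = ∑' n : V → ℤ,
      (∫ x, cexp (-(2 * Real.pi * I * ∑ v, (n v : ℂ) * x v)) * g x) *
        cexp (2 * Real.pi * I * ∑ v, (n v : ℂ) * b v) := by
  set S : (V → ℝ) → ℂ := fun x => ∑' l : V → ℤ, g (x + fun v => (l v : ℝ)) with hS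
  have hc : Continuous S := by
    rw [continuous_iff_continuousAt]
    intro x
    obtain ⟨u, hu, hub⟩ := hb (‖x‖ + 1)
    have : ContinuousOn S (Metric.ball 0 (‖x‖ + 1)) := by
      refine continuousOn_tsum (fun l => by fun_prop) hu (fun l y hy => hub y (fun v => ?_) l)
      have h1 := norm_le_pi_norm y v
      rw [mem_ball_zero_iff] at hy
      rw [← Real.norm_eq_abs]; linarith
    exact this.continuousAt (Metric.isOpen_ball.mem_nhds (by simp))
  have hper : ∀ (x : V → ℝ) (m : V → ℤ), S (x + fun v => (m v : ℝ)) = S x := fun x m => by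
    simp only [hS]
    rw [← (Equiv.addLeft m).tsum_eq (fun l : V → ℤ => g (x + fun v => (l v : ℝ)))]
    refine tsum_congr fun l => congrArg g ?_
    ext v
    simp [add_assoc]
  let q : C(V → ℝ, UnitAddTorus V) :=
    ⟨fun (x : V → ℝ) (i : V) => (x i : UnitAddCircle), isOpenQuotientMap_torus.continuous⟩
  have hq : Topology.IsQuotientMap q := isOpenQuotientMap_torus.isQuotientMap
  have hfac : Function.FactorsThrough (⟨S, hc⟩ : C(V → ℝ, ℂ)) q := fun x y hxy => by
    have : ∀ v, ∃ n : ℤ, y v = x v + n := fun v => exists_int_of_coe_eq (congrFun hxy v)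
    choose n hn using this
    have h2 : y = x + fun v => (n v : ℝ) := funext hn
    simp only [ContinuousMap.coe_mk]
    rw [h2, hper]
  let F : C(UnitAddTorus V, ℂ) := hq.lift ⟨S, hc⟩ hfac
  have hF : ∀ x, F (q x) = S x := fun x =>
    congrArg (fun f : C(V → ℝ, ℂ) => f x) (hq.lift_comp ⟨S, hc⟩ hfac)
  have hfour : ∀ (n : V → ℤ) (x : V → ℝ),
      UnitAddTorus.mFourier n (q x) = cexp (2 * Real.pi * I * ∑ v, (n v : ℂ) * x v) := fun n x => by
    simp only [UnitAddTorus.mFourier, ContinuousMap.coe_mk, q]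
    simp only [fourier_coe_apply]
    rw [← Complex.exp_sum, Finset.mul_sum]
    congr 1
    refine Finset.sum_congr rfl fun v _ => ?_
    push_cast; ring
  have hcoef : ∀ n, UnitAddTorus.mFourierCoeff F n =
      ∫ x, cexp (-(2 * Real.pi * I * ∑ v, (n v : ℂ) * x v)) * g x := fun n => by
    rw [UnitAddTorus.mFourierCoeff_eq_integral _ _ 0]
    set h : (V → ℝ) → ℂ := fun x => cexp (-(2 * Real.pi * I * ∑ v, (n v : ℂ) * x v)) * g x with hh
    have hnorm : ∀ x, ‖h x‖ = ‖g x‖ := fun x => by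
      rw [hh, norm_mul, Complex.norm_exp]
      have : (-(2 * Real.pi * I * ∑ v, (n v : ℂ) * (x v : ℂ))).re = 0 := by
        rw [show (-(2 * Real.pi * I * ∑ v, (n v : ℂ) * (x v : ℂ))) =
          ((-(2 * Real.pi * ∑ v, (n v : ℝ) * x v) : ℝ) : ℂ) * I by push_cast; ring]
        rw [Complex.re_ofReal_mul]; simp
      rw [this]; simp
    have hhc : Continuous h := by rw [hh]; fun_prop
    have hint : Integrable h := (integrable_norm_iff hhc.aestronglyMeasurable).1
      (by simp only [hnorm]; exact hi.norm)
    have h1 := hasSum_integral_cube hint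
    rw [← h1.tsum_eq]
    have h3 : Summable fun l : V → ℤ => ∫ x in cube (0 : V → ℤ), ‖h (x + fun v => (l v : ℝ))‖ :=
      (hasSum_integral_cube hint.norm).summable
    have h4 := hasSum_integral_of_summable_integral_norm
      (F := fun (l : V → ℤ) x => h (x + fun v => (l v : ℝ)))
      (μ := volume.restrict (cube (0 : V → ℤ)))
      (fun l => (hint.comp_add_right _).integrableOn) h3
    rw [h4.tsum_eq]
    have hset : {x : V → ℝ | ∀ i, x i ∈ Set.Ioc ((0 : V → ℝ) i) ((0 : V → ℝ) i + 1)} = cube 0 := by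
      simp [cube]
    rw [hset]
    refine setIntegral_congr_fun (measurableSet_cube 0) fun x _ => ?_
    simp only [smul_eq_mul]
    have e1 := hfour (-n) x
    have e2 := hF x
    simp only [q, ContinuousMap.coe_mk] at e1 e2
    rw [e1, e2, hS, ← tsum_mul_left]
    refine tsum_congr fun l => ?_
    simp only [hh]
    congr 1
    have : (2 * Real.pi * I * ∑ v, ((-n) v : ℂ) * (x v : ℂ)) =
      -(2 * Real.pi * I * ∑ v, (n v : ℂ) * ((x + fun v => (l v : ℝ)) v : ℝ)) +
        ((∑ v, n v * l v : ℤ) : ℂ) * (2 * Real.pi * I) := by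
      simp only [Pi.neg_apply, Pi.add_apply]
      push_cast
      simp only [mul_add, Finset.sum_add_distrib, neg_mul, Finset.sum_neg_distrib]
      ring
    simp only [Pi.neg_apply, Int.cast_neg] at this ⊢
    rw [this, Complex.exp_add, Complex.exp_int_mul_two_pi_mul_I, mul_one]
  have hsum : Summable (UnitAddTorus.mFourierCoeff F) := by
    refine Summable.of_norm (hs.congr fun n => ?_)
    rw [hcoef]
  have := UnitAddTorus.hasSum_mFourier_series_apply_of_summable hsum (q b)
  rw [hF] at this
  change S b = _
  rw [← this.tsum_eq]
  refine tsum_congr fun n => ?_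
  rw [hcoef, hfour, smul_eq_mul]

theorem norm_gaussian (A : Matrix V V ℝ) (p : ℂ) (x : V → ℝ) :
    ‖cexp (-p * cform A (fun v => (x v : ℂ)) (fun v => (x v : ℂ)))‖ =
      Real.exp (-p.re * (x ⬝ᵥ A.mulVec x)) := by
  rw [cform_ofReal, Complex.norm_exp, Complex.re_mul_ofReal, Complex.neg_re]

/-- Coercivity together with |x_v l_v| ≤ R |l_v|. Uniformity for x in a box is what the domination
hypothesis of `poisson_summation` asks for. -/
theorem exists_gaussian_bound {A : Matrix V V ℝ} (hA : A.PosDef) {p : ℝ} (hp : 0 < p) :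
    ∃ c > 0, ∀ (R : ℝ) (x : V → ℝ), (∀ v, |x v| ≤ R) → ∀ l : V → ℝ,
      Real.exp (-p * ((x + l) ⬝ᵥ A.mulVec (x + l))) ≤
        Real.exp (-c * ∑ v, l v ^ 2 + 2 * c * R * ∑ v, |l v|) := by
  obtain ⟨c, hc, h⟩ := exists_coercive hA
  refine ⟨p * c, by positivity, fun R x hx l => Real.exp_le_exp.2 ?_⟩
  have h1 := h (x + l)
  have h2 : ∑ v, l v ^ 2 - 2 * R * ∑ v, |l v| ≤ ∑ v, (x + l) v ^ 2 := by
    rw [Finset.mul_sum, ← Finset.sum_sub_distrib]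
    refine Finset.sum_le_sum fun v _ => ?_
    simp only [Pi.add_apply]
    have h3 : |x v * l v| ≤ R * |l v| := by
      rw [abs_mul]; exact mul_le_mul_of_nonneg_right (hx v) (abs_nonneg _)
    have h4 := neg_abs_le (x v * l v)
    nlinarith [sq_nonneg (x v)]
  have h5 : p * (c * (∑ v, l v ^ 2 - 2 * R * ∑ v, |l v|)) ≤ p * ((x + l) ⬝ᵥ A.mulVec (x + l)) :=
    mul_le_mul_of_nonneg_left ((mul_le_mul_of_nonneg_left h2 hc.le).trans h1) hp.le
  linarith

theorem summable_norm_gaussian {A : Matrix V V ℝ} (hA : A.PosDef) {p : ℂ} (hp : 0 < p.re)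
    (b : V → ℝ) : Summable fun l : V → ℤ =>
      ‖cexp (-p * cform A (fun v => ((b v + l v : ℝ) : ℂ)) (fun v => ((b v + l v : ℝ) : ℂ)))‖ := by
  obtain ⟨c, hc, h⟩ := exists_gaussian_bound hA hp
  refine Summable.of_nonneg_of_le (fun _ => norm_nonneg _) (fun l => ?_)
    (summable_gaussian_pi hc (2 * c * ‖b‖))
  have := norm_gaussian A p (b + fun v => (l v : ℝ))
  simp only [Pi.add_apply] at this
  rw [this]
  exact h ‖b‖ b (fun v => norm_le_pi_norm b v) (fun v => (l v : ℝ))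

theorem theta_inversion [DecidableEq V] {A : Matrix V V ℝ} (hA : A.PosDef) {p : ℂ} (hp : 0 < p.re)
    (b : V → ℝ) :
    ∑' l : V → ℤ,
      cexp (-p * cform A (fun v => ((b v + l v : ℝ) : ℂ)) (fun v => ((b v + l v : ℝ) : ℂ))) =
    (Real.pi / p) ^ (Fintype.card V / 2 : ℂ) * ((Real.sqrt A.det)⁻¹ : ℝ) *
    ∑' n : V → ℤ, cexp (-(Real.pi ^ 2 / p) * cform A⁻¹ (fun v => ((n v : ℝ) : ℂ))
      (fun v => ((n v : ℝ) : ℂ)) + 2 * Real.pi * I * ∑ v, (n v : ℂ) * b v) := by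
  have hp0 : p ≠ 0 := by rintro rfl; simp at hp
  have hpi : 0 < (Real.pi ^ 2 / p : ℂ).re := by
    rw [show (Real.pi ^ 2 / p : ℂ) = ((Real.pi ^ 2 : ℝ) : ℂ) * p⁻¹ by push_cast; ring,
      Complex.re_ofReal_mul, Complex.inv_re]
    have := Complex.normSq_pos.2 hp0
    positivity
  set g : (V → ℝ) → ℂ := fun x => cexp (-p * cform A (fun v => (x v : ℂ)) (fun v => (x v : ℂ)))
    with hg
  have hgc : Continuous g := by rw [hg]; fun_prop
  obtain ⟨c, hc, h⟩ := exists_gaussian_bound hA hp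
  have hb : ∀ R : ℝ, ∃ u : (V → ℤ) → ℝ, Summable u ∧ ∀ x : V → ℝ, (∀ v, |x v| ≤ R) →
      ∀ l : V → ℤ, ‖g (x + fun v => (l v : ℝ))‖ ≤ u l := fun R =>
    ⟨_, summable_gaussian_pi hc (2 * c * R), fun x hx l => by
      rw [hg, norm_gaussian]; exact h R x hx _⟩
  have hi : Integrable g := by
    refine (integrable_gaussian_pi hc 0).mono' hgc.aestronglyMeasurable
      (Filter.Eventually.of_forall fun x => ?_)
    have := h 0 0 (by simp) x
    rw [hg, norm_gaussian]
    simpa using this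
  have hhat : ∀ n : V → ℤ, ∫ x, cexp (-(2 * Real.pi * I * ∑ v, (n v : ℂ) * x v)) * g x =
      (Real.pi / p) ^ (Fintype.card V / 2 : ℂ) * ((Real.sqrt A.det)⁻¹ : ℝ) *
        cexp (-(Real.pi ^ 2 / p) * cform A⁻¹ (fun v => ((n v : ℝ) : ℂ))
          (fun v => ((n v : ℝ) : ℂ))) := fun n => by
    have h1 := integral_gaussian_linear hA hp ((-(2 * Real.pi * I)) • fun v => ((n v : ℝ) : ℂ))
    rw [cform_smul_left, cform_smul_right] at h1
    rw [show -(Real.pi ^ 2 / p : ℂ) * cform A⁻¹ (fun v => ((n v : ℝ) : ℂ)) (fun v => ((n v : ℝ) : ℂ))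
      = -(2 * Real.pi * I) * (-(2 * Real.pi * I) * cform A⁻¹ (fun v => ((n v : ℝ) : ℂ))
        (fun v => ((n v : ℝ) : ℂ))) / (4 * p) by
          field_simp; ring_nf; rw [I_sq]; ring, ← h1]
    refine integral_congr_ae (Filter.Eventually.of_forall fun x => ?_)
    simp only [hg]
    rw [← Complex.exp_add, add_comm]
    congr 2
    simp only [Pi.smul_apply, smul_eq_mul, Finset.mul_sum, ← Finset.sum_neg_distrib]
    refine Finset.sum_congr rfl fun v _ => ?_
    push_cast; ring
  have hs : Summable fun n : V → ℤ => ‖∫ x, cexp (-(2 * Real.pi * I * ∑ v, (n v : ℂ) * x v)) * g x‖ := by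
    simp only [hhat, norm_mul]
    refine Summable.mul_left _ ?_
    simpa using summable_norm_gaussian hA.inv hpi 0
  have := poisson_summation hgc hi hb hs b
  simp only [hg, Pi.add_apply] at this
  rw [this, ← tsum_mul_left]
  refine tsum_congr fun n => ?_
  have := hhat n
  simp only [hg] at this
  rw [this, Complex.exp_add]
  ring

theorem ofReal_mul_cpow {s : ℝ} (hs : 0 < s) {z : ℂ} (hz : z ≠ 0) (w : ℂ) :
    ((s : ℂ) * z) ^ w = (s : ℂ) ^ w * z ^ w := by
  have hs' : (s : ℂ) ≠ 0 := by exact_mod_cast hs.ne'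
  rw [Complex.cpow_def_of_ne_zero (mul_ne_zero hs' hz), Complex.cpow_def_of_ne_zero hs',
    Complex.cpow_def_of_ne_zero hz, Complex.log_ofReal_mul hs hz, Complex.ofReal_log hs.le,
    add_mul, Complex.exp_add]

/-- The leading behaviour of a shifted Gaussian lattice sum. -/
theorem tendsto_theta [DecidableEq V] {A : Matrix V V ℝ} (hA : A.PosDef) (b : V → ℝ) {β : ℝ → ℂ}
    {ρ : ℝ} (hρ : 0 < ρ) (hβ : Filter.Tendsto (fun s : ℝ => β s / s) (𝓝[>] 0) (𝓝 ρ)) :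
    Filter.Tendsto (fun s : ℝ => (s : ℂ) ^ (Fintype.card V / 2 : ℂ) * ∑' l : V → ℤ,
      cexp (-β s * cform A (fun v => ((b v + l v : ℝ) : ℂ)) (fun v => ((b v + l v : ℝ) : ℂ))))
      (𝓝[>] 0) (𝓝 ((Real.pi / ρ : ℂ) ^ (Fintype.card V / 2 : ℂ) * ((Real.sqrt A.det)⁻¹ : ℝ))) := by
  have hinv : Filter.Tendsto (fun s : ℝ => (s : ℂ) / β s) (𝓝[>] 0) (𝓝 (ρ⁻¹ : ℂ)) := by
    refine (hβ.inv₀ (by exact_mod_cast hρ.ne')).congr fun s => ?_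
    rw [inv_div]
  have hre : Filter.Tendsto (fun s : ℝ => ((s : ℂ) / β s).re) (𝓝[>] 0) (𝓝 ρ⁻¹) := by
    have := (Complex.continuous_re.tendsto _).comp hinv
    rw [← Complex.ofReal_inv, Complex.ofReal_re] at this
    exact this
  have hev : ∀ᶠ s : ℝ in 𝓝[>] (0 : ℝ), ρ⁻¹ / 2 < ((s : ℂ) / β s).re :=
    hre.eventually (lt_mem_nhds (by have : 0 < ρ⁻¹ := by positivity
                                    linarith))
  have hs0 : ∀ᶠ s : ℝ in 𝓝[>] (0 : ℝ), 0 < s ∧ s < 1 := Ioo_mem_nhdsGT one_pos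
  obtain ⟨c, hc, hcb⟩ := exists_coercive hA.inv
  set T : ℝ → (V → ℤ) → ℂ := fun s n => cexp (-(Real.pi ^ 2 / β s) *
    cform A⁻¹ (fun v => ((n v : ℝ) : ℂ)) (fun v => ((n v : ℝ) : ℂ)) +
      2 * Real.pi * I * ∑ v, (n v : ℂ) * b v) with hT
  have hTn : ∀ (s : ℝ) (n : V → ℤ), 0 < s → ρ⁻¹ / 2 < ((s : ℂ) / β s).re →
      ‖T s n‖ ≤ Real.exp (-(Real.pi ^ 2 * (ρ⁻¹ / 2) * c / s) * ∑ v, (n v : ℝ) ^ 2) := by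
    intro s n hs hsb
    rw [hT, Complex.norm_exp]
    refine Real.exp_le_exp.2 ?_
    rw [cform_ofReal, Complex.add_re,
      show (2 * Real.pi * I * ∑ v, (n v : ℂ) * b v) = ((2 * Real.pi * ∑ v, (n v : ℝ) * b v : ℝ) : ℂ) * I by
        push_cast; ring, Complex.re_ofReal_mul, Complex.I_re, mul_zero, add_zero,
      Complex.re_mul_ofReal, Complex.neg_re]
    have e1 : (Real.pi ^ 2 / β s : ℂ) = ((Real.pi ^ 2 / s : ℝ) : ℂ) * (s / β s) := by
      have : (s : ℂ) ≠ 0 := by exact_mod_cast hs.ne'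
      push_cast; field_simp
    rw [e1, Complex.re_ofReal_mul]
    have h2 := hcb (fun v => (n v : ℝ))
    have h4 : 0 ≤ ∑ v, (n v : ℝ) ^ 2 := by positivity
    have h3 : Real.pi ^ 2 / s * (ρ⁻¹ / 2) * (c * ∑ v, (n v : ℝ) ^ 2) ≤
        Real.pi ^ 2 / s * ((s : ℂ) / β s).re *
          ((fun v => (n v : ℝ)) ⬝ᵥ A⁻¹.mulVec (fun v => (n v : ℝ))) := by
      have h6 : 0 ≤ ((s : ℂ) / β s).re := le_trans (by positivity) hsb.le
      refine mul_le_mul ?_ h2 (by positivity) (by positivity)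
      gcongr
    have h5 : Real.pi ^ 2 * (ρ⁻¹ / 2) * c / s * ∑ v, (n v : ℝ) ^ 2 =
      Real.pi ^ 2 / s * (ρ⁻¹ / 2) * (c * ∑ v, (n v : ℝ) ^ 2) := by ring
    linarith
  set κ := Real.pi ^ 2 * (ρ⁻¹ / 2) * c with hκ
  have hκ0 : 0 < κ := by positivity
  -- After inversion the terms with n ≠ 0 decay like exp(-κ|n|²/s) and vanish in the limit. Since s
  -- < 1, κ/s ≥ κ, so the value at s = 1 dominates.
  have hlim : Filter.Tendsto (fun s => ∑' n, T s n) (𝓝[>] 0)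
      (𝓝 (∑' n : V → ℤ, if n = 0 then (1 : ℂ) else 0)) := by
    refine tendsto_tsum_of_dominated_convergence (summable_gaussian_pi (V := V) hκ0 0) (fun n => ?_) ?_
    · by_cases hn : n = 0
      · subst hn
        simp [hT, cform]
      · rw [if_neg hn]
        refine squeeze_zero_norm' (a := fun s : ℝ => Real.exp (-(κ * ∑ v, (n v : ℝ) ^ 2) * s⁻¹)) ?_ ?_
        · filter_upwards [hev, hs0] with s h1 h2
          refine (hTn s n h2.1 h1).trans (le_of_eq ?_)
          congr 1; ring
        · refine Real.tendsto_exp_atBot.comp ?_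
          refine Filter.Tendsto.const_mul_atTop_of_neg ?_ tendsto_inv_nhdsGT_zero
          obtain ⟨v, hv⟩ := Function.ne_iff.1 hn
          have : 0 < ∑ v, (n v : ℝ) ^ 2 := by
            refine Finset.sum_pos' (fun _ _ => sq_nonneg _) ⟨v, Finset.mem_univ _, ?_⟩
            have : (n v : ℝ) ≠ 0 := by exact_mod_cast hv
            positivity
          nlinarith
    · filter_upwards [hev, hs0] with s h1 h2 n
      refine (hTn s n h2.1 h1).trans (Real.exp_le_exp.2 ?_)
      have h4 : 0 ≤ ∑ v, (n v : ℝ) ^ 2 := by positivity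
      have : κ ≤ κ / s := by rw [le_div_iff₀ h2.1]; nlinarith [h2.2]
      nlinarith
  rw [tsum_ite_eq] at hlim
  have hpow : Filter.Tendsto (fun s : ℝ => (Real.pi * (s / β s) : ℂ) ^ (Fintype.card V / 2 : ℂ))
      (𝓝[>] 0) (𝓝 ((Real.pi / ρ : ℂ) ^ (Fintype.card V / 2 : ℂ))) := by
    rw [div_eq_mul_inv (Real.pi : ℂ) (ρ : ℂ)]
    refine (hinv.const_mul _).cpow tendsto_const_nhds ?_
    rw [← Complex.ofReal_inv, ← Complex.ofReal_mul]
    exact Complex.ofReal_mem_slitPlane.2 (by positivity)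
  have := (hpow.mul_const (((Real.sqrt A.det)⁻¹ : ℝ) : ℂ)).mul hlim
  rw [mul_one] at this
  refine this.congr' ?_
  filter_upwards [hev, hs0] with s h1 h2
  have hspos := h2.1
  have hsb : 0 < ((s : ℂ) / β s).re := lt_trans (by positivity) h1
  have hβ0 : β s ≠ 0 := by
    intro h; rw [h] at hsb; simp at hsb
  have hβre : 0 < (β s).re := by
    rw [div_eq_mul_inv, Complex.re_ofReal_mul, Complex.inv_re] at hsb
    have hn := Complex.normSq_pos.2 hβ0
    have := (pos_iff_pos_of_mul_pos hsb).1 h2.1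
    exact (div_pos_iff_of_pos_right hn).1 this
  rw [theta_inversion hA hβre b, ← mul_assoc, ← mul_assoc]
  congr 2
  rw [show (Real.pi * (s / β s) : ℂ) = s * (Real.pi / β s) by ring]
  exact ofReal_mul_cpow hspos (div_ne_zero (by exact_mod_cast Real.pi_ne_zero) hβ0) _

end Poisson


theorem e_add (x y : ℂ) : e (x + y) = e x * e y := by
  simp only [e, mul_add, Complex.exp_add]

theorem e_zero : e 0 = 1 := by simp [e]

theorem e_int (n : ℤ) : e n = 1 := by
  rw [e, mul_comm, Complex.exp_int_mul_two_pi_mul_I]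

theorem e_add_int (x : ℂ) (n : ℤ) : e (x + n) = e x := by rw [e_add, e_int, mul_one]

theorem e_ne_zero (x : ℂ) : e x ≠ 0 := Complex.exp_ne_zero _

theorem norm_e (x : ℂ) : ‖e x‖ = Real.exp (-(2 * Real.pi * x.im)) := by
  rw [e, Complex.norm_exp]
  congr 1
  simp

theorem e_sum {ι : Type*} (s : Finset ι) (f : ι → ℂ) : e (∑ i ∈ s, f i) = ∏ i ∈ s, e (f i) := by
  simp only [e, Finset.mul_sum, Complex.exp_sum]

/-! ### Reciprocity of quadratic Gauss sums -/

section Lattice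
variable {V : Type*} [Fintype V] [DecidableEq V] {W : Matrix V V ℤ}

theorem finite_coker (hW : W.det ≠ 0) : Finite (Coker W) := by
  refine Submodule.finiteQuotientOfFreeOfRankEq _ ?_
  exact LinearMap.finrank_range_of_inj (Matrix.mulVec_injective_of_det_ne_zero hW)

/-- Division with remainder by the lattice `W ℤ^V`. -/
def latticeEquiv (hW : W.det ≠ 0) : Coker W × (V → ℤ) ≃ (V → ℤ) :=
  Equiv.ofBijective (fun p => Quotient.out p.1 + W.mulVec p.2) (by
    have hmk : ∀ (a : Coker W) (y : V → ℤ),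
        (toCoker W (Quotient.out a + W.mulVec y)) = a := fun a y => by
      have h1 : toCoker W (Quotient.out a) = a := Quotient.out_eq a
      have h2 : toCoker W (W.mulVec y) = 0 :=
        (Submodule.Quotient.mk_eq_zero _).2 ⟨y, rfl⟩
      change Submodule.Quotient.mk _ = _
      rw [Submodule.Quotient.mk_add]
      exact (congrArg₂ (· + ·) h1 h2).trans (add_zero _)
    constructor
    · rintro ⟨a, y⟩ ⟨a', y'⟩ h
      simp only at h
      have h1 : a = a' := by rw [← hmk a y, h, hmk]
      subst h1
      rw [Matrix.mulVec_injective_of_det_ne_zero hW (add_left_cancel h)]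
    · intro x
      have h1 : toCoker W (Quotient.out (toCoker W x)) = toCoker W x := Quotient.out_eq _
      obtain ⟨y, hy⟩ := (Submodule.Quotient.eq _).1 h1.symm
      refine ⟨(toCoker W x, y), ?_⟩
      simp only
      rw [Matrix.mulVecLin_apply] at hy
      rw [hy]; abel)

/-- Coordinatewise division with remainder by `N`. -/
def residueEquiv (N : ℕ) (hN : 0 < N) : (V → Fin N) × (V → ℤ) ≃ (V → ℤ) :=
  Equiv.ofBijective (fun p v => ((p.1 v : ℕ) : ℤ) + N * p.2 v) (by
    have hN' : (0 : ℤ) < N := by exact_mod_cast hN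
    constructor
    · rintro ⟨a, y⟩ ⟨a', y'⟩ h
      have h1 : ∀ v, a v = a' v ∧ y v = y' v := fun v => by
        have h2 := congrFun h v
        simp only at h2
        have h3 := congrArg (· % (N : ℤ)) h2
        simp only [Int.add_mul_emod_self_left] at h3
        rw [Int.emod_eq_of_lt (by positivity) (by exact_mod_cast (a v).2),
          Int.emod_eq_of_lt (by positivity) (by exact_mod_cast (a' v).2)] at h3
        refine ⟨Fin.ext (by exact_mod_cast h3), ?_⟩
        rw [h3] at h2
        exact mul_left_cancel₀ hN'.ne' (add_left_cancel h2)
      exact Prod.ext (funext fun v => (h1 v).1) (funext fun v => (h1 v).2)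
    · intro x
      refine ⟨(fun v => ⟨(x v % N).toNat, ?_⟩, fun v => x v / N), ?_⟩
      · have := Int.emod_lt_of_pos (x v) hN'
        have := Int.emod_nonneg (x v) hN'.ne'
        omega
      · ext v
        simp only
        rw [Int.toNat_of_nonneg (Int.emod_nonneg (x v) hN'.ne')]
        exact Int.emod_add_mul_ediv _ _)

variable (W) in
/-- The quadratic Gauss sum `∑_μ 𝐞(ᵗμ W μ / 4k + ᵗμ l / 2k)`. -/
def gaussSum (k : ℕ) (l : V → ℤ) : ℂ :=
  ∑ μ : V → Fin (2 * k), e (((fun v => ((μ v : ℕ) : ℤ)) ⬝ᵥ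
        W.mulVec (fun v => ((μ v : ℕ) : ℤ)) : ℤ) / (4 * k)) *
    e (((∑ v, ((μ v : ℕ) : ℤ) * l v : ℤ) : ℂ) / (2 * k))

/-- A matrix over the integers as a matrix over the reals. -/
abbrev realMatrix (W : Matrix V V ℤ) : Matrix V V ℝ := W.map (Int.cast : ℤ → ℝ)

theorem realMatrix_mulVec (y : V → ℤ) :
    (realMatrix W).mulVec (toReal y) = toReal (W.mulVec y) := by
  ext v
  simp [Matrix.mulVec, dotProduct, toReal]

theorem toReal_dotProduct (x y : V → ℤ) : toReal x ⬝ᵥ toReal y = ((x ⬝ᵥ y : ℤ) : ℝ) := by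
  simp [dotProduct, toReal]

theorem isUnit_det_realMatrix (hW : (-(realMatrix W)).PosDef) : IsUnit (realMatrix W).det := by
  have := hW.det_pos
  rw [Matrix.det_neg] at this
  exact isUnit_iff_ne_zero.2 (by rintro h; simp [h] at this)

theorem det_realMatrix : (realMatrix W).det = (W.det : ℝ) :=
  ((Int.castRingHom ℝ).map_det W).symm

theorem det_ne_zero_of_posDef (hW : (-(realMatrix W)).PosDef) : W.det ≠ 0 := by
  have := (isUnit_det_realMatrix hW).ne_zero
  rw [det_realMatrix] at this
  exact_mod_cast this

theorem abs_det_eq (hW : (-(realMatrix W)).PosDef) : |(W.det : ℝ)| = (-(realMatrix W)).det := by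
  have := hW.det_pos
  rw [← abs_of_pos this, Matrix.det_neg, abs_mul, abs_pow, abs_neg, abs_one, one_pow, one_mul,
    det_realMatrix]

theorem inv_neg_realMatrix (hW : (-(realMatrix W)).PosDef) :
    (-(realMatrix W))⁻¹ = -(realMatrix W)⁻¹ := by
  refine Matrix.inv_eq_right_inv ?_
  rw [neg_mul_neg, Matrix.mul_nonsing_inv _ (isUnit_det_realMatrix hW)]

theorem isSymm_of_posDef (hW : (-(realMatrix W)).PosDef) : (realMatrix W).IsSymm := by
  have := hW.isHermitian
  rw [Matrix.IsHermitian, Matrix.conjTranspose_eq_transpose_of_trivial, Matrix.transpose_neg] at this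
  exact neg_injective this

theorem isSymm_int_of_posDef (hW : (-(realMatrix W)).PosDef) : W.IsSymm := by
  have := isSymm_of_posDef hW
  refine Matrix.IsSymm.ext fun i j => ?_
  have := this.apply i j
  simp only [Matrix.map_apply] at this
  exact_mod_cast this

theorem invForm_shift (hW : (-(realMatrix W)).PosDef) (u y : V → ℝ) :
    invForm W (u + (realMatrix W).mulVec y) (u + (realMatrix W).mulVec y) =
      (y + (realMatrix W)⁻¹.mulVec u) ⬝ᵥ (realMatrix W).mulVec (y + (realMatrix W)⁻¹.mulVec u) := by
  have hu := isUnit_det_realMatrix hW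
  set z := y + (realMatrix W)⁻¹.mulVec u with hz
  have h1 : u + (realMatrix W).mulVec y = (realMatrix W).mulVec z := by
    rw [hz, Matrix.mulVec_add, Matrix.mulVec_mulVec, Matrix.mul_nonsing_inv _ hu,
      Matrix.one_mulVec, add_comm]
  rw [h1, invForm, Matrix.mulVec_mulVec, Matrix.nonsing_inv_mul _ hu, Matrix.one_mulVec,
    dotProduct_comm]

theorem invForm_shift_expand (hW : (-(realMatrix W)).PosDef) (u y : V → ℝ) :
    invForm W (u + (realMatrix W).mulVec y) (u + (realMatrix W).mulVec y) =
      invForm W u u + 2 * (y ⬝ᵥ u) + y ⬝ᵥ (realMatrix W).mulVec y := by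
  have hu := isUnit_det_realMatrix hW
  have hs := isSymm_of_posDef hW
  simp only [invForm]
  rw [Matrix.mulVec_add, Matrix.mulVec_mulVec, Matrix.nonsing_inv_mul _ hu, Matrix.one_mulVec]
  simp only [add_dotProduct, dotProduct_add]
  have h1 : (realMatrix W).mulVec y ⬝ᵥ (realMatrix W)⁻¹.mulVec u = y ⬝ᵥ u := by
    rw [dotProduct_comm, Matrix.dotProduct_mulVec, ← Matrix.mulVec_transpose, hs.eq,
      Matrix.mulVec_mulVec, Matrix.mul_nonsing_inv _ hu, Matrix.one_mulVec, dotProduct_comm]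
  have h2 : (realMatrix W).mulVec y ⬝ᵥ y = y ⬝ᵥ (realMatrix W).mulVec y := dotProduct_comm _ _
  rw [h1, h2, dotProduct_comm u y]
  ring

theorem invForm_add_self (hW : (-(realMatrix W)).PosDef) (u x : V → ℝ) :
    invForm W (u + x) (u + x) = invForm W u u + 2 * invForm W u x + invForm W x x := by
  have hs : ((realMatrix W)⁻¹).IsSymm := by
    rw [Matrix.IsSymm, Matrix.transpose_nonsing_inv, (isSymm_of_posDef hW).eq]
  have h1 : invForm W x u = invForm W u x := by
    simp only [invForm]
    rw [dotProduct_comm, Matrix.dotProduct_mulVec, ← Matrix.mulVec_transpose, dotProduct_comm,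
      hs.eq, dotProduct_comm]
  simp only [invForm] at h1 ⊢
  rw [Matrix.mulVec_add]
  simp only [add_dotProduct, dotProduct_add]
  linarith

theorem tsum_equiv_finite_prod {ι κ : Type*} [Fintype ι] (E : ι × κ ≃ (V → ℤ)) {f : (V → ℤ) → ℂ}
    (hf : Summable f) : ∑' x, f x = ∑ i, ∑' y, f (E (i, y)) := by
  have h := (E.summable_iff (f := f)).2 hf
  rw [← E.tsum_eq f, ← tsum_fintype (L := SummationFilter.unconditional ι) (fun i => ∑' y, f (E (i, y)))]
  exact h.tsum_prod

/-- The Gauss weights summed over `ℤ^V / W ℤ^V`. -/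
theorem quadratic_reciprocity_aux (hW : (-(realMatrix W)).PosDef) [Fintype (Coker W)] {k : ℕ}
    (hk : 0 < k) (l : V → ℤ) {s : ℝ} (hs : 0 < s) :
    ∑' x : V → ℤ, cexp (-(s - 2 * Real.pi * I * k) * cform (-(realMatrix W))⁻¹
        (fun v => (((l v / (2 * k) : ℝ) + x v : ℝ) : ℂ))
        (fun v => (((l v / (2 * k) : ℝ) + x v : ℝ) : ℂ))) =
      ∑ a : Coker W, gaussWeight W k (Quotient.out a) l * e ((Q W (toReal l) / (4 * k) : ℝ)) *
        ∑' y : V → ℤ, cexp (-s * cform (-(realMatrix W))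
          (fun v => ((((realMatrix W)⁻¹.mulVec
            (fun v => (Quotient.out a v : ℝ) + l v / (2 * k))) v + y v : ℝ) : ℂ))
          (fun v => ((((realMatrix W)⁻¹.mulVec
            (fun v => (Quotient.out a v : ℝ) + l v / (2 * k))) v + y v : ℝ) : ℂ))) := by
  have hk' : (0 : ℝ) < k := by exact_mod_cast hk
  have hp : 0 < ((s : ℂ) - 2 * Real.pi * I * k).re := by simpa using hs
  have hsum := (summable_norm_gaussian hW.inv hp (fun v => (l v / (2 * k) : ℝ))).of_norm
  rw [tsum_equiv_finite_prod (latticeEquiv (det_ne_zero_of_posDef hW)) hsum]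
  refine Finset.sum_congr rfl fun a _ => ?_
  rw [← tsum_mul_left]
  refine tsum_congr fun y => ?_
  set α : V → ℤ := Quotient.out a with hα
  have hE : latticeEquiv (det_ne_zero_of_posDef hW) (a, y) = α + W.mulVec y := rfl
  rw [hE]
  set u : V → ℝ := fun v => (α v : ℝ) + l v / (2 * k) with hu
  rw [cform_ofReal (-(realMatrix W))⁻¹ (fun v => (l v / (2 * k) : ℝ) + ((α + W.mulVec y) v : ℤ))
    (fun v => (l v / (2 * k) : ℝ) + ((α + W.mulVec y) v : ℤ)),
    cform_ofReal (-(realMatrix W)) (fun v => ((realMatrix W)⁻¹.mulVec u) v + (y v : ℝ))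
    (fun v => ((realMatrix W)⁻¹.mulVec u) v + (y v : ℝ))]
  have hx : (fun v => (l v / (2 * k) : ℝ) + ((α + W.mulVec y) v : ℤ)) =
      u + (realMatrix W).mulVec (toReal y) := by
    rw [realMatrix_mulVec]
    ext v
    simp only [hu, toReal, Pi.add_apply]
    push_cast; ring
  have hz : (fun v => ((realMatrix W)⁻¹.mulVec u) v + (y v : ℝ)) =
      toReal y + (realMatrix W)⁻¹.mulVec u := by
    ext v
    simp only [toReal, Pi.add_apply]
    ring
  rw [hx, hz, inv_neg_realMatrix hW, Matrix.neg_mulVec, Matrix.neg_mulVec, dotProduct_neg,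
    dotProduct_neg, ← invForm_shift hW]
  set X := invForm W (u + (realMatrix W).mulVec (toReal y)) (u + (realMatrix W).mulVec (toReal y))
    with hX
  have hX' : (u + (realMatrix W).mulVec (toReal y)) ⬝ᵥ
      (realMatrix W)⁻¹.mulVec (u + (realMatrix W).mulVec (toReal y)) = X := rfl
  rw [hX']
  -- Expanding the form W⁻¹ at u + Wy, u = α + l/2k, gives the Gauss weight, the phase 𝐞(Q(l)/4k),
  -- and the integer passed to `e_add_int`.
  have hphase : cexp (2 * Real.pi * I * k * (-X : ℝ)) =
      gaussWeight W k α l * e ((Q W (toReal l) / (4 * k) : ℝ)) := by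
    have h1 : cexp (2 * Real.pi * I * k * (-X : ℝ)) = e ((-(k * X) : ℝ)) := by
      rw [e]; push_cast; ring_nf
    rw [h1, gaussWeight, ← e_add, ← Complex.ofReal_add]
    have h2 : u = toReal α + ((1 / (2 * k) : ℝ)) • toReal l := by
      ext v; simp [hu, toReal]; ring
    have h3 : invForm W u u = invForm W (toReal α) (toReal α) +
        invForm W (toReal α) (toReal l) / k + invForm W (toReal l) (toReal l) / (4 * k ^ 2) := by
      rw [h2, invForm_add_self hW]
      simp only [invForm, Matrix.mulVec_smul, smul_dotProduct, dotProduct_smul, smul_eq_mul]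
      field_simp
      ring
    have h4 : toReal y ⬝ᵥ u = ((y ⬝ᵥ α : ℤ) : ℝ) + ((y ⬝ᵥ l : ℤ) : ℝ) / (2 * k) := by
      rw [h2, dotProduct_add, dotProduct_smul, toReal_dotProduct, toReal_dotProduct, smul_eq_mul]
      ring
    rw [hX, invForm_shift_expand hW, h3, h4, realMatrix_mulVec, toReal_dotProduct, Q]
    rw [← e_add_int _ (2 * k * (y ⬝ᵥ α) + y ⬝ᵥ l + k * (y ⬝ᵥ W.mulVec y))]
    congr 1
    have hk'' : (k : ℂ) ≠ 0 := by exact_mod_cast hk.ne'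
    push_cast
    field_simp
    ring
  rw [← hphase, ← Complex.exp_add]
  congr 1
  push_cast
  ring

/-- The dual side of theta inversion, with n = μ + 2ky. The phase 𝐞(ᵗnWn/4k + ᵗn l/2k) depends on μ
only. What is left is a Gaussian lattice sum whose parameter -2πiks/(s - 2πik) is asymptotic to s as
s → 0. -/
theorem gaussSum_aux (hW : (-(realMatrix W)).PosDef) {k : ℕ}
    (hk : 0 < k) (l : V → ℤ) {s : ℝ} (hs : 0 < s) :
    ∑' n : V → ℤ, cexp (-(Real.pi ^ 2 / (s - 2 * Real.pi * I * k)) *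
        cform (-(realMatrix W)) (fun v => ((n v : ℝ) : ℂ)) (fun v => ((n v : ℝ) : ℂ)) +
        2 * Real.pi * I * ∑ v, (n v : ℂ) * (l v / (2 * k) : ℝ)) =
      ∑ μ : V → Fin (2 * k), (e (((fun v => ((μ v : ℕ) : ℤ)) ⬝ᵥ
        W.mulVec (fun v => ((μ v : ℕ) : ℤ)) : ℤ) / (4 * k)) *
        e (((∑ v, ((μ v : ℕ) : ℤ) * l v : ℤ) : ℂ) / (2 * k))) *
        ∑' y : V → ℤ, cexp (-(-(2 * Real.pi * I * k * s) / (s - 2 * Real.pi * I * k)) *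
          cform (-(realMatrix W)) (fun v => (((μ v : ℕ) / (2 * k) + y v : ℝ) : ℂ))
            (fun v => (((μ v : ℕ) / (2 * k) + y v : ℝ) : ℂ))) := by
  have hk' : (0 : ℝ) < k := by exact_mod_cast hk
  have hk'' : (k : ℂ) ≠ 0 := by exact_mod_cast hk.ne'
  have hp : 0 < ((s : ℂ) - 2 * Real.pi * I * k).re := by simpa using hs
  have hp0 : (s : ℂ) - 2 * Real.pi * I * k ≠ 0 := by
    intro h; rw [h] at hp; simp at hp
  have hpi : 0 < (Real.pi ^ 2 / ((s : ℂ) - 2 * Real.pi * I * k) : ℂ).re := by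
    rw [show (Real.pi ^ 2 / ((s : ℂ) - 2 * Real.pi * I * k) : ℂ) =
      ((Real.pi ^ 2 : ℝ) : ℂ) * ((s : ℂ) - 2 * Real.pi * I * k)⁻¹ by push_cast; ring,
      Complex.re_ofReal_mul, Complex.inv_re]
    have := Complex.normSq_pos.2 hp0
    positivity
  have hsum : Summable fun n : V → ℤ => cexp (-(Real.pi ^ 2 / (s - 2 * Real.pi * I * k)) *
        cform (-(realMatrix W)) (fun v => ((n v : ℝ) : ℂ)) (fun v => ((n v : ℝ) : ℂ)) +
        2 * Real.pi * I * ∑ v, (n v : ℂ) * (l v / (2 * k) : ℝ)) := by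
    refine Summable.of_norm ((summable_norm_gaussian hW hpi 0).congr fun n => ?_)
    rw [Complex.exp_add, norm_mul,
      show (2 * Real.pi * I * ∑ v, (n v : ℂ) * (l v / (2 * k) : ℝ)) =
        ((2 * Real.pi * ∑ v, (n v : ℝ) * (l v / (2 * k)) : ℝ) : ℂ) * I by push_cast; ring,
      Complex.norm_exp_ofReal_mul_I, mul_one]
    simp
  rw [tsum_equiv_finite_prod (residueEquiv (2 * k) (by omega)) hsum]
  refine Finset.sum_congr rfl fun μ _ => ?_
  rw [← tsum_mul_left]
  refine tsum_congr fun y => ?_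
  set m : V → ℤ := fun v => ((μ v : ℕ) : ℤ) with hm
  have hE : residueEquiv (2 * k) (by omega) (μ, y) = m + (2 * k : ℤ) • y := by
    ext v
    simp [residueEquiv, hm]
  rw [hE]
  set n := m + (2 * k : ℤ) • y with hn
  have hnr : toReal n = toReal m + (2 * k : ℝ) • toReal y := by
    ext v
    simp [hn, toReal]
  have c1 : cform (-(realMatrix W)) (fun v => ((n v : ℝ) : ℂ)) (fun v => ((n v : ℝ) : ℂ)) =
      ((-(n ⬝ᵥ W.mulVec n : ℤ) : ℝ) : ℂ) := by
    have := cform_ofReal (-(realMatrix W)) (toReal n) (toReal n)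
    rw [Matrix.neg_mulVec, dotProduct_neg, realMatrix_mulVec, toReal_dotProduct] at this
    exact this
  have c2 : cform (-(realMatrix W)) (fun v => (((μ v : ℕ) / (2 * k) + y v : ℝ) : ℂ))
      (fun v => (((μ v : ℕ) / (2 * k) + y v : ℝ) : ℂ)) =
      ((-(n ⬝ᵥ W.mulVec n : ℤ) / (4 * k ^ 2) : ℝ) : ℂ) := by
    have := cform_ofReal (-(realMatrix W)) ((1 / (2 * k) : ℝ) • toReal n) ((1 / (2 * k) : ℝ) • toReal n)
    rw [Matrix.neg_mulVec, dotProduct_neg, Matrix.mulVec_smul, smul_dotProduct, dotProduct_smul,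
      realMatrix_mulVec, toReal_dotProduct] at this
    have hv : (fun v => (((μ v : ℕ) / (2 * k) + y v : ℝ) : ℂ)) =
        fun v => ((((1 / (2 * k) : ℝ) • toReal n) v : ℝ) : ℂ) := by
      ext v
      congr 1
      rw [hnr]
      simp only [Pi.smul_apply, Pi.add_apply, toReal, hm, smul_eq_mul]
      push_cast
      field_simp
    rw [hv, this]
    congr 1
    simp only [smul_eq_mul]
    field_simp
    ring
  have hphase : e (((m ⬝ᵥ W.mulVec m : ℤ) : ℂ) / (4 * k)) *
      e (((∑ v, m v * l v : ℤ) : ℂ) / (2 * k)) =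
      e (((n ⬝ᵥ W.mulVec n : ℤ) : ℂ) / (4 * k) + ((n ⬝ᵥ l : ℤ) : ℂ) / (2 * k)) := by
    have hsym : y ⬝ᵥ W.mulVec m = m ⬝ᵥ W.mulVec y := by
      rw [Matrix.dotProduct_mulVec, ← Matrix.mulVec_transpose, (isSymm_int_of_posDef hW).eq,
        dotProduct_comm]
    have e1 : n ⬝ᵥ W.mulVec n = m ⬝ᵥ W.mulVec m + 4 * k * (m ⬝ᵥ W.mulVec y) +
        4 * k * (k * (y ⬝ᵥ W.mulVec y)) := by
      rw [hn, Matrix.mulVec_add, Matrix.mulVec_smul]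
      simp only [add_dotProduct, dotProduct_add, smul_dotProduct, dotProduct_smul, smul_eq_mul]
      rw [hsym]; ring
    have e2 : n ⬝ᵥ l = m ⬝ᵥ l + 2 * k * (y ⬝ᵥ l) := by
      rw [hn]
      simp only [add_dotProduct, smul_dotProduct, smul_eq_mul]
    rw [← e_add, e1, e2,
      ← e_add_int _ (m ⬝ᵥ W.mulVec y + k * (y ⬝ᵥ W.mulVec y) + y ⬝ᵥ l)]
    congr 1
    have : (∑ v, m v * l v) = m ⬝ᵥ l := rfl
    rw [this]
    push_cast
    field_simp
    ring
  rw [hphase, c1, c2, e, ← Complex.exp_add]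
  congr 1
  have e3 : ∑ v, (n v : ℂ) * ((l v / (2 * k) : ℝ) : ℂ) = ((n ⬝ᵥ l : ℤ) : ℂ) / (2 * k) := by
    simp only [dotProduct]
    push_cast
    rw [Finset.sum_div]
    exact Finset.sum_congr rfl fun v _ => by ring
  rw [e3]
  generalize hP : (s : ℂ) - 2 * Real.pi * I * k = P at hp0
  have hsP : (s : ℂ) = P + 2 * Real.pi * I * k := by rw [← hP]; ring
  rw [hsP]
  push_cast
  field_simp
  ring_nf
  rw [I_sq]
  ring

/-- The base equals i/2k, and the principal branch of i^(1/2) is ζ_8: this is the origin of the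
constant ζ_8^|V| / √(2k)^|V|. -/
theorem cpow_I_div {k : ℕ} (hk : 0 < k) (r : ℕ) :
    (Real.pi / (-(2 * Real.pi * I * k)) : ℂ) ^ (r / 2 : ℂ) =
      e (1 / 8) ^ r / (Real.sqrt (2 * k) : ℂ) ^ r := by
  have hk' : (0 : ℝ) < k := by exact_mod_cast hk
  have h1 : (Real.pi / (-(2 * Real.pi * I * k)) : ℂ) = ((1 / (2 * k) : ℝ) : ℂ) * I := by
    have hk'' : (k : ℂ) ≠ 0 := by exact_mod_cast hk.ne'
    have hpi : (Real.pi : ℂ) ≠ 0 := by exact_mod_cast Real.pi_ne_zero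
    push_cast
    field_simp
    rw [I_sq]
  rw [h1, ofReal_mul_cpow (by positivity) I_ne_zero,
    show (r / 2 : ℂ) = r * (1 / 2 : ℂ) by ring, Complex.cpow_nat_mul, Complex.cpow_nat_mul,
    mul_comm, div_eq_mul_inv (e (1 / 8) ^ r), ← inv_pow]
  congr 2
  · rw [Complex.cpow_def_of_ne_zero I_ne_zero, Complex.log_I, e]
    congr 1; ring
  · rw [show (1 / 2 : ℂ) = ((1 / 2 : ℝ) : ℂ) by push_cast; rfl, ← Complex.ofReal_cpow (by positivity),
      ← Real.sqrt_eq_rpow, one_div, Real.sqrt_inv]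
    push_cast; rfl

/-- Reciprocity between the Gauss sums over `ℤ^V / W ℤ^V` and over `ℤ^V / 2k ℤ^V`. -/
theorem quadratic_reciprocity (hW : (-(realMatrix W)).PosDef) [Fintype (Coker W)] {k : ℕ}
    (hk : 0 < k) (l : V → ℤ) :
    ∑ a : Coker W, gaussWeight W k (Quotient.out a) l * e ((Q W (toReal l) / (4 * k) : ℝ)) =
      e (1 / 8) ^ Fintype.card V * (Real.sqrt |(W.det : ℝ)| : ℂ) /
        (Real.sqrt (2 * k) : ℂ) ^ Fintype.card V * gaussSum W k l := by
  have hk' : (0 : ℝ) < k := by exact_mod_cast hk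
  have hk'' : (k : ℂ) ≠ 0 := by exact_mod_cast hk.ne'
  have hpi0 : (Real.pi : ℂ) ≠ 0 := by exact_mod_cast Real.pi_ne_zero
  set A := -(realMatrix W) with hA
  set r := Fintype.card V with hr
  set C : ℂ := (Real.pi / (1 : ℝ) : ℂ) ^ (r / 2 : ℂ) * ((Real.sqrt A.det)⁻¹ : ℝ) with hC
  have hid : Filter.Tendsto (fun s : ℝ => ((s : ℂ)) / (s : ℂ)) (𝓝[>] 0) (𝓝 ((1 : ℝ) : ℂ)) := by
    refine (tendsto_const_nhds (x := ((1 : ℝ) : ℂ))).congr' ?_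
    filter_upwards [self_mem_nhdsWithin] with s hs
    have : (s : ℂ) ≠ 0 := by exact_mod_cast (Set.mem_Ioi.1 hs).ne'
    rw [div_self this]; simp
  have hpt : Filter.Tendsto (fun s : ℝ => (s : ℂ) - 2 * Real.pi * I * k) (𝓝[>] 0)
      (𝓝 (-(2 * Real.pi * I * k))) := by
    have : Continuous fun s : ℝ => (s : ℂ) - 2 * Real.pi * I * k := by fun_prop
    have := this.tendsto 0
    simp only [Complex.ofReal_zero, zero_sub] at this
    exact this.mono_left nhdsWithin_le_nhds
  have hne : -(2 * Real.pi * I * k : ℂ) ≠ 0 := by simp [hpi0, hk'']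
  have hβ : Filter.Tendsto (fun s : ℝ => (-(2 * Real.pi * I * k * s) / (s - 2 * Real.pi * I * k)) / s)
      (𝓝[>] 0) (𝓝 ((1 : ℝ) : ℂ)) := by
    have := (tendsto_const_nhds (x := -(2 * Real.pi * I * k : ℂ))).div hpt hne
    rw [div_self hne] at this
    rw [Complex.ofReal_one]
    refine this.congr' ?_
    filter_upwards [self_mem_nhdsWithin] with s hs
    have : (s : ℂ) ≠ 0 := by exact_mod_cast (Set.mem_Ioi.1 hs).ne'
    simp only [Pi.div_apply]
    field_simp
  -- Two evaluations of one series, direct and by Poisson summation, are multiplied by s^(r/2) as s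
  -- → 0+. Each Gaussian lattice sum then has the same nonzero limit `C`, which cancels and leaves
  -- the identity of Gauss sums.
  have hL := tendsto_finsetSum (Finset.univ : Finset (Coker W)) fun a _ =>
    (tendsto_theta hW ((realMatrix W)⁻¹.mulVec
      (fun v => (Quotient.out a v : ℝ) + l v / (2 * k))) one_pos hid).const_mul
      (gaussWeight W k (Quotient.out a) l * e ((Q W (toReal l) / (4 * k) : ℝ)))
  have hR := tendsto_finsetSum (Finset.univ : Finset (V → Fin (2 * k))) fun μ _ =>
    (tendsto_theta hW (fun v => ((μ v : ℕ) / (2 * k) : ℝ)) one_pos hβ).const_mul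
      (e (((fun v => ((μ v : ℕ) : ℤ)) ⬝ᵥ
        W.mulVec (fun v => ((μ v : ℕ) : ℤ)) : ℤ) / (4 * k)) *
        e (((∑ v, ((μ v : ℕ) : ℤ) * l v : ℤ) : ℂ) / (2 * k)))
  have hpow : Filter.Tendsto (fun s : ℝ => (Real.pi / ((s : ℂ) - 2 * Real.pi * I * k) : ℂ) ^ (r / 2 : ℂ))
      (𝓝[>] 0) (𝓝 (e (1 / 8) ^ r / (Real.sqrt (2 * k) : ℂ) ^ r)) := by
    rw [← cpow_I_div hk r]
    refine (tendsto_const_nhds.div hpt hne).cpow tendsto_const_nhds ?_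
    -- The limit of the base is on the positive imaginary axis, away from the branch cut.
    right
    rw [show (Real.pi / (-(2 * Real.pi * I * k)) : ℂ) = ((1 / (2 * k) : ℝ) : ℂ) * I by
      push_cast
      field_simp
      rw [I_sq], Complex.im_ofReal_mul]
    simp [hk.ne']
  have hR' := (hpow.mul_const (((Real.sqrt A⁻¹.det)⁻¹ : ℝ) : ℂ)).mul hR
  have huniq := tendsto_nhds_unique_of_eventuallyEq hL hR' (by
    filter_upwards [self_mem_nhdsWithin] with s hs
    have hs : 0 < s := hs
    have hp : 0 < ((s : ℂ) - 2 * Real.pi * I * k).re := by simpa using hs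
    have h1 := quadratic_reciprocity_aux hW hk l hs
    have h2 := theta_inversion hW.inv hp (fun v => (l v / (2 * k) : ℝ))
    rw [Matrix.nonsing_inv_nonsing_inv _ (isUnit_iff_ne_zero.2 hW.det_pos.ne'),
      gaussSum_aux hW hk l hs, h1] at h2
    have h3 := congrArg (fun z => (s : ℂ) ^ (r / 2 : ℂ) * z) h2
    simp only [Finset.mul_sum] at h3 ⊢
    refine Eq.trans (Finset.sum_congr rfl fun a _ => ?_) (h3.trans (Finset.sum_congr rfl fun a _ => ?_))
    · ring
    · ring)
  have hC0 : C ≠ 0 := by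
    have := hW.det_pos
    rw [hC]
    refine mul_ne_zero ?_ ?_
    · rw [Complex.cpow_ne_zero_iff]; left; simp
    · simp only [Complex.ofReal_inv]
      exact inv_ne_zero (by exact_mod_cast (Real.sqrt_pos.2 hW.det_pos).ne')
  simp only [← hr, ← hC] at huniq
  refine mul_right_cancel₀ hC0 ?_
  rw [Finset.sum_mul, huniq, ← Finset.sum_mul, ← mul_assoc, gaussSum, abs_det_eq hW]
  congr 1
  rw [Matrix.det_nonsing_inv, Ring.inverse_eq_inv', Real.sqrt_inv, inv_inv]
  ring

end Lattice


/-! ### Laurent expansions of the vertex factor off the unit circle -/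

section VertexFactor

theorem vertexFactor_inv {K : Type*} [Field K] (d : ℕ) (z : K) :
    vertexFactor d z⁻¹ = (-1) ^ d * vertexFactor d z := by
  rw [vertexFactor, vertexFactor, inv_inv, show z⁻¹ - z = (-1) * (z - z⁻¹) by ring, mul_zpow]
  congr 1
  rw [show (2 - (d : ℤ)) = 2 * (1 - (d : ℤ)) + d by ring, zpow_add₀ (by simp), zpow_mul]
  simp

/-- For d ≤ 2 this is a Laurent polynomial. For d = n + 3 it is z^(-(n+1)) (1 - z⁻²)^(-(n+1)), a
binomial series in z⁻². The parity of the exponents is what confines the theta series to the classes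
2ℤ^V + δ. -/
theorem exists_vertexFactor_expansion (d : ℕ) : ∃ c : ℤ → ℂ, (∀ l, c l ≠ 0 → Even (l - d)) ∧
    ∀ z : ℂ, 1 < ‖z‖ → HasSum (fun l => c l * z ^ (-l)) (vertexFactor d z) := by
  have hz0 : ∀ z : ℂ, 1 < ‖z‖ → z ≠ 0 := fun z hz h => by simp [h] at hz; linarith
  rcases d with _ | _ | _ | n
  · refine ⟨fun l => if l = -2 then 1 else if l = 0 then -2 else if l = 2 then 1 else 0,
      fun l hl => ?_, fun z hz => ?_⟩
    · by_cases h1 : l = -2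
      · subst h1; decide
      by_cases h2 : l = 0
      · subst h2; decide
      by_cases h3 : l = 2
      · subst h3; decide
      simp [h1, h2, h3] at hl
    · have := hasSum_sum_of_ne_finset_zero (L := SummationFilter.unconditional ℤ)
        (f := fun l : ℤ => (if l = -2 then (1 : ℂ) else if l = 0 then -2
          else if l = 2 then 1 else 0) * z ^ (-l)) (s := {-2, 0, 2}) (fun l hl => by
            simp only [Finset.mem_insert, Finset.mem_singleton, not_or] at hl
            simp [hl.1, hl.2.1, hl.2.2])
      convert this using 1
      have := hz0 z hz
      simp [vertexFactor]
      field_simp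
      ring
  · refine ⟨fun l => if l = -1 then 1 else if l = 1 then -1 else 0,
      fun l hl => ?_, fun z hz => ?_⟩
    · by_cases h1 : l = -1
      · subst h1; decide
      by_cases h2 : l = 1
      · subst h2; decide
      simp [h1, h2] at hl
    · have := hasSum_sum_of_ne_finset_zero (L := SummationFilter.unconditional ℤ)
        (f := fun l : ℤ => (if l = -1 then (1 : ℂ) else if l = 1 then -1
          else 0) * z ^ (-l)) (s := {-1, 1}) (fun l hl => by
            simp only [Finset.mem_insert, Finset.mem_singleton, not_or] at hl
            simp [hl.1, hl.2])
      convert this using 1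
      simp [vertexFactor]
      ring
  · refine ⟨fun l => if l = 0 then 1 else 0, fun l hl => ?_, fun z hz => ?_⟩
    · by_cases h1 : l = 0
      · subst h1; decide
      simp [h1] at hl
    · have := hasSum_sum_of_ne_finset_zero (L := SummationFilter.unconditional ℤ)
        (f := fun l : ℤ => (if l = 0 then (1 : ℂ) else 0) * z ^ (-l)) (s := {0}) (fun l hl => by
            simp only [Finset.mem_singleton] at hl
            simp [hl])
      convert this using 1
      simp [vertexFactor]
  · let g : ℕ → ℤ := fun j => n + 1 + 2 * j
    have hg : Function.Injective g := fun i j hij => by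
      simp only [g] at hij; omega
    refine ⟨Function.extend g (fun j => ((j + n).choose n : ℂ)) 0, fun l hl => ?_, fun z hz => ?_⟩
    · by_cases h : ∃ j, g j = l
      · obtain ⟨j, rfl⟩ := h
        simp only [g]
        exact ⟨j - 1, by push_cast; ring⟩
      · exact absurd (Function.extend_apply' _ _ _ h) hl
    · have hz' := hz0 z hz
      have hr : ‖(z ^ 2)⁻¹‖ < 1 := by
        rw [norm_inv, norm_pow]
        exact inv_lt_one_of_one_lt₀ (one_lt_pow₀ hz (by norm_num))
      have h1 := (hasSum_choose_mul_geometric_of_norm_lt_one n hr).mul_left (z ^ (-(n + 1 : ℤ)))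
      rw [← hg.hasSum_iff]
      · have hfun : (fun l => Function.extend g (fun j => ((j + n).choose n : ℂ)) 0 l * z ^ (-l)) ∘ g =
            fun j => z ^ (-(n + 1 : ℤ)) * (((j + n).choose n : ℂ) * (z ^ 2)⁻¹ ^ j) := by
          ext j
          simp only [Function.comp, hg.extend_apply, g]
          rw [mul_left_comm]
          congr 1
          rw [inv_pow, ← pow_mul, ← zpow_natCast, ← zpow_neg, ← zpow_add₀ hz']
          congr 1
          push_cast; ring
        have hval : vertexFactor (n + 1 + 1 + 1) z =
            z ^ (-(n + 1 : ℤ)) * (1 / (1 - (z ^ 2)⁻¹) ^ (n + 1)) := by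
          rw [vertexFactor, show (2 - ((n + 1 + 1 + 1 : ℕ) : ℤ)) = -((n + 1 : ℕ) : ℤ) by push_cast; ring,
            zpow_neg, zpow_natCast, show (-(n + 1 : ℤ)) = -((n + 1 : ℕ) : ℤ) by push_cast; ring,
            zpow_neg, zpow_natCast, one_div, ← mul_inv, ← mul_pow]
          congr 2
          field_simp
        rw [hfun, hval]
        exact h1
      · intro l hl
        rw [Function.extend_apply' _ _ _ (by simpa using hl)]
        simp

/-- The coefficients of the expansion of the vertex factor outside the unit circle (`σ = 1`) and
inside of it (`σ = -1`). -/
def vertexCoeff (σ : ℤˣ) (d : ℕ) (l : ℤ) : ℂ :=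
  if σ = 1 then (exists_vertexFactor_expansion d).choose l
  else (-1) ^ d * (exists_vertexFactor_expansion d).choose (-l)

theorem even_of_vertexCoeff_ne_zero {σ : ℤˣ} {d : ℕ} {l : ℤ} (h : vertexCoeff σ d l ≠ 0) :
    Even (l - d) := by
  have := (exists_vertexFactor_expansion d).choose_spec.1
  rw [vertexCoeff] at h
  split_ifs at h
  · exact this l h
  · have := this (-l) (right_ne_zero_of_mul h)
    obtain ⟨j, hj⟩ := this
    exact ⟨-j - d, by omega⟩

/-- Inside the circle, the outer expansion is applied at z⁻¹ and `vertexFactor_inv` corrects the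
sign. The hypothesis makes the sign of log ‖z‖ equal to σ. -/
theorem hasSum_vertexCoeff {σ : ℤˣ} (d : ℕ) {z : ℂ} (hz : 0 < ((σ : ℤ) : ℝ) * Real.log ‖z‖) :
    HasSum (fun l => vertexCoeff σ d l * z ^ (-l)) (vertexFactor d z) := by
  have hs := (exists_vertexFactor_expansion d).choose_spec.2
  rcases Int.units_eq_one_or σ with rfl | rfl
  · simp only [vertexCoeff, if_true]
    exact hs z ((Real.log_pos_iff (norm_nonneg z)).1 (by simpa using hz))
  · have h1 : Real.log ‖z‖ < 0 := by simpa using hz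
    have hz0 : z ≠ 0 := by rintro rfl; simp at h1
    have h2 : 1 < ‖z⁻¹‖ := by
      rw [norm_inv]
      exact (Real.log_pos_iff (by positivity)).1 (by rw [Real.log_inv]; linarith)
    have h3 := (hs z⁻¹ h2).mul_left ((-1) ^ d)
    rw [vertexFactor_inv, ← mul_assoc, ← mul_pow, neg_mul_neg, one_mul, one_pow, one_mul] at h3
    rw [← (Equiv.neg ℤ).hasSum_iff]
    have : (-1 : ℤˣ) ≠ 1 := by decide
    have hfun : (fun l => vertexCoeff (-1) d l * z ^ (-l)) ∘ ⇑(Equiv.neg ℤ) = fun l =>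
        (-1) ^ d * ((exists_vertexFactor_expansion d).choose l * z⁻¹ ^ (-l)) := by
      ext l
      simp [vertexCoeff, Function.comp, mul_assoc, this]
    rw [hfun]
    exact h3

theorem log_norm_mul_exp (σ : ℤˣ) : ((σ : ℤ) : ℝ) * Real.log ‖cexp (((σ : ℤ) : ℝ) : ℂ)‖ = 1 := by
  rw [Complex.norm_exp_ofReal, Real.log_exp]
  rcases Int.units_eq_one_or σ with rfl | rfl <;> simp

theorem real_exp_zpow (x : ℝ) (n : ℤ) : Real.exp (n * x) = Real.exp x ^ n := by
  rw [mul_comm, Real.exp_mul, Real.rpow_intCast]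

/-- The terms of the convergent series at |z| = e^σ are bounded. Exponential growth is a crude
bound, but the Gaussian in l absorbs it. -/
theorem exists_vertexCoeff_bound (σ : ℤˣ) (d : ℕ) :
    ∃ C > 0, ∀ l, ‖vertexCoeff σ d l‖ ≤ C * Real.exp |(l : ℝ)| := by
  have h := (hasSum_vertexCoeff d (by rw [log_norm_mul_exp σ]; exact one_pos)).summable.norm
  refine ⟨(∑' l, ‖vertexCoeff σ d l * cexp (((σ : ℤ) : ℝ) : ℂ) ^ (-l)‖) + 1,
    by positivity, fun l => ?_⟩
  have h1 := h.le_tsum l (fun _ _ => norm_nonneg _)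
  rw [norm_mul, norm_zpow, Complex.norm_exp_ofReal, ← real_exp_zpow] at h1
  have h2 : ‖vertexCoeff σ d l‖ = ‖vertexCoeff σ d l‖ * Real.exp (((-l : ℤ) : ℝ) * ((σ : ℤ) : ℝ)) *
      Real.exp ((l : ℝ) * ((σ : ℤ) : ℝ)) := by
    rw [mul_assoc, ← Real.exp_add]
    push_cast
    simp
  rw [h2]
  refine mul_le_mul (h1.trans (by linarith)) (Real.exp_le_exp.2 ?_) (Real.exp_pos _).le (by positivity)
  rcases Int.units_eq_one_or σ with rfl | rfl
  · simpa using le_abs_self (l : ℝ)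
  · simpa using neg_le_abs (l : ℝ)

theorem integral_e (n : ℤ) : ∫ θ in Set.Icc (0 : ℝ) 1, e (n * θ) = if n = 0 then 1 else 0 := by
  split_ifs with h
  · simp [h, e_zero]
  · rw [integral_Icc_eq_integral_Ioc, ← intervalIntegral.integral_of_le zero_le_one]
    have hc : (2 * Real.pi * I * n : ℂ) ≠ 0 := by simp [h, Real.pi_ne_zero]
    have := integral_exp_mul_complex (a := 0) (b := 1) hc
    simp only [e]
    simp only [mul_assoc] at this ⊢
    rw [this]
    have h2 := e_int n
    rw [e] at h2
    simp only [mul_assoc] at h2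
    simp [h2]

theorem continuous_vertexFactor_circle {r : ℝ} (hr : 0 < r) (hr1 : r ≠ 1) (d : ℕ) :
    Continuous fun θ : ℝ => vertexFactor d ((r : ℂ) * e θ) := by
  unfold vertexFactor e
  have h0 : ∀ θ : ℝ, (r : ℂ) * cexp (2 * Real.pi * I * θ) ≠ 0 := fun θ =>
    mul_ne_zero (by exact_mod_cast hr.ne') (Complex.exp_ne_zero _)
  refine Continuous.zpow₀ (by
    refine Continuous.sub (by fun_prop) (Continuous.inv₀ (by fun_prop) h0)) _ (fun θ => Or.inl ?_)
  intro h
  rw [sub_eq_zero] at h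
  have h1 := congrArg norm h
  rw [norm_inv, norm_mul, Complex.norm_real, Complex.norm_exp] at h1
  have h2 : (2 * Real.pi * I * θ : ℂ).re = 0 := by simp
  rw [h2, Real.exp_zero, mul_one, Real.norm_of_nonneg hr.le] at h1
  have : r * r = 1 := by 
    nth_rewrite 2 [h1]
    exact mul_inv_cancel₀ hr.ne'
  exact hr1 (by nlinarith)

theorem norm_ofReal_mul_e {r : ℝ} (hr : 0 < r) (θ : ℝ) : ‖(r : ℂ) * e θ‖ = r := by
  rw [norm_mul, norm_e, Complex.norm_real, Real.norm_of_nonneg hr.le]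
  simp

/-- Integrating termwise, only the term in z^(-l) survives. The radius disappears; only the side of
the unit circle is remembered. -/
theorem integral_circle_vertexFactor {σ : ℤˣ} (d : ℕ) {r : ℝ} (hr : 0 < r)
    (hσ : 0 < ((σ : ℤ) : ℝ) * Real.log r) (l : ℤ) :
    ∫ θ in Set.Icc (0 : ℝ) 1, ((r : ℂ) * e θ) ^ l * vertexFactor d ((r : ℂ) * e θ) =
      vertexCoeff σ d l := by
  have hr0 : (r : ℂ) ≠ 0 := by exact_mod_cast hr.ne'
  have hz : ∀ θ : ℝ, 0 < ((σ : ℤ) : ℝ) * Real.log ‖(r : ℂ) * e θ‖ := fun θ => by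
    rw [norm_ofReal_mul_e hr]; exact hσ
  have hne : ∀ θ : ℝ, (r : ℂ) * e θ ≠ 0 := fun θ => mul_ne_zero hr0 (e_ne_zero _)
  have hpow : ∀ (θ : ℝ) (n : ℤ), ((r : ℂ) * e θ) ^ n = (r : ℂ) ^ n * e (n * θ) := fun θ n => by
    rw [mul_zpow, e, e, ← Complex.exp_int_mul]
    ring_nf
  have hF : ∀ θ : ℝ, ((r : ℂ) * e θ) ^ l * vertexFactor d ((r : ℂ) * e θ) =
      ∑' n : ℤ, vertexCoeff σ d n * (r : ℂ) ^ (l - n) * e ((l - n : ℤ) * θ) := fun θ => by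
    rw [← (hasSum_vertexCoeff d (hz θ)).tsum_eq, ← tsum_mul_left]
    refine tsum_congr fun n => ?_
    rw [mul_left_comm, ← zpow_add₀ (hne θ), hpow, ← sub_eq_add_neg, mul_assoc]
  simp only [hF]
  have hnorm : ∀ (n : ℤ) (θ : ℝ), ‖vertexCoeff σ d n * (r : ℂ) ^ (l - n) * e ((l - n : ℤ) * θ)‖ =
      r ^ l * (‖vertexCoeff σ d n‖ * r ^ (-n)) := fun n θ => by
    rw [norm_mul, norm_mul, norm_e, norm_zpow, Complex.norm_real, Real.norm_of_nonneg hr.le,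
      sub_eq_add_neg, zpow_add₀ hr.ne']
    have : ((((l + -n : ℤ) : ℂ)) * (θ : ℂ)).im = 0 := by
      rw [← Complex.ofReal_intCast, ← Complex.ofReal_mul, Complex.ofReal_im]
    rw [this]
    simp; ring
  have hs : Summable fun n => r ^ l * (‖vertexCoeff σ d n‖ * r ^ (-n)) := by
    refine Summable.mul_left _ ?_
    refine (hasSum_vertexCoeff d (hz 0)).summable.norm.congr fun n => ?_
    rw [norm_mul, norm_zpow, norm_ofReal_mul_e hr]
  rw [← integral_tsum_of_summable_integral_norm]
  · rw [tsum_eq_single l]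
    · simp [e_zero]
    · intro n hn
      rw [integral_const_mul, integral_e, if_neg (sub_ne_zero.2 hn.symm), mul_zero]
  · intro n
    refine Continuous.integrableOn_Icc ?_
    unfold e
    fun_prop
  · simp only [hnorm]
    simpa using hs

end VertexFactor

/-! ### Convergence of the theta series and evaluation of the principal value -/

section Theta
variable {V : Type*} [Fintype V] [DecidableEq V] {W : Matrix V V ℤ}

theorem norm_e_quadratic (τ : ℂ) (x : ℝ) : ‖e ((x : ℝ) * τ)‖ = Real.exp (-(2 * Real.pi * τ.im) * x) := by
  rw [norm_e, Complex.im_ofReal_mul]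
  congr 1; ring

theorem exists_Q_coercive (hW : (-(realMatrix W)).PosDef) :
    ∃ c > 0, ∀ x : V → ℝ, c * ∑ v, x v ^ 2 ≤ Q W x := by
  obtain ⟨c, hc, h⟩ := exists_coercive hW.inv
  refine ⟨c, hc, fun x => (h x).trans (le_of_eq ?_)⟩
  rw [inv_neg_realMatrix hW, Matrix.neg_mulVec, dotProduct_neg]
  rfl

theorem exists_norm_e_Q_bound (hW : (-(realMatrix W)).PosDef) {τ : ℂ} (hτ : 0 < τ.im) :
    ∃ c > 0, ∀ l : V → ℤ, ‖e ((Q W (toReal l) / 4 : ℝ) * τ)‖ ≤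
      Real.exp (-c * ∑ v, (l v : ℝ) ^ 2) := by
  obtain ⟨c, hc, h⟩ := exists_Q_coercive hW
  refine ⟨2 * Real.pi * τ.im * (c / 4), by positivity, fun l => ?_⟩
  rw [norm_e_quadratic]
  refine Real.exp_le_exp.2 ?_
  have h1 := h (toReal l)
  have h2 : 2 * Real.pi * τ.im * (c * ∑ v, toReal l v ^ 2) ≤ 2 * Real.pi * τ.im * Q W (toReal l) :=
    mul_le_mul_of_nonneg_left h1 (by positivity)
  simp only [toReal] at h2 ⊢
  linarith

theorem zpow_le_exp {r : ℝ} (hr : 0 < r) {a : ℝ} (ha : |Real.log r| ≤ a) (n : ℤ) :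
    r ^ n ≤ Real.exp (a * |(n : ℝ)|) := by
  rw [← Real.exp_log hr, ← real_exp_zpow]
  refine Real.exp_le_exp.2 ((le_abs_self _).trans ?_)
  rw [abs_mul, mul_comm]
  exact mul_le_mul_of_nonneg_right ha (abs_nonneg _)

theorem summable_theta_norm (hW : (-(realMatrix W)).PosDef) {τ : ℂ} (hτ : 0 < τ.im)
    {g : V → ℤ → ℂ} {C a : ℝ} (hg : ∀ v l, ‖g v l‖ ≤ C * Real.exp (a * |(l : ℝ)|)) :
    Summable fun l : V → ℤ => ‖e ((Q W (toReal l) / 4 : ℝ) * τ) * ∏ v, g v (l v)‖ := by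
  obtain ⟨c, hc, h⟩ := exists_norm_e_Q_bound hW hτ
  refine Summable.of_nonneg_of_le (fun _ => norm_nonneg _) (fun l => ?_)
    ((summable_gaussian_pi (V := V) hc a).mul_left (C ^ Fintype.card V))
  rw [norm_mul, norm_prod, Real.exp_add, mul_left_comm]
  refine mul_le_mul (h l) ?_ (by positivity) (by positivity)
  refine (Finset.prod_le_prod (fun _ _ => norm_nonneg _) fun v _ => hg v (l v)).trans (le_of_eq ?_)
  rw [Finset.prod_mul_distrib, Finset.prod_const, Finset.mul_sum, Real.exp_sum, Finset.card_univ]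

theorem summable_thetaTerm_norm (hW : (-(realMatrix W)).PosDef) {τ : ℂ} (hτ : 0 < τ.im)
    {z : V → ℂ} (hz : ∀ v, z v ≠ 0) : Summable fun l : V → ℤ => ‖thetaTerm W τ z l‖ := by
  refine summable_theta_norm hW hτ (g := fun v n => z v ^ n) (C := 1)
    (a := ∑ v, |Real.log ‖z v‖|) (fun v n => ?_)
  rw [norm_zpow, one_mul]
  exact zpow_le_exp (norm_pos_iff.2 (hz v))
    (Finset.single_le_sum (f := fun v => |Real.log ‖z v‖|) (fun _ _ => abs_nonneg _)
      (Finset.mem_univ v)) n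

variable {G : SimpleGraph V} [DecidableRel G.Adj] {w : V → ℤ}

theorem integral_cube_prod (f : V → ℝ → ℂ) :
    ∫ θ in Set.Icc (0 : V → ℝ) 1, ∏ v, f v (θ v) = ∏ v, ∫ x in Set.Icc (0 : ℝ) 1, f v x := by
  have : Set.Icc (0 : V → ℝ) 1 = Set.univ.pi fun _ => Set.Icc (0 : ℝ) 1 := by
    rw [Set.pi_univ_Icc]; rfl
  rw [this, volume_pi, Measure.restrict_pi_pi]
  exact integral_fintype_prod_eq_prod f

theorem integrable_cube_prod {f : V → ℝ → ℂ} (hf : ∀ v, Continuous (f v)) :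
    Integrable (fun θ : V → ℝ => ∏ v, f v (θ v)) (volume.restrict (Set.Icc (0 : V → ℝ) 1)) :=
  Continuous.integrableOn_Icc (by fun_prop)

/-- Sum and integral are interchanged, and the torus integral factors over the vertices. The result
is free of ε, so the limit defining the principal value is that of an eventually constant function.
-/
theorem torusIntegral_integrand (hW : (-(realMatrix (linkingMatrix G w))).PosDef)
    (b : Coker (2 • linkingMatrix G w)) {τ : ℂ} (hτ : 0 < τ.im) (s : V → ℤˣ) {ε : ℝ}
    (hε : ε ∈ Set.Ioo (0 : ℝ) 1) :
    torusIntegral (fun v => 1 + ((s v : ℤ) : ℝ) * ε) (integrand G w b τ) =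
      ∑' l : {l : V → ℤ // toCoker (2 • linkingMatrix G w) l = b},
        e ((Q (linkingMatrix G w) (toReal (l : V → ℤ)) / 4 : ℝ) * τ) *
          ∏ v, vertexCoeff (s v) (G.degree v) ((l : V → ℤ) v) := by
  set r : V → ℝ := fun v => 1 + ((s v : ℤ) : ℝ) * ε with hr
  have hr' : ∀ v, 0 < r v ∧ r v ≠ 1 ∧ 0 < ((s v : ℤ) : ℝ) * Real.log (r v) := fun v => by
    obtain ⟨h0, h1⟩ := hε
    simp only [hr]
    rcases Int.units_eq_one_or (s v) with h | h <;> rw [h] <;> simp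
    · exact ⟨by linarith, h0.ne', Real.log_pos (by linarith)⟩
    · exact ⟨h1, h0.ne', Real.log_neg (by linarith) (by linarith)⟩
  have hcF : ∀ v, Continuous fun θ : ℝ => vertexFactor (G.degree v) ((r v : ℂ) * e θ) := fun v =>
    continuous_vertexFactor_circle (hr' v).1 (hr' v).2.1 _
  have hcz : ∀ (v : V) (n : ℤ), Continuous fun θ : ℝ => ((r v : ℂ) * e θ) ^ n := fun v n => by
    refine Continuous.zpow₀ (by unfold e; fun_prop) _ fun θ => Or.inl ?_
    exact mul_ne_zero (by exact_mod_cast (hr' v).1.ne') (e_ne_zero _)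
  have hterm : ∀ (l : V → ℤ) (θ : V → ℝ),
      thetaTerm (linkingMatrix G w) τ (fun v => (r v : ℂ) * e (θ v)) l *
        ∏ v, vertexFactor (G.degree v) ((r v : ℂ) * e (θ v)) =
      e ((Q (linkingMatrix G w) (toReal l) / 4 : ℝ) * τ) *
        ∏ v, (((r v : ℂ) * e (θ v)) ^ l v * vertexFactor (G.degree v) ((r v : ℂ) * e (θ v))) :=
    fun l θ => by
      rw [thetaTerm, mul_assoc, Finset.prod_mul_distrib]
  simp only [torusIntegral, integrand, theta]
  simp only [← tsum_mul_right, hterm]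
  rw [← integral_tsum_of_summable_integral_norm]
  · refine tsum_congr fun l => ?_
    rw [integral_const_mul, integral_cube_prod (fun v θ => ((r v : ℂ) * e θ) ^ (l : V → ℤ) v *
      vertexFactor (G.degree v) ((r v : ℂ) * e θ))]
    congr 1
    exact Finset.prod_congr rfl fun v _ =>
      integral_circle_vertexFactor _ (hr' v).1 (hr' v).2.2 _
  · intro l
    exact (integrable_cube_prod (f := fun v θ => ((r v : ℂ) * e θ) ^ (l : V → ℤ) v *
      vertexFactor (G.degree v) ((r v : ℂ) * e θ)) fun v => (hcz v _).mul (hcF v)).const_mul _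
  · have h1 : ∀ (l : V → ℤ) (θ : V → ℝ),
        ‖e ((Q (linkingMatrix G w) (toReal l) / 4 : ℝ) * τ) *
        ∏ v, (((r v : ℂ) * e (θ v)) ^ l v * vertexFactor (G.degree v) ((r v : ℂ) * e (θ v)))‖ =
        ‖thetaTerm (linkingMatrix G w) τ (fun v => (r v : ℂ)) l‖ *
          ‖∏ v, vertexFactor (G.degree v) ((r v : ℂ) * e (θ v))‖ := fun l θ => by
      rw [← hterm, norm_mul]
      congr 1
      rw [thetaTerm, thetaTerm, norm_mul, norm_mul, norm_prod, norm_prod]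
      congr 1
      refine Finset.prod_congr rfl fun v _ => ?_
      rw [norm_zpow, norm_zpow, norm_ofReal_mul_e (hr' v).1, Complex.norm_real,
        Real.norm_of_nonneg (hr' v).1.le]
    simp only [h1, integral_const_mul]
    refine Summable.mul_right _ ?_
    exact (summable_thetaTerm_norm hW hτ (z := fun v => (r v : ℂ))
      (fun v => by exact_mod_cast (hr' v).1.ne')).subtype _

theorem symmetricIntegral_integrand (hW : (-(realMatrix (linkingMatrix G w))).PosDef)
    (b : Coker (2 • linkingMatrix G w)) {τ : ℂ} (hτ : 0 < τ.im) :
    Filter.Tendsto (symmetricIntegral (integrand G w b τ)) (𝓝[>] (0 : ℝ))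
      (𝓝 ((1 / 2) ^ Fintype.card V * ∑ s : V → ℤˣ,
        ∑' l : {l : V → ℤ // toCoker (2 • linkingMatrix G w) l = b},
        e ((Q (linkingMatrix G w) (toReal (l : V → ℤ)) / 4 : ℝ) * τ) *
          ∏ v, vertexCoeff (s v) (G.degree v) ((l : V → ℤ) v))) := by
  refine tendsto_const_nhds.congr' ?_
  filter_upwards [Ioo_mem_nhdsGT (one_pos : (0 : ℝ) < 1)] with ε hε
  rw [symmetricIntegral]
  congr 1
  exact Finset.sum_congr rfl fun s _ => (torusIntegral_integrand hW b hτ s hε).symm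

theorem principalValue_integrand (hW : (-(realMatrix (linkingMatrix G w))).PosDef)
    (b : Coker (2 • linkingMatrix G w)) {τ : ℂ} (hτ : 0 < τ.im) :
    principalValue (integrand G w b τ) = (1 / 2) ^ Fintype.card V * ∑ s : V → ℤˣ,
        ∑' l : {l : V → ℤ // toCoker (2 • linkingMatrix G w) l = b},
        e ((Q (linkingMatrix G w) (toReal (l : V → ℤ)) / 4 : ℝ) * τ) *
          ∏ v, vertexCoeff (s v) (G.degree v) ((l : V → ℤ) v) :=
  (symmetricIntegral_integrand hW b hτ).limUnder_eq

end Theta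


/-! ### The weighted sum as a series over ℤ^V -/

section Sums
variable {V : Type*} [Fintype V] [DecidableEq V] {W : Matrix V V ℤ}

theorem invForm_mulVec (hW : (-(realMatrix W)).PosDef) (x y : V → ℤ) :
    invForm W (toReal x) (toReal (W.mulVec y)) = ((x ⬝ᵥ y : ℤ) : ℝ) := by
  rw [invForm, ← realMatrix_mulVec, Matrix.mulVec_mulVec,
    Matrix.nonsing_inv_mul _ (isUnit_det_realMatrix hW), Matrix.one_mulVec, toReal_dotProduct]

theorem toReal_add (x y : V → ℤ) : toReal (x + y) = toReal x + toReal y := by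
  ext v; simp [toReal]

theorem gaussWeight_add (hW : (-(realMatrix W)).PosDef) (k : ℕ) (a l y : V → ℤ) :
    gaussWeight W k a (l + W.mulVec y) = gaussWeight W k a l := by
  rw [gaussWeight, gaussWeight, toReal_add]
  have : invForm W (toReal a) (toReal l + toReal (W.mulVec y)) =
      invForm W (toReal a) (toReal l) + ((a ⬝ᵥ y : ℤ) : ℝ) := by
    rw [← invForm_mulVec hW]
    simp only [invForm, Matrix.mulVec_add, dotProduct_add]
  rw [this, ← e_add_int _ (a ⬝ᵥ y)]
  congr 1
  push_cast
  ring

theorem norm_gaussWeight (k : ℕ) (a l : V → ℤ) : ‖gaussWeight W k a l‖ = 1 := by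
  rw [gaussWeight, norm_e, Complex.ofReal_im]; simp

/-- Frees the weight from the chosen representative of b, so that it can be moved inside the sum
over l in the class b. -/
theorem gaussWeight_out (hW : (-(realMatrix W)).PosDef) (k : ℕ) (a l : V → ℤ) :
    gaussWeight W k a (Quotient.out (toCoker (2 • W) l)) = gaussWeight W k a l := by
  have h1 : toCoker (2 • W) (Quotient.out (toCoker (2 • W) l)) = toCoker (2 • W) l :=
    Quotient.out_eq _
  obtain ⟨y, hy⟩ := (Submodule.Quotient.eq _).1 h1
  have h2 : Quotient.out (toCoker (2 • W) l) = l + W.mulVec (2 • y) := by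
    rw [Matrix.mulVecLin_apply, Matrix.smul_mulVec] at hy
    rw [Matrix.mulVec_smul, hy]; abel
  rw [h2, gaussWeight_add hW]

variable {G : SimpleGraph V} [DecidableRel G.Adj] {w : V → ℤ}

/-- The general term of the series for the invariants, in the chamber given by `s`. -/
def seriesTerm (G : SimpleGraph V) [DecidableRel G.Adj] (w : V → ℤ) (τ : ℂ) (s : V → ℤˣ)
    (l : V → ℤ) : ℂ :=
  e ((Q (linkingMatrix G w) (toReal l) / 4 : ℝ) * τ) * ∏ v, vertexCoeff (s v) (G.degree v) (l v)

theorem exists_vertexCoeff_bound_uniform (s : V → ℤˣ) (d : V → ℕ) :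
    ∃ C : ℝ, ∀ v l, ‖vertexCoeff (s v) (d v) l‖ ≤ C * Real.exp (1 * |(l : ℝ)|) := by
  choose C hC0 hC using fun v => exists_vertexCoeff_bound (s v) (d v)
  refine ⟨∑ v, C v, fun v l => (hC v l).trans ?_⟩
  rw [one_mul]
  exact mul_le_mul_of_nonneg_right
    (Finset.single_le_sum (fun v _ => (hC0 v).le) (Finset.mem_univ v)) (Real.exp_pos _).le

theorem summable_seriesTerm (hW : (-(realMatrix (linkingMatrix G w))).PosDef) {τ : ℂ}
    (hτ : 0 < τ.im) (s : V → ℤˣ) : Summable fun l => ‖seriesTerm G w τ s l‖ := by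
  obtain ⟨C, hC⟩ := exists_vertexCoeff_bound_uniform s (fun v => G.degree v)
  exact summable_theta_norm hW hτ hC

theorem mem_degreeClasses_of_seriesTerm_ne_zero {τ : ℂ} {s : V → ℤˣ} {l : V → ℤ}
    (h : seriesTerm G w τ s l ≠ 0) : toCoker (2 • linkingMatrix G w) l ∈ degreeClasses G w := by
  have h1 : ∀ v, Even (l v - G.degree v) := fun v =>
    even_of_vertexCoeff_ne_zero (Finset.prod_ne_zero_iff.1 (right_ne_zero_of_mul h) v (Finset.mem_univ v))
  choose n hn using h1
  refine ⟨n, congrArg _ (funext fun v => ?_)⟩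
  have := hn v
  simp [degreeVector]
  omega

theorem det_two_smul_ne_zero (hW : (-(realMatrix W)).PosDef) : (2 • W).det ≠ 0 := by
  rw [Matrix.det_smul_of_tower]
  have := det_ne_zero_of_posDef hW
  simp [this]

/-- The classes b partition ℤ^V, so the sums over b and over l in b merge into one. Restricting b to
2ℤ^V + δ loses nothing, since outside it some vertex coefficient vanishes by parity. -/
theorem weightedSum_eq (hW : (-(realMatrix (linkingMatrix G w))).PosDef)
    [Fintype (Coker (linkingMatrix G w))] (k : ℕ) {τ : ℂ} (hτ : 0 < τ.im) :
    weightedSum G w k τ = (1 / 2) ^ Fintype.card V * ∑ s : V → ℤˣ, ∑' l : V → ℤ,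
      (∑ a : Coker (linkingMatrix G w), gaussWeight (linkingMatrix G w) k (Quotient.out a) l) *
        seriesTerm G w τ s l := by
  classical
  have : Finite (Coker (2 • linkingMatrix G w)) := finite_coker (det_two_smul_ne_zero hW)
  have := Fintype.ofFinite (Coker (2 • linkingMatrix G w))
  have hZ : ∀ b, Zhat G w b τ * e (weightExponent w * τ) = (1 / 2) ^ Fintype.card V *
      ∑ s : V → ℤˣ, ∑' l : {l : V → ℤ // toCoker (2 • linkingMatrix G w) l = b},
        seriesTerm G w τ s l := fun b => by
    rw [Zhat, mul_right_comm, ← e_add, neg_add_cancel, e_zero, one_mul,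
      principalValue_integrand hW b hτ]
    rfl
  rw [weightedSum, finsum_eq_sum_of_fintype]
  have hb : ∀ a : Coker (linkingMatrix G w),
      (∑ᶠ (b : Coker (2 • linkingMatrix G w)) (_ : b ∈ degreeClasses G w),
        gaussWeight (linkingMatrix G w) k (Quotient.out a) (Quotient.out b) *
          (Zhat G w b τ * e (weightExponent w * τ))) =
      (1 / 2) ^ Fintype.card V * ∑ s : V → ℤˣ, ∑' l : V → ℤ,
        gaussWeight (linkingMatrix G w) k (Quotient.out a) l * seriesTerm G w τ s l := fun a => by
    rw [finsum_eq_sum_of_fintype]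
    have hterm : ∀ b : Coker (2 • linkingMatrix G w), (∑ᶠ (_ : b ∈ degreeClasses G w),
        gaussWeight (linkingMatrix G w) k (Quotient.out a) (Quotient.out b) *
          (Zhat G w b τ * e (weightExponent w * τ))) =
        (1 / 2) ^ Fintype.card V * ∑ s : V → ℤˣ,
          ∑' l : {l : V → ℤ // toCoker (2 • linkingMatrix G w) l = b},
            gaussWeight (linkingMatrix G w) k (Quotient.out a) l * seriesTerm G w τ s l := fun b => by
      rw [finsum_eq_if, hZ, mul_left_comm, Finset.mul_sum]
      split_ifs with h
      · congr 1
        refine Finset.sum_congr rfl fun s _ => ?_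
        rw [← tsum_mul_left]
        refine tsum_congr fun l => ?_
        rw [← gaussWeight_out hW k _ (l : V → ℤ), l.2]
      · symm
        rw [Finset.sum_eq_zero, mul_zero]
        intro s _
        rw [← tsum_zero (α := ℂ) (β := {l : V → ℤ // toCoker (2 • linkingMatrix G w) l = b})]
        refine tsum_congr fun l => ?_
        by_contra hne
        exact h (l.2 ▸ mem_degreeClasses_of_seriesTerm_ne_zero (right_ne_zero_of_mul hne))
    simp only [hterm]
    rw [← Finset.mul_sum, Finset.sum_comm]
    congr 1
    refine Finset.sum_congr rfl fun s _ => ?_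
    have hs : Summable fun l => gaussWeight (linkingMatrix G w) k (Quotient.out a) l *
        seriesTerm G w τ s l := by
      refine Summable.of_norm ((summable_seriesTerm hW hτ s).congr fun l => ?_)
      rw [norm_mul, norm_gaussWeight, one_mul]
    have h1 := ((Equiv.sigmaFiberEquiv (toCoker (2 • linkingMatrix G w))).summable_iff).2 hs
    rw [← (Equiv.sigmaFiberEquiv (toCoker (2 • linkingMatrix G w))).tsum_eq]
    refine Eq.trans ?_ h1.tsum_sigma.symm
    rw [tsum_fintype]
    rfl
  simp only [hb]
  rw [← Finset.mul_sum, Finset.sum_comm]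
  congr 1
  refine Finset.sum_congr rfl fun s _ => ?_
  simp only [Finset.sum_mul]
  rw [Summable.tsum_finsetSum]
  intro a _
  refine Summable.of_norm ((summable_seriesTerm hW hτ s).congr fun l => ?_)
  rw [norm_mul, norm_gaussWeight, one_mul]

end Sums

/-! ### Gaussian integrals over shifted contours -/

section Contour
variable {V : Type*} [Fintype V] [DecidableEq V]

/-- The point of the contour `ℝ^V + i s` above `ξ`. -/
def contour (s : V → ℤˣ) (ξ : V → ℝ) : V → ℂ := fun v => (ξ v : ℂ) + ((s v : ℤ) : ℂ) * I

@[fun_prop]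
theorem continuous_contour (s : V → ℤˣ) : Continuous (contour s) := by
  unfold contour; fun_prop

/-- The integral of `h` over `ℝ^V + i s` against a Gaussian kernel. -/
def contourIntegral (A : Matrix V V ℝ) (s : V → ℤˣ) (h : (V → ℂ) → ℂ) : ℂ :=
  ∫ ξ : V → ℝ, cexp (-cform A (contour s ξ) (contour s ξ)) * h (contour s ξ)

/-- On ξ + iη the real part of the form is A(ξ, ξ) - A(η, η). -/
theorem exists_kernel_bound {A : Matrix V V ℝ} (hA : A.PosDef) (s : V → ℤˣ) :
    ∃ c > 0, ∃ C > 0, ∀ ξ : V → ℝ, ‖cexp (-cform A (contour s ξ) (contour s ξ))‖ ≤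
      C * Real.exp (-c * ∑ v, ξ v ^ 2) := by
  obtain ⟨c, hc, h⟩ := exists_coercive hA
  set η : V → ℝ := fun v => ((s v : ℤ) : ℝ) with hη
  refine ⟨c, hc, Real.exp (η ⬝ᵥ A.mulVec η), Real.exp_pos _, fun ξ => ?_⟩
  have h1 : contour s ξ = (fun v => (ξ v : ℂ)) + I • (fun v => (η v : ℂ)) := by
    ext v; simp [contour, hη, mul_comm]
  rw [Complex.norm_exp, ← Real.exp_add]
  refine Real.exp_le_exp.2 ?_
  rw [h1, cform_add_left, cform_add_right, cform_add_right, cform_smul_left, cform_smul_right,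
    cform_smul_left, cform_smul_right]
  simp only [cform_ofReal]
  have := h ξ
  simp
  linarith

/-- The right side does not involve s. Writing ζ = ξ + iη turns the kernel into a Gaussian in ξ with
a complex linear term, so no contour deformation is needed: the terms in η cancel algebraically. -/
theorem integral_contour_linear {A : Matrix V V ℝ} (hA : A.PosDef) (s : V → ℤˣ) (x : V → ℝ) :
    contourIntegral A s (fun ζ => cexp (I * ∑ v, (x v : ℂ) * ζ v)) =
      (Real.pi : ℂ) ^ (Fintype.card V / 2 : ℂ) * ((Real.sqrt A.det)⁻¹ : ℝ) *
        cexp (-cform A⁻¹ (fun v => (x v : ℂ)) (fun v => (x v : ℂ)) / 4) := by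
  have hsymm : A.IsSymm := by
    have := hA.isHermitian
    rwa [Matrix.IsHermitian, Matrix.conjTranspose_eq_transpose_of_trivial] at this
  set η : V → ℝ := fun v => ((s v : ℤ) : ℝ) with hη
  set η' : V → ℂ := fun v => (η v : ℂ) with hη'
  set x' : V → ℂ := fun v => (x v : ℂ) with hx'
  set κ : V → ℂ := fun v => ((A.mulVec η v : ℝ) : ℂ) with hκ
  have h1 : ∀ ξ, contour s ξ = (fun v => (ξ v : ℂ)) + I • η' := fun ξ => by
    ext v; simp [contour, hη, hη', mul_comm]
  have hu : IsUnit A.det := isUnit_iff_ne_zero.2 hA.det_pos.ne'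
  have hlin : ∀ z : V → ℂ, cform A z η' = ∑ v, κ v * z v := fun z => by
    simp only [cform, hκ, Matrix.mulVec, dotProduct, hη']
    push_cast
    simp only [Finset.sum_mul]
    exact Finset.sum_congr rfl fun i _ => Finset.sum_congr rfl fun j _ => by ring
  have hinv1 : cform A⁻¹ x' κ = ∑ v, x' v * η' v := by
    rw [hx', hκ, cform_ofReal, Matrix.mulVec_mulVec, Matrix.nonsing_inv_mul _ hu, Matrix.one_mulVec]
    simp [dotProduct, hη']
  have hinv2 : cform A⁻¹ κ κ = cform A η' η' := by
    rw [hκ, hη', cform_ofReal, cform_ofReal, Matrix.mulVec_mulVec, Matrix.nonsing_inv_mul _ hu,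
      Matrix.one_mulVec, dotProduct_comm]
  have hsymm' : (A⁻¹).IsSymm := by
    rw [Matrix.IsSymm, Matrix.transpose_nonsing_inv, hsymm.eq]
  have h2 := integral_gaussian_linear hA (p := 1) (by simp) (I • (x' + (-2 : ℂ) • κ))
  have h3 : ∀ ξ : V → ℝ, cexp (-cform A (contour s ξ) (contour s ξ)) *
      cexp (I * ∑ v, (x v : ℂ) * contour s ξ v) =
      cexp (cform A η' η' - ∑ v, x' v * η' v) *
      cexp (-1 * cform A (fun v => (ξ v : ℂ)) (fun v => (ξ v : ℂ)) +
        ∑ v, (I • (x' + (-2 : ℂ) • κ)) v * ξ v) := fun ξ => by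
    rw [← Complex.exp_add, ← Complex.exp_add, h1]
    congr 1
    rw [cform_add_left, cform_add_right, cform_add_right, cform_smul_left, cform_smul_right,
      cform_smul_left, cform_smul_right, cform_comm hsymm η', hlin (fun v => (ξ v : ℂ))]
    simp only [Pi.add_apply, Pi.smul_apply, smul_eq_mul, mul_add, add_mul, Finset.sum_add_distrib,
      Finset.mul_sum, ← mul_assoc, I_mul_I]
    have e1 : ∀ v, I * x v * I * η' v = - (x' v * η' v) := fun v => by
      rw [hx']; linear_combination (x v : ℂ) * η' v * I_mul_I
    have e2 : ∀ v, I * (-2) * κ v * (ξ v : ℂ) = -2 * (I * κ v * ξ v) := fun v => by ring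
    simp only [e1, e2, Finset.sum_neg_distrib, ← Finset.mul_sum, hx']
    ring
  rw [contourIntegral]
  simp only [h3]
  rw [integral_const_mul, h2, mul_left_comm, ← Complex.exp_add, div_one]
  congr 2
  rw [cform_smul_left, cform_smul_right, cform_add_left, cform_add_right, cform_add_right,
    cform_smul_left, cform_smul_right, cform_smul_left, cform_smul_right, cform_comm hsymm' κ x',
    hinv1, hinv2]
  ring_nf
  rw [I_sq]
  ring

/-- The normalizing constant of the Gaussian kernel. -/
def gaussConst (A : Matrix V V ℝ) : ℂ :=
  (Real.pi : ℂ) ^ (Fintype.card V / 2 : ℂ) * ((Real.sqrt A.det)⁻¹ : ℝ)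

theorem gaussConst_ne_zero {A : Matrix V V ℝ} (hA : A.PosDef) : gaussConst A ≠ 0 := by
  refine mul_ne_zero ?_ ?_
  · rw [Complex.cpow_ne_zero_iff]; left; simp
  · simp only [Complex.ofReal_inv]
    exact inv_ne_zero (by exact_mod_cast (Real.sqrt_pos.2 hA.det_pos).ne')

theorem integral_contour_Q {W : Matrix V V ℤ} (hW : (-(realMatrix W)).PosDef) (s : V → ℤˣ)
    (x : V → ℝ) :
    contourIntegral (-(realMatrix W)) s (fun ζ => cexp (I * ∑ v, (x v : ℂ) * ζ v)) =
      gaussConst (-(realMatrix W)) * ((Real.exp (-Q W x / 4) : ℝ) : ℂ) := by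
  rw [integral_contour_linear hW, gaussConst, cform_ofReal, inv_neg_realMatrix hW,
    Matrix.neg_mulVec, dotProduct_neg, Complex.ofReal_exp]
  congr 2
  push_cast [Q, invForm]
  ring

/-- Replace e^(-tQ(l)/4) by the Gaussian average of e^(i√t l·ζ) and sum over l inside. On the
contour |e^(i√t ζ_v)| = e^(-s_v √t), so the inverse lies on the side of the unit circle given by
s_v, exactly where the expansion with coefficients `vertexCoeff (s v)` converges. -/
theorem tsum_vertexCoeff_eq_contourIntegral {W : Matrix V V ℤ} (hW : (-(realMatrix W)).PosDef)
    (s : V → ℤˣ) (d : V → ℕ) {c : V → ℂ} (hc : ∀ v, ‖c v‖ = 1) {t : ℝ} (ht : 0 < t) :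
    ∑' l : V → ℤ, ((Real.exp (-(t * Q W (toReal l)) / 4) : ℝ) : ℂ) *
        ∏ v, (vertexCoeff (s v) (d v) (l v) * c v ^ l v) =
      (gaussConst (-(realMatrix W)))⁻¹ * contourIntegral (-(realMatrix W)) s (fun ζ =>
        ∏ v, vertexFactor (d v) (c v * cexp (I * Real.sqrt t * ζ v))⁻¹) := by
  set A := -(realMatrix W) with hA
  have hst : 0 < Real.sqrt t := Real.sqrt_pos.2 ht
  set y : V → ℂ → ℂ := fun v ζ => c v * cexp (I * Real.sqrt t * ζ) with hy
  have hc0 : ∀ v, c v ≠ 0 := fun v h => by simpa [h] using hc v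
  have hy0 : ∀ v ζ, y v ζ ≠ 0 := fun v ζ => mul_ne_zero (hc0 v) (Complex.exp_ne_zero _)
  have hyn : ∀ (ξ : V → ℝ) v, ‖y v (contour s ξ v)‖ = Real.exp (-(Real.sqrt t * ((s v : ℤ) : ℝ))) :=
    fun ξ v => by
      simp only [hy, contour]
      rw [norm_mul, hc, one_mul, Complex.norm_exp]
      congr 1
      simp
  have hlog : ∀ (ξ : V → ℝ) v, 0 < ((s v : ℤ) : ℝ) * Real.log ‖(y v (contour s ξ v))⁻¹‖ := fun ξ v => by
    rw [norm_inv, hyn, Real.log_inv, Real.log_exp]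
    rcases Int.units_eq_one_or (s v) with h | h <;> rw [h] <;> simpa using hst
  have hsum : ∀ (ξ : V → ℝ) v, HasSum (fun n : ℤ => vertexCoeff (s v) (d v) n * y v (contour s ξ v) ^ n)
      (vertexFactor (d v) (y v (contour s ξ v))⁻¹) := fun ξ v => by
    have := hasSum_vertexCoeff (d v) (hlog ξ v)
    simpa using this
  -- These norms do not depend on ξ, so the interchange of sum and integral only needs absolute
  -- convergence at ξ = 0.
  have hnorm : ∀ (ξ : V → ℝ) (l : V → ℤ), ‖∏ v, (vertexCoeff (s v) (d v) (l v) *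
      y v (contour s ξ v) ^ l v)‖ = ‖∏ v, (vertexCoeff (s v) (d v) (l v) *
        y v (contour s 0 v) ^ l v)‖ := fun ξ l => by
    rw [norm_prod, norm_prod]
    refine Finset.prod_congr rfl fun v _ => ?_
    rw [norm_mul, norm_mul, norm_zpow, norm_zpow, hyn, hyn]
  have hprod : ∀ ξ : V → ℝ, HasSum (fun l : V → ℤ => ∏ v, (vertexCoeff (s v) (d v) (l v) *
      y v (contour s ξ v) ^ l v)) (∏ v, vertexFactor (d v) (y v (contour s ξ v))⁻¹) := fun ξ => by
    have := hasSum_prod_pi (f := fun v n => vertexCoeff (s v) (d v) n * y v (contour s ξ v) ^ n)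
      (fun v => (hsum ξ v).summable.norm)
    simpa only [(hsum ξ _).tsum_eq] using this
  have hterm : ∀ l : V → ℤ, ((Real.exp (-(t * Q W (toReal l)) / 4) : ℝ) : ℂ) *
        ∏ v, (vertexCoeff (s v) (d v) (l v) * c v ^ l v) =
      (gaussConst A)⁻¹ * ∫ ξ : V → ℝ, cexp (-cform A (contour s ξ) (contour s ξ)) *
        ∏ v, (vertexCoeff (s v) (d v) (l v) * y v (contour s ξ v) ^ l v) := fun l => by
    have h1 := integral_contour_Q hW s (Real.sqrt t • toReal l)
    have h2 : Q W (Real.sqrt t • toReal l) = t * Q W (toReal l) := by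
      simp only [Q, invForm, Matrix.mulVec_smul, smul_dotProduct, dotProduct_smul, smul_eq_mul]
      rw [mul_neg, ← mul_assoc, Real.mul_self_sqrt ht.le]
    rw [h2] at h1
    rw [← mul_right_inj' (gaussConst_ne_zero hW), ← mul_assoc, ← h1, ← mul_assoc,
      mul_inv_cancel₀ (gaussConst_ne_zero hW), one_mul, contourIntegral, ← integral_mul_const]
    refine integral_congr_ae (Filter.Eventually.of_forall fun ξ => ?_)
    simp only
    rw [mul_assoc]
    congr 1
    rw [Finset.mul_sum, Complex.exp_sum, ← Finset.prod_mul_distrib]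
    refine Finset.prod_congr rfl fun v _ => ?_
    rw [mul_left_comm]
    congr 1
    simp only [hy]
    rw [mul_zpow, ← Complex.exp_int_mul, mul_comm]
    congr 2
    simp only [Pi.smul_apply, smul_eq_mul, toReal]
    push_cast; ring
  simp only [hterm]
  rw [tsum_mul_left]
  congr 1
  obtain ⟨κ, hκ, C, hC, hb⟩ := exists_kernel_bound hW s
  have hi : Integrable fun ξ : V → ℝ => cexp (-cform A (contour s ξ) (contour s ξ)) := by
    refine ((integrable_gaussian_pi (V := V) hκ 0).const_mul C).mono' ?_
      (Filter.Eventually.of_forall fun ξ => ?_)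
    · exact Continuous.aestronglyMeasurable (by fun_prop)
    · simpa using hb ξ
  have hcont : ∀ l : V → ℤ, Continuous fun ξ : V → ℝ => ∏ v, (vertexCoeff (s v) (d v) (l v) *
      y v (contour s ξ v) ^ l v) := fun l => by
    refine continuous_finsetProd _ fun v _ => Continuous.mul continuous_const ?_
    refine Continuous.zpow₀ ?_ _ fun ξ => Or.inl (hy0 v _)
    simp only [hy, contour]
    fun_prop
  rw [integral_tsum_of_summable_integral_norm]
  · rw [contourIntegral]
    refine integral_congr_ae (Filter.Eventually.of_forall fun ξ => ?_)
    simp only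
    rw [tsum_mul_left, (hprod ξ).tsum_eq]
  · intro l
    refine hi.mul_bdd (c := ‖∏ v, (vertexCoeff (s v) (d v) (l v) *
        y v (contour s 0 v) ^ l v)‖) (hcont l).aestronglyMeasurable
        (Filter.Eventually.of_forall fun ξ => (hnorm ξ l).le)
  · simp only [norm_mul, hnorm, integral_mul_const]
    exact Summable.mul_left _ (hprod 0).summable.norm

end Contour

/-! ### Exact contour formula for the weighted sum -/

section Exact
variable {V : Type*} [Fintype V] [DecidableEq V] {G : SimpleGraph V} [DecidableRel G.Adj] {w : V → ℤ}

/-- The phase `𝐞(ᵗμ W μ / 4k)`. -/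
def gaussPhase (W : Matrix V V ℤ) (k : ℕ) (μ : V → Fin (2 * k)) : ℂ :=
  e (((fun v => ((μ v : ℕ) : ℤ)) ⬝ᵥ W.mulVec (fun v => ((μ v : ℕ) : ℤ)) : ℤ) / (4 * k))

/-- The root of unity `ζ_{2k}^m`. -/
def unityRoot (k m : ℕ) : ℂ := e (1 / (2 * k)) ^ m

theorem norm_unityRoot (k m : ℕ) : ‖unityRoot k m‖ = 1 := by
  rw [unityRoot, norm_pow, norm_e]
  have : (1 / (2 * (k : ℂ))).im = 0 := by
    rw [show (1 / (2 * (k : ℂ))) = ((1 / (2 * k) : ℝ) : ℂ) by push_cast; rfl, Complex.ofReal_im]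
  rw [this]; simp

theorem even_sum_degree : Even (∑ v, G.degree v) := by
  rw [G.sum_degrees_eq_twice_card_edges]; exact even_two_mul _

/-- No asymptotics yet. The root-of-unity part of q^(Q(l)/4) combines with the Gauss weights into
the sum over a that `quadratic_reciprocity` evaluates; the remaining part e^(-tQ(l)/4) is handled by
`tsum_vertexCoeff_eq_contourIntegral`, one μ at a time. -/
theorem weightedSum_eq_contourIntegral (hW : (-(realMatrix (linkingMatrix G w))).PosDef) {k : ℕ}
    (hk : 0 < k) {t : ℝ} (ht : 0 < t) :
    weightedSum G w k (1 / k + I * t / (2 * Real.pi)) =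
      e (1 / 8) ^ Fintype.card V * (Real.sqrt |((linkingMatrix G w).det : ℝ)| : ℂ) /
        (Real.sqrt (2 * k) : ℂ) ^ Fintype.card V *
      ((1 / 2) ^ Fintype.card V * ∑ s : V → ℤˣ, ∑ μ : V → Fin (2 * k),
        gaussPhase (linkingMatrix G w) k μ * ((gaussConst (-(realMatrix (linkingMatrix G w))))⁻¹ *
          contourIntegral (-(realMatrix (linkingMatrix G w))) s (fun ζ =>
            ∏ v, vertexFactor (G.degree v) (unityRoot k (μ v) * cexp (I * Real.sqrt t * ζ v))))) := by
  have hpi : (Real.pi : ℂ) ≠ 0 := by exact_mod_cast Real.pi_ne_zero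
  have hτ : 0 < (1 / (k : ℂ) + I * t / (2 * Real.pi)).im := by
    rw [show (1 / (k : ℂ) + I * t / (2 * Real.pi)) = ((1 / k : ℝ) : ℂ) + ((t / (2 * Real.pi) : ℝ) : ℂ) * I by
      push_cast; ring]
    rw [Complex.add_im, Complex.ofReal_im, Complex.im_ofReal_mul, I_im]
    have := Real.pi_pos
    simp only [zero_add, mul_one]
    positivity
  have := finite_coker (det_ne_zero_of_posDef hW)
  have := Fintype.ofFinite (Coker (linkingMatrix G w))
  rw [weightedSum_eq hW k hτ, mul_left_comm]
  congr 1
  rw [Finset.mul_sum]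
  refine Finset.sum_congr rfl fun s _ => ?_
  have hsplit : ∀ l : V → ℤ, seriesTerm G w (1 / k + I * t / (2 * Real.pi)) s l =
      e ((Q (linkingMatrix G w) (toReal l) / (4 * k) : ℝ)) *
        (((Real.exp (-(t * Q (linkingMatrix G w) (toReal l)) / 4) : ℝ) : ℂ) *
          ∏ v, vertexCoeff (s v) (G.degree v) (l v)) := fun l => by
    rw [seriesTerm, ← mul_assoc]
    congr 1
    rw [e, e, Complex.ofReal_exp, ← Complex.exp_add]
    congr 1
    have : (k : ℂ) ≠ 0 := by exact_mod_cast hk.ne'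
    push_cast
    field_simp
    ring_nf
    rw [I_sq]
    ring
  simp only [hsplit, ← mul_assoc, Finset.sum_mul]
  simp only [← Finset.sum_mul, quadratic_reciprocity hW hk]
  simp only [mul_assoc]
  rw [tsum_mul_left]
  have hroot : ∀ (μ : V → Fin (2 * k)) (l : V → ℤ),
      e (((∑ v, ((μ v : ℕ) : ℤ) * l v : ℤ) : ℂ) / (2 * k)) = ∏ v, unityRoot k (μ v) ^ l v := fun μ l => by
    push_cast
    rw [Finset.sum_div, e_sum]
    refine Finset.prod_congr rfl fun v _ => ?_
    rw [unityRoot, e, e, ← Complex.exp_nat_mul, ← Complex.exp_int_mul]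
    congr 1; ring
  have hgs : ∀ l : V → ℤ, gaussSum (linkingMatrix G w) k l *
      (((Real.exp (-(t * Q (linkingMatrix G w) (toReal l)) / 4) : ℝ) : ℂ) *
        ∏ v, vertexCoeff (s v) (G.degree v) (l v)) =
      ∑ μ : V → Fin (2 * k), gaussPhase (linkingMatrix G w) k μ *
        (((Real.exp (-(t * Q (linkingMatrix G w) (toReal l)) / 4) : ℝ) : ℂ) *
          ∏ v, (vertexCoeff (s v) (G.degree v) (l v) * unityRoot k (μ v) ^ l v)) := fun l => by
    rw [gaussSum, Finset.sum_mul]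
    refine Finset.sum_congr rfl fun μ _ => ?_
    rw [hroot, Finset.prod_mul_distrib, gaussPhase]
    ring
  have hsum : ∀ μ : V → Fin (2 * k), Summable fun l : V → ℤ =>
      gaussPhase (linkingMatrix G w) k μ *
        (((Real.exp (-(t * Q (linkingMatrix G w) (toReal l)) / 4) : ℝ) : ℂ) *
          ∏ v, (vertexCoeff (s v) (G.degree v) (l v) * unityRoot k (μ v) ^ l v)) := fun μ => by
    refine Summable.mul_left _ (Summable.of_norm ((summable_seriesTerm hW hτ s).congr fun l => ?_))
    rw [hsplit, norm_mul, norm_e, Complex.ofReal_im, norm_mul, norm_mul, Finset.prod_mul_distrib,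
      norm_mul, norm_prod (f := fun v => unityRoot k (μ v) ^ l v)]
    simp [norm_unityRoot]
  simp only [hgs]
  rw [Summable.tsum_finsetSum (fun μ _ => hsum μ)]
  congr 1
  refine Finset.sum_congr rfl fun μ _ => ?_
  rw [tsum_mul_left, tsum_vertexCoeff_eq_contourIntegral hW s _
    (fun v => norm_unityRoot k (μ v)) ht]
  -- Removing the inverses inside the vertex factors costs ∏ (-1)^(deg v), which is 1 by the
  -- handshake lemma.
  simp only [vertexFactor_inv, Finset.prod_mul_distrib, Finset.prod_pow_eq_pow_sum,
    (even_sum_degree (G := G)).neg_one_pow, one_mul]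
  simp only [mul_assoc]

end Exact


/-! ### Calculus of asymptotic power series at the origin -/

section FormalExpansion
open Asymptotics Filter

/-- The function `h` has the asymptotic power series `ψ` at the origin. -/
def HasPowerExpansion (h : ℂ → ℂ) (ψ : PowerSeries ℂ) : Prop :=
  ∀ J : ℕ, ∃ p : Polynomial ℂ, (PowerSeries.X ^ J ∣ ψ - (p : PowerSeries ℂ)) ∧
    (fun T => h T - p.eval T) =O[𝓝[≠] 0] fun T => T ^ J

namespace HasPowerExpansion
variable {h h₁ h₂ : ℂ → ℂ} {ψ ψ₁ ψ₂ : PowerSeries ℂ}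

theorem polynomial_isBigO_one (p : Polynomial ℂ) :
    (fun T => p.eval T) =O[𝓝[≠] (0 : ℂ)] fun _ => (1 : ℂ) :=
  ((p.continuous.tendsto 0).mono_left nhdsWithin_le_nhds).isBigO_one ℂ

theorem isBigO_one (H : HasPowerExpansion h ψ) : h =O[𝓝[≠] (0 : ℂ)] fun _ => (1 : ℂ) := by
  obtain ⟨p, -, hp⟩ := H 0
  simpa using (hp.trans (by simpa using isBigO_refl (fun _ : ℂ => (1:ℂ)) _)).add (polynomial_isBigO_one p)

theorem eval_isBigO {p : Polynomial ℂ} {J : ℕ} (hp : PowerSeries.X ^ J ∣ (p : PowerSeries ℂ)) :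
    (fun T => p.eval T) =O[𝓝[≠] (0 : ℂ)] fun T => T ^ J := by
  have h1 : Polynomial.X ^ J ∣ p := by
    rw [Polynomial.X_pow_dvd_iff]
    rw [PowerSeries.X_pow_dvd_iff] at hp
    intro d hd; simpa using hp d hd
  obtain ⟨r, rfl⟩ := h1
  simpa using (isBigO_refl (fun T : ℂ => T ^ J) (𝓝[≠] 0)).mul (polynomial_isBigO_one r)

theorem isBigO_of_dvd (H : HasPowerExpansion h ψ) {J : ℕ} (hJ : PowerSeries.X ^ J ∣ ψ) :
    h =O[𝓝[≠] (0 : ℂ)] fun T => T ^ J := by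
  obtain ⟨p, h1, hp⟩ := H J
  have h2 : PowerSeries.X ^ J ∣ (p : PowerSeries ℂ) := (dvd_sub_right hJ).1 h1
  simpa using hp.add (eval_isBigO h2)

theorem eval_trunc (ψ : PowerSeries ℂ) (J : ℕ) (T : ℂ) :
    (ψ.trunc J).eval T = ∑ i ∈ Finset.range J, ψ.coeff i * T ^ i := by
  simpa [Polynomial.eval₂_eq_eval_map] using
    PowerSeries.eval₂_trunc_eq_sum_range T (RingHom.id ℂ) J ψ

/-- The definition leaves the approximating polynomial free modulo X^J, which makes it stable under
products and inverses. Here the canonical truncation is recovered. -/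
theorem sub_trunc (H : HasPowerExpansion h ψ) (J : ℕ) :
    (fun T => h T - ∑ i ∈ Finset.range J, ψ.coeff i * T ^ i) =O[𝓝[≠] (0 : ℂ)] fun T => T ^ J := by
  obtain ⟨p, h1, hp⟩ := H J
  have h2 : PowerSeries.X ^ J ∣ ((p - ψ.trunc J : Polynomial ℂ) : PowerSeries ℂ) := by
    rw [PowerSeries.X_pow_dvd_iff] at h1 ⊢
    intro d hd
    have := h1 d hd
    rw [map_sub, Polynomial.coeff_coe] at this
    rw [Polynomial.coeff_coe, Polynomial.coeff_sub, PowerSeries.coeff_trunc, if_pos hd,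
      ← sub_eq_zero.1 this, sub_self]
  refine (hp.add (eval_isBigO h2)).congr_left fun T => ?_
  rw [Polynomial.eval_sub, eval_trunc]
  ring

theorem mul (H₁ : HasPowerExpansion h₁ ψ₁) (H₂ : HasPowerExpansion h₂ ψ₂) :
    HasPowerExpansion (fun T => h₁ T * h₂ T) (ψ₁ * ψ₂) := fun J => by
  obtain ⟨p, hp, hp'⟩ := H₁ J
  obtain ⟨q, hq, hq'⟩ := H₂ J
  refine ⟨p * q, ?_, ?_⟩
  · rw [Polynomial.coe_mul, show ψ₁ * ψ₂ - p * q = (ψ₁ - p) * ψ₂ + p * (ψ₂ - q) by ring]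
    exact dvd_add (hp.mul_right _) (hq.mul_left _)
  · have h1 := hp'.mul H₂.isBigO_one
    have h2 := (polynomial_isBigO_one p).mul hq'
    simp only [mul_one, one_mul] at h1 h2
    refine (h1.add h2).congr_left fun T => ?_
    simp only [Polynomial.eval_mul]; ring

theorem sub (H₁ : HasPowerExpansion h₁ ψ₁) (H₂ : HasPowerExpansion h₂ ψ₂) :
    HasPowerExpansion (fun T => h₁ T - h₂ T) (ψ₁ - ψ₂) := fun J => by
  obtain ⟨p, hp, hp'⟩ := H₁ J
  obtain ⟨q, hq, hq'⟩ := H₂ J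
  refine ⟨p - q, ?_, ?_⟩
  · rw [Polynomial.coe_sub, show ψ₁ - ψ₂ - (p - q) = (ψ₁ - p) - (ψ₂ - q) by ring]
    exact dvd_sub hp hq
  · refine (hp'.sub hq').congr_left fun T => ?_
    simp only [Polynomial.eval_sub]; ring

theorem polynomial (p : Polynomial ℂ) : HasPowerExpansion (fun T => p.eval T) p := fun J =>
  ⟨p, by simp, by simpa using isBigO_zero _ _⟩

theorem const (c : ℂ) : HasPowerExpansion (fun _ => c) (PowerSeries.C c) := by
  simpa using polynomial (Polynomial.C c)

theorem id_pow (n : ℕ) : HasPowerExpansion (fun T => T ^ n) (PowerSeries.X ^ n) := by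
  simpa using polynomial (Polynomial.X ^ n)

theorem pow (H : HasPowerExpansion h ψ) (n : ℕ) : HasPowerExpansion (fun T => h T ^ n) (ψ ^ n) := by
  induction n with
  | zero => simpa using const 1
  | succ n ih => simpa only [pow_succ] using ih.mul H

theorem tendsto (H : HasPowerExpansion h ψ) :
    Tendsto h (𝓝[≠] 0) (𝓝 (PowerSeries.constantCoeff ψ)) := by
  have h1 := (H.sub_trunc 1).trans_tendsto (by
    simpa using (show Tendsto (fun T : ℂ => T) (𝓝[≠] 0) (𝓝 0) from nhdsWithin_le_nhds))
  have h2 := h1.add_const (PowerSeries.constantCoeff ψ)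
  simpa using h2

theorem inv (H : HasPowerExpansion h ψ) (h0 : PowerSeries.constantCoeff ψ ≠ 0) :
    HasPowerExpansion (fun T => (h T)⁻¹) ψ⁻¹ := fun J => by
  set q := (ψ⁻¹).trunc J with hq
  have hdq : PowerSeries.X ^ J ∣ ψ⁻¹ - (q : PowerSeries ℂ) := by
    rw [PowerSeries.X_pow_dvd_iff]
    intro d hd
    rw [map_sub, Polynomial.coeff_coe, hq, PowerSeries.coeff_trunc, if_pos hd, sub_self]
  refine ⟨q, hdq, ?_⟩
  have h1 : PowerSeries.X ^ J ∣ PowerSeries.C 1 - ψ * (q : PowerSeries ℂ) := by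
    have : PowerSeries.C 1 - ψ * (q : PowerSeries ℂ) = ψ * (ψ⁻¹ - (q : PowerSeries ℂ)) := by
      rw [mul_sub, PowerSeries.mul_inv_cancel _ h0, map_one]
    rw [this]; exact hdq.mul_left _
  have h2 := ((const 1).sub (H.mul (polynomial q))).isBigO_of_dvd h1
  have h3 := (H.tendsto.inv₀ h0).isBigO_one ℂ
  have h4 := h3.mul h2
  simp only [one_mul] at h4
  refine h4.congr' ?_ EventuallyEq.rfl
  filter_upwards [H.tendsto.eventually_ne h0] with T hT
  field_simp

theorem div_id (H : HasPowerExpansion h (PowerSeries.X * ψ)) :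
    HasPowerExpansion (fun T => h T / T) ψ := fun J => by
  obtain ⟨p, hp, hp'⟩ := H (J + 1)
  have hX : Polynomial.X ∣ p := by
    rw [Polynomial.X_dvd_iff]
    rw [PowerSeries.X_pow_dvd_iff] at hp
    have := hp 0 (by omega)
    simpa using this
  obtain ⟨r, rfl⟩ := hX
  refine ⟨r, ?_, ?_⟩
  · rw [Polynomial.coe_mul, Polynomial.coe_X, ← mul_sub, pow_succ'] at hp
    exact (mul_dvd_mul_iff_left PowerSeries.X_ne_zero).1 hp
  · have h1 := hp'.mul (isBigO_refl (fun T : ℂ => T⁻¹) (𝓝[≠] 0))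
    refine h1.congr' ?_ ?_ <;> filter_upwards [self_mem_nhdsWithin] with T (hT : T ≠ 0)
    · simp; field_simp
    · field_simp; ring

theorem exp : HasPowerExpansion cexp (PowerSeries.exp ℂ) := fun J => by
  refine ⟨(PowerSeries.exp ℂ).trunc J, ?_, ?_⟩
  · rw [PowerSeries.X_pow_dvd_iff]
    intro d hd
    rw [map_sub, Polynomial.coeff_coe, PowerSeries.coeff_trunc, if_pos hd, sub_self]
  · refine ((Complex.exp_sub_sum_range_isBigO_pow J).mono nhdsWithin_le_nhds).congr_left fun T => ?_
    rw [eval_trunc]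
    simp only [PowerSeries.coeff_exp]
    congr 1
    refine Finset.sum_congr rfl fun i _ => ?_
    simp
    ring

theorem rescale (H : HasPowerExpansion h ψ) {a : ℂ} (ha : a ≠ 0) :
    HasPowerExpansion (fun T => h (a * T)) (PowerSeries.rescale a ψ) := fun J => by
  obtain ⟨p, hp, hp'⟩ := H J
  refine ⟨p.comp (Polynomial.C a * Polynomial.X), ?_, ?_⟩
  · rw [PowerSeries.X_pow_dvd_iff] at hp ⊢
    intro d hd
    have := hp d hd
    rw [map_sub, Polynomial.coeff_coe] at this
    rw [map_sub, Polynomial.coeff_coe, Polynomial.comp_C_mul_X_coeff, PowerSeries.coeff_rescale,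
      sub_eq_zero.1 this]
    ring
  · have ht : Tendsto (fun T : ℂ => a * T) (𝓝[≠] 0) (𝓝[≠] 0) := by
      refine tendsto_nhdsWithin_iff.2 ⟨?_, ?_⟩
      · have : Tendsto (fun T : ℂ => a * T) (𝓝 0) (𝓝 (a * 0)) := (continuous_const_mul a).tendsto 0
        rw [mul_zero] at this
        exact this.mono_left nhdsWithin_le_nhds
      · filter_upwards [self_mem_nhdsWithin] with T (hT : T ≠ 0)
        exact mul_ne_zero ha hT
    have h1 := hp'.comp_tendsto ht
    have h2 : ((fun T : ℂ => T ^ J) ∘ fun T => a * T) =O[𝓝[≠] 0] fun T => T ^ J := by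
      simp only [Function.comp_def, mul_pow]
      exact (isBigO_refl _ _).const_mul_left _
    refine (h1.trans h2).congr_left fun T => ?_
    simp

theorem eq_zero (H : HasPowerExpansion (fun _ => 0) ψ) : ψ = 0 := by
  ext n
  induction n using Nat.strong_induction_on generalizing ψ with
  | _ n ih =>
    have h0 : PowerSeries.constantCoeff ψ = 0 :=
      tendsto_nhds_unique H.tendsto tendsto_const_nhds
    obtain ⟨u, rfl⟩ := PowerSeries.X_dvd_iff.2 h0
    have hu : HasPowerExpansion (fun _ => 0) u := by simpa only [zero_div] using H.div_id
    rcases n with _ | n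
    · simp
    · rw [PowerSeries.coeff_succ_X_mul, ih n (by omega) hu]; simp

/-- Converts functional equations into identities between formal coefficients. -/
theorem unique (H₁ : HasPowerExpansion h ψ₁) (H₂ : HasPowerExpansion h ψ₂) : ψ₁ = ψ₂ := by
  have := H₁.sub H₂
  simp only [sub_self] at this
  exact sub_eq_zero.1 this.eq_zero

end HasPowerExpansion

end FormalExpansion

/-! ### Laurent expansion of F(c e^T) at T = 0 -/

section VertexExpansion
open Asymptotics Filter

theorem constMulExp_sub_inv {c : ℂ} (hc : c ≠ 0) :
    constMulExp c - (constMulExp c)⁻¹ = ((PowerSeries.C c * PowerSeries.exp ℂ -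
      PowerSeries.C c⁻¹ * PowerSeries.rescale (-1) (PowerSeries.exp ℂ) : PowerSeries ℂ) :
        LaurentSeries ℂ) := by
  have h1 : constMulExp c = ((PowerSeries.C c * PowerSeries.exp ℂ : PowerSeries ℂ) :
      LaurentSeries ℂ) := by
    rw [constMulExp, PowerSeries.coe_mul, PowerSeries.coe_C]
  have h2 : (constMulExp c)⁻¹ = ((PowerSeries.C c⁻¹ * PowerSeries.rescale (-1) (PowerSeries.exp ℂ) :
      PowerSeries ℂ) : LaurentSeries ℂ) := by
    refine inv_eq_of_mul_eq_one_right ?_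
    rw [h1, ← PowerSeries.coe_mul]
    have := PowerSeries.exp_mul_exp_neg_eq_one (A := ℂ)
    rw [PowerSeries.evalNegHom] at this
    rw [show PowerSeries.C c * PowerSeries.exp ℂ *
      (PowerSeries.C c⁻¹ * PowerSeries.rescale (-1) (PowerSeries.exp ℂ)) =
      (PowerSeries.C c * PowerSeries.C c⁻¹) *
        (PowerSeries.exp ℂ * PowerSeries.rescale (-1) (PowerSeries.exp ℂ)) by ring, this,
      ← map_mul, mul_inv_cancel₀ hc]
    simp
  rw [h2, h1, PowerSeries.coe_sub]

/-- The truncated difference d - 2 bounds the pole order and is 0 for d ≤ 2. The function c e^T - (c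
e^T)⁻¹ vanishes at 0 exactly when c² = 1, and then to first order, with derivative 2c; otherwise
there is no pole, whence the last clause. A single ψ serves both the formal and the analytic
statement, so that the formally defined `laurentCoeff` controls the actual function. -/
theorem exists_powerExpansion (d : ℕ) {c : ℂ} (hc : c ≠ 0) : ∃ ψ : PowerSeries ℂ,
    vertexFactor d (constMulExp c) = HahnSeries.single (-((d - 2 : ℕ) : ℤ)) 1 * (ψ : LaurentSeries ℂ) ∧
    HasPowerExpansion (fun T => T ^ (d - 2) * vertexFactor d (c * cexp T)) ψ ∧
    (c ^ 2 ≠ 1 → PowerSeries.X ^ (d - 2) ∣ ψ) := by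
  set y : PowerSeries ℂ := PowerSeries.C c * PowerSeries.exp ℂ -
      PowerSeries.C c⁻¹ * PowerSeries.rescale (-1) (PowerSeries.exp ℂ) with hy
  have hyL : constMulExp c - (constMulExp c)⁻¹ = (y : LaurentSeries ℂ) := constMulExp_sub_inv hc
  have hyE : HasPowerExpansion (fun T => c * cexp T - (c * cexp T)⁻¹) y := by
    have := ((HasPowerExpansion.const c).mul .exp).sub
      ((HasPowerExpansion.const c⁻¹).mul (HasPowerExpansion.exp.rescale (a := -1) (by simp)))
    convert this using 3 with T
    rw [mul_inv, ← Complex.exp_neg, neg_one_mul]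
  have hinv : ∀ u : PowerSeries ℂ, PowerSeries.constantCoeff u ≠ 0 →
      (u : LaurentSeries ℂ)⁻¹ = ((u⁻¹ : PowerSeries ℂ) : LaurentSeries ℂ) := fun u hu => by
    refine inv_eq_of_mul_eq_one_right ?_
    rw [← PowerSeries.coe_mul, PowerSeries.mul_inv_cancel _ hu, PowerSeries.coe_one]
  have hsX : ∀ n : ℕ, HahnSeries.single (-(n : ℤ)) (1 : ℂ) *
      ((PowerSeries.X ^ n : PowerSeries ℂ) : LaurentSeries ℂ) = 1 := fun n => by
    rw [PowerSeries.coe_pow, PowerSeries.coe_X, HahnSeries.single_pow, HahnSeries.single_mul_single]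
    simp
  rcases le_or_gt d 2 with hd | hd
  · obtain ⟨j, hj⟩ := Nat.exists_eq_add_of_le hd
    have e1 : d - 2 = 0 := by omega
    have e2 : (2 - (d : ℤ)) = (j : ℕ) := by omega
    refine ⟨y ^ j, ?_, ?_, fun _ => by simp [e1]⟩
    · rw [vertexFactor, hyL, e2, zpow_natCast, e1, PowerSeries.coe_pow]
      simp
    · simp only [vertexFactor, e1, e2, zpow_natCast, pow_zero, one_mul]
      exact hyE.pow j
  · obtain ⟨n, hn⟩ : ∃ n, d - 2 = n := ⟨_, rfl⟩
    have e2 : (2 - (d : ℤ)) = -(n : ℕ) := by omega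
    simp only [vertexFactor, hyL, hn, e2, zpow_neg, zpow_natCast]
    by_cases h0 : PowerSeries.constantCoeff y = 0
    · obtain ⟨u, hu⟩ := PowerSeries.X_dvd_iff.2 h0
      have hcc : c - c⁻¹ = 0 := by
        have h := h0
        rw [← PowerSeries.coeff_zero_eq_constantCoeff_apply, hy, map_sub, PowerSeries.coeff_C_mul,
          PowerSeries.coeff_C_mul, PowerSeries.coeff_rescale] at h
        simpa [PowerSeries.coeff_exp] using h
      have hc2 : c ^ 2 = 1 := by
        have := congrArg (· * c) hcc
        simp only [sub_mul, inv_mul_cancel₀ hc, zero_mul] at this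
        linear_combination this
      have hu0 : PowerSeries.constantCoeff u ≠ 0 := by
        have h1 : PowerSeries.constantCoeff u = c + c⁻¹ := by
          have h2 := congrArg (PowerSeries.coeff 1) hu
          rw [← zero_add 1, PowerSeries.coeff_succ_X_mul, zero_add,
            PowerSeries.coeff_zero_eq_constantCoeff_apply] at h2
          rw [← h2, hy, map_sub, PowerSeries.coeff_C_mul, PowerSeries.coeff_C_mul,
            PowerSeries.coeff_rescale]
          simp [PowerSeries.coeff_exp]
        rw [h1, ← sub_eq_zero.1 hcc, ← two_mul]
        exact mul_ne_zero two_ne_zero hc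
      refine ⟨(u⁻¹) ^ n, ?_, ?_, fun h => absurd hc2 h⟩
      · rw [PowerSeries.coe_pow, ← hinv u hu0, hu, PowerSeries.coe_mul, mul_pow, mul_inv, inv_pow,
          ← PowerSeries.coe_pow, inv_eq_of_mul_eq_one_left (hsX n)]
      · rw [hu] at hyE
        have := (hyE.div_id.inv hu0).pow n
        convert this using 2 with T
        rw [inv_div, div_pow, div_eq_mul_inv]
    · refine ⟨PowerSeries.X ^ n * (y⁻¹) ^ n, ?_, ?_, fun _ => dvd_mul_right _ _⟩
      · rw [PowerSeries.coe_mul, ← mul_assoc, hsX, one_mul, PowerSeries.coe_pow, ← hinv y h0, inv_pow]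
      · simpa only [inv_pow] using (HasPowerExpansion.id_pow n).mul ((hyE.inv h0).pow n)

/-- The coefficients of the Laurent series `F(c e^t)`. -/
def laurentCoeff (d : ℕ) (c : ℂ) (j : ℤ) : ℂ := (vertexFactor d (constMulExp c)).coeff j

theorem coeff_single_mul_coe (n : ℕ) (ψ : PowerSeries ℂ) (j : ℤ) :
    (HahnSeries.single (-(n : ℤ)) 1 * (ψ : LaurentSeries ℂ) : LaurentSeries ℂ).coeff j =
      if j < -(n : ℤ) then 0 else ψ.coeff (j + n).toNat := by
  have h1 := HahnSeries.coeff_single_mul_add (r := (1 : ℂ)) (x := (ψ : LaurentSeries ℂ))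
    (a := j + n) (b := -(n : ℤ))
  rw [show j + n + -(n : ℤ) = j by ring, one_mul, PowerSeries.coeff_coe] at h1
  rw [h1]
  by_cases h : j < -(n : ℤ)
  · rw [if_pos h, if_pos (by omega)]
  · rw [if_neg h, if_neg (by omega)]
    congr 2
    omega

theorem laurentCoeff_eq_zero {d : ℕ} {c : ℂ} (hc : c ≠ 0) {j : ℤ} (hj : j < -((d - 2 : ℕ) : ℤ)) :
    laurentCoeff d c j = 0 := by
  obtain ⟨ψ, h1, -, -⟩ := exists_powerExpansion d hc
  rw [laurentCoeff, h1, coeff_single_mul_coe, if_pos hj]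

theorem sq_eq_one_of_laurentCoeff_ne_zero {d : ℕ} {c : ℂ} (hc : c ≠ 0) {j : ℤ} (hj : j < 0)
    (h : laurentCoeff d c j ≠ 0) : c ^ 2 = 1 := by
  by_contra hc2
  obtain ⟨ψ, h1, -, h3⟩ := exists_powerExpansion d hc
  refine h ?_
  rw [laurentCoeff, h1, coeff_single_mul_coe]
  split_ifs with h4
  · rfl
  · exact (PowerSeries.X_pow_dvd_iff.1 (h3 hc2)) _ (by omega)

/-- F(c⁻¹e^T) = (-1)^d F(c e^(-T)), transferred to the coefficients by `HasPowerExpansion.unique`.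
-/
theorem laurentCoeff_inv {d : ℕ} {c : ℂ} (hc : c ≠ 0) (j : ℤ) :
    laurentCoeff d c⁻¹ j = (-1) ^ (j + d) * laurentCoeff d c j := by
  obtain ⟨ψ, h1, h2, -⟩ := exists_powerExpansion d hc
  obtain ⟨χ, h1', h2', -⟩ := exists_powerExpansion d (inv_ne_zero hc)
  set n := d - 2 with hn
  have h3 := h2'.rescale (a := -1) (by simp)
  have h4 := (HasPowerExpansion.const ((-1) ^ (n + d))).mul h2
  have h5 : PowerSeries.rescale (-1) χ = PowerSeries.C ((-1) ^ (n + d)) * ψ := by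
    refine h3.unique ?_
    convert h4 using 2 with T
    rw [neg_one_mul, Complex.exp_neg, ← mul_inv, vertexFactor_inv, neg_pow]
    ring
  rw [laurentCoeff, laurentCoeff, h1, h1', coeff_single_mul_coe, coeff_single_mul_coe]
  split_ifs with h6
  · simp
  · obtain ⟨i, hi⟩ : ∃ i : ℕ, j + n = i := ⟨(j + n).toNat, by omega⟩
    have h7 := congrArg (PowerSeries.coeff i) h5
    rw [PowerSeries.coeff_rescale, PowerSeries.coeff_C_mul] at h7
    rw [hi, Int.toNat_natCast]
    have h8 : (-1 : ℂ) ^ (j + d) = (-1) ^ i * (-1) ^ (n + d) := by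
      rw [show j + (d : ℤ) = (i : ℤ) + (n + d : ℕ) - 2 * n by omega,
        zpow_sub₀ (by simp), zpow_mul, zpow_add₀ (by simp)]
      simp only [zpow_natCast]
      norm_num
    rw [h8, mul_assoc, ← h7, ← mul_assoc, ← mul_pow]
    simp

/-- The Laurent polynomial obtained by cutting the expansion of `F(c e^T)` at order `J`. -/
def laurentCut (d : ℕ) (c : ℂ) (J : ℕ) (T : ℂ) : ℂ :=
  ∑ j ∈ Finset.Ico (-((d - 2 : ℕ) : ℤ)) J, laurentCoeff d c j * T ^ j

theorem vertexFactor_sub_laurentCut_isBigO (d : ℕ) {c : ℂ} (hc : c ≠ 0) (J : ℕ) :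
    (fun T => vertexFactor d (c * cexp T) - laurentCut d c J T) =O[𝓝[≠] 0] fun T => T ^ J := by
  obtain ⟨ψ, h1, h2, -⟩ := exists_powerExpansion d hc
  have h3 := h2.sub_trunc (J + (d - 2))
  have h4 := h3.mul (isBigO_refl (fun T : ℂ => (T ^ (d - 2))⁻¹) (𝓝[≠] 0))
  refine h4.congr' ?_ ?_ <;> filter_upwards [self_mem_nhdsWithin] with T (hT : T ≠ 0)
  · rw [sub_mul, mul_right_comm, mul_inv_cancel₀ (pow_ne_zero _ hT), one_mul]
    congr 1
    rw [laurentCut, Finset.sum_mul]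
    refine Finset.sum_bij' (fun i _ => (i : ℤ) - (d - 2 : ℕ)) (fun j _ => (j + (d - 2 : ℕ)).toNat)
      ?_ ?_ ?_ ?_ ?_
    · intro i hi; simp at hi ⊢; omega
    · intro i hi; simp only [Finset.mem_Ico, Finset.mem_range] at hi ⊢; omega
    · intro i hi; simp
    · intro i hi; simp only [Finset.mem_Ico] at hi; omega
    · intro i hi
      rw [laurentCoeff, h1, coeff_single_mul_coe, if_neg (by omega), sub_add_cancel,
        Int.toNat_natCast, zpow_sub₀ hT, zpow_natCast, zpow_natCast]
      ring
  · rw [pow_add, mul_assoc, mul_inv_cancel₀ (pow_ne_zero _ hT), mul_one]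

end VertexExpansion


/-! ### Uniform estimates for one vertex factor along the contour -/

section OneVariable
open Asymptotics Filter

theorem one_add_abs_pow_le (m : ℕ) (x : ℝ) :
    (1 + |x|) ^ m ≤ (m.factorial * Real.exp 1) * Real.exp |x| := by
  have h := Real.pow_div_factorial_le_exp (1 + |x|) (by positivity) m
  rw [div_le_iff₀ (by positivity), Real.exp_add] at h
  linarith

theorem norm_contour_coord (x : ℝ) (σ : ℤˣ) :
    1 ≤ ‖(x : ℂ) + ((σ : ℤ) : ℂ) * I‖ ∧ ‖(x : ℂ) + ((σ : ℤ) : ℂ) * I‖ ≤ 1 + |x| := by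
  have h2 : ‖((σ : ℤ) : ℂ) * I‖ = 1 := by
    rcases Int.units_eq_one_or σ with h | h <;> simp [h]
  constructor
  · have := Complex.abs_im_le_norm ((x : ℂ) + ((σ : ℤ) : ℂ) * I)
    refine le_trans ?_ this
    rcases Int.units_eq_one_or σ with h | h <;> simp [h]
  · refine (norm_add_le _ _).trans ?_
    rw [h2, Complex.norm_real, Real.norm_eq_abs, add_comm]

theorem contour_coord_ne_zero (x : ℝ) (σ : ℤˣ) : (x : ℂ) + ((σ : ℤ) : ℂ) * I ≠ 0 := fun h => by
  have := (norm_contour_coord x σ).1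
  rw [h, norm_zero] at this
  linarith

theorem norm_cexp_contour_coord (x r : ℝ) (σ : ℤˣ) :
    ‖cexp (I * r * (x + ((σ : ℤ) : ℂ) * I))‖ = Real.exp (-(r * ((σ : ℤ) : ℝ))) := by
  rw [Complex.norm_exp]
  congr 1
  simp

/-- On the contour one of |y|, |y⁻¹| is e^r and the other e^(-r), so |y - y⁻¹| lies between e^r -
e^(-r) ≥ r and 2e^r. The lower bound is uniform in x even when c = ±1, since the contour keeps away
from the poles. -/
theorem norm_sub_inv_bounds {c : ℂ} (hc : ‖c‖ = 1) {r : ℝ} (hr : 0 < r) (x : ℝ) (σ : ℤˣ) :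
    r ≤ ‖c * cexp (I * r * (x + ((σ : ℤ) : ℂ) * I)) - (c * cexp (I * r * (x + ((σ : ℤ) : ℂ) * I)))⁻¹‖ ∧
    ‖c * cexp (I * r * (x + ((σ : ℤ) : ℂ) * I)) - (c * cexp (I * r * (x + ((σ : ℤ) : ℂ) * I)))⁻¹‖ ≤
      2 * Real.exp r := by
  set y := c * cexp (I * r * (x + ((σ : ℤ) : ℂ) * I)) with hy
  have hn : ‖y‖ = Real.exp (-(r * ((σ : ℤ) : ℝ))) := by
    rw [hy, norm_mul, hc, one_mul, norm_cexp_contour_coord]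
  have hn' : ‖y⁻¹‖ = Real.exp (r * ((σ : ℤ) : ℝ)) := by
    rw [norm_inv, hn, ← Real.exp_neg, neg_neg]
  have h1 : r + 1 ≤ Real.exp r := Real.add_one_le_exp r
  have h2 : Real.exp (-r) ≤ 1 := Real.exp_le_one_iff.2 (by linarith)
  rcases Int.units_eq_one_or σ with h | h <;> simp only [h] at hn hn' <;> simp at hn hn' <;> rw [← norm_inv] at hn'
  · have a1 := norm_sub_norm_le y⁻¹ y
    have a2 := norm_sub_le y y⁻¹
    rw [norm_sub_rev] at a1
    constructor <;> linarith
  · have a1 := norm_sub_norm_le y y⁻¹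
    have a2 := norm_sub_le y y⁻¹
    constructor <;> linarith

/-- The constant 36 = 6² comes from d = 0, where |y - y⁻¹| ≤ 2e^r ≤ 6. -/
theorem norm_vertexFactor_le (d : ℕ) {c : ℂ} (hc : ‖c‖ = 1) {r : ℝ} (hr : 0 < r) (hr1 : r < 1)
    (x : ℝ) (σ : ℤˣ) :
    ‖vertexFactor d (c * cexp (I * r * (x + ((σ : ℤ) : ℂ) * I)))‖ ≤ 36 * (r ^ (d - 2))⁻¹ := by
  obtain ⟨h1, h2⟩ := norm_sub_inv_bounds hc hr x σ
  rw [vertexFactor, norm_zpow]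
  set z := ‖c * cexp (I * r * (x + ((σ : ℤ) : ℂ) * I)) - (c * cexp (I * r * (x + ((σ : ℤ) : ℂ) * I)))⁻¹‖
  have h3 : Real.exp r ≤ 3 := (Real.exp_le_exp.2 hr1.le).trans (by
    have := Real.exp_one_lt_d9; linarith)
  rcases le_or_gt d 2 with hd | hd
  · have e1 : d - 2 = 0 := by omega
    rw [e1, pow_zero, inv_one, mul_one]
    have hz : z ≤ 6 := by linarith
    have hz0 : 0 ≤ z := norm_nonneg _
    interval_cases d <;> norm_num <;> nlinarith
  · obtain ⟨n, hn⟩ : ∃ n, d - 2 = n := ⟨_, rfl⟩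
    have e2 : (2 - (d : ℤ)) = -(n : ℕ) := by omega
    rw [e2, hn, zpow_neg, zpow_natCast]
    have h4 : (z ^ n)⁻¹ ≤ (r ^ n)⁻¹ := inv_anti₀ (by positivity) (pow_le_pow_left₀ hr.le h1 n)
    have : 0 ≤ (r ^ n)⁻¹ := by positivity
    linarith

theorem norm_zpow_le_of_between {T : ℂ} {ρ : ℝ} (hρ : 0 < ρ) (hρ1 : ρ ≤ 1) (hT : ρ ≤ ‖T‖) {n J : ℕ}
    {j : ℤ} (h1 : -(n : ℤ) ≤ j) (h2 : j < J) : ‖T ^ j‖ ≤ (ρ ^ (J + n))⁻¹ * ‖T‖ ^ J := by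
  obtain ⟨i, hi⟩ : ∃ i : ℕ, (J : ℤ) - j = i := ⟨((J : ℤ) - j).toNat, by omega⟩
  have hT0 : 0 < ‖T‖ := hρ.trans_le hT
  rw [norm_zpow, show j = (J : ℤ) - i by omega, zpow_sub₀ hT0.ne', zpow_natCast, zpow_natCast,
    div_eq_mul_inv, mul_comm]
  refine mul_le_mul_of_nonneg_right (inv_anti₀ (by positivity) ?_) (by positivity)
  calc ρ ^ (J + n) ≤ ρ ^ i := pow_le_pow_of_le_one hρ.le hρ1 (by omega)
    _ ≤ ‖T‖ ^ i := pow_le_pow_left₀ hρ.le hT i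

/-- For ‖T‖ < ρ the expansion at 0 applies. For ‖T‖ ≥ ρ both terms are bounded separately. For the
vertex factor, 1 ≤ (‖T‖/ρ)^(J+n) and ‖T‖ ≤ r(1 + |x|) supply r^J, the extra n powers paying for the
bound r^(-n). The polynomial growth in x is absorbed by e^|x|. -/
theorem exists_norm_vertexFactor_sub_le (d : ℕ) {c : ℂ} (hc : ‖c‖ = 1) (J : ℕ) (σ : ℤˣ) :
    ∃ K : ℝ, 0 ≤ K ∧ ∀ r : ℝ, 0 < r → r < 1 → ∀ x : ℝ,
      ‖vertexFactor d (c * cexp (I * r * (x + ((σ : ℤ) : ℂ) * I))) -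
        laurentCut d c J (I * r * (x + ((σ : ℤ) : ℂ) * I))‖ ≤ K * r ^ J * Real.exp |x| := by
  have hc0 : c ≠ 0 := fun h => by simp [h] at hc
  obtain ⟨K₀, hK₀, hb⟩ := (vertexFactor_sub_laurentCut_isBigO d hc0 J).exists_pos
  rw [IsBigOWith, eventually_nhdsWithin_iff, Metric.eventually_nhds_iff] at hb
  obtain ⟨ρ', hρ', hb⟩ := hb
  set n := d - 2 with hn
  set ρ := min ρ' 1 with hρdef
  have hρ : 0 < ρ := lt_min hρ' one_pos
  have hρ1 : ρ ≤ 1 := min_le_right _ _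
  set S : ℝ := ∑ j ∈ Finset.Ico (-(n : ℤ)) J, ‖laurentCoeff d c j‖ with hS
  have hS0 : 0 ≤ S := Finset.sum_nonneg fun _ _ => norm_nonneg _
  set R := (ρ ^ (J + n))⁻¹ with hR
  have hR0 : 0 ≤ R := by positivity
  set E : ℕ → ℝ := fun m => m.factorial * Real.exp 1 with hE
  refine ⟨K₀ * E J + 36 * R * E (J + n) + S * R * E J, by positivity, fun r hr hr1 x => ?_⟩
  set ζ := (x : ℂ) + ((σ : ℤ) : ℂ) * I with hζ
  obtain ⟨hζ1, hζ2⟩ := norm_contour_coord x σ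
  have hTn : ‖I * r * ζ‖ = r * ‖ζ‖ := by simp [abs_of_pos hr]
  have hTle : ‖I * r * ζ‖ ≤ r * (1 + |x|) := by rw [hTn]; gcongr
  have hTge : r ≤ ‖I * r * ζ‖ := by rw [hTn]; nlinarith
  have hT0 : I * r * ζ ≠ 0 := norm_pos_iff.1 (hr.trans_le hTge)
  have hJ : ‖I * r * ζ‖ ^ J ≤ r ^ J * (E J * Real.exp |x|) := by
    refine (pow_le_pow_left₀ (norm_nonneg _) hTle J).trans ?_
    rw [mul_pow]
    exact mul_le_mul_of_nonneg_left (one_add_abs_pow_le J x) (by positivity)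
  have hpos : 0 ≤ r ^ J * Real.exp |x| := by positivity
  have hE0 : ∀ m, 0 ≤ E m := fun m => by positivity
  rcases lt_or_ge ‖I * r * ζ‖ ρ with h | h
  · have h1 := hb (y := I * r * ζ) (by rw [dist_zero_right]; exact h.trans_le (min_le_left _ _)) hT0
    rw [norm_pow] at h1
    refine h1.trans ((mul_le_mul_of_nonneg_left hJ hK₀.le).trans ?_)
    have : 0 ≤ (36 * R * E (J + n) + S * R * E J) * (r ^ J * Real.exp |x|) :=
      mul_nonneg (add_nonneg (mul_nonneg (by positivity) (hE0 _)) (mul_nonneg (by positivity) (hE0 _))) hpos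
    nlinarith
  · have h1 : ‖vertexFactor d (c * cexp (I * r * ζ))‖ ≤
        36 * R * E (J + n) * (r ^ J * Real.exp |x|) := by
      refine (norm_vertexFactor_le d hc hr hr1 x σ).trans ?_
      have h2 : 1 ≤ R * ‖I * r * ζ‖ ^ (J + n) := by
        rw [hR, inv_mul_eq_div, one_le_div (by positivity)]
        exact pow_le_pow_left₀ hρ.le h _
      have h3 : ‖I * r * ζ‖ ^ (J + n) ≤ r ^ (J + n) * (E (J + n) * Real.exp |x|) := by
        refine (pow_le_pow_left₀ (norm_nonneg _) hTle _).trans ?_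
        rw [mul_pow]
        exact mul_le_mul_of_nonneg_left (one_add_abs_pow_le _ x) (by positivity)
      calc 36 * (r ^ n)⁻¹ = 36 * (r ^ n)⁻¹ * 1 := by ring
        _ ≤ 36 * (r ^ n)⁻¹ * (R * (r ^ (J + n) * (E (J + n) * Real.exp |x|))) := by
            refine mul_le_mul_of_nonneg_left (h2.trans ?_) (by positivity)
            exact mul_le_mul_of_nonneg_left h3 hR0
        _ = 36 * R * E (J + n) * (r ^ J * Real.exp |x|) := by
            rw [pow_add]
            field_simp
    have h2 : ‖laurentCut d c J (I * r * ζ)‖ ≤ S * R * E J * (r ^ J * Real.exp |x|) := by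
      rw [laurentCut]
      refine (norm_sum_le _ _).trans ?_
      calc _ ≤ ∑ j ∈ Finset.Ico (-(n : ℤ)) J, ‖laurentCoeff d c j‖ *
            (R * (r ^ J * (E J * Real.exp |x|))) := by
            refine Finset.sum_le_sum fun j hj => ?_
            rw [norm_mul]
            refine mul_le_mul_of_nonneg_left ?_ (norm_nonneg _)
            rw [Finset.mem_Ico] at hj
            exact (norm_zpow_le_of_between hρ hρ1 h hj.1 hj.2).trans
              (mul_le_mul_of_nonneg_left hJ hR0)
        _ = S * R * E J * (r ^ J * Real.exp |x|) := by
            rw [← Finset.sum_mul]; ring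
    refine (norm_sub_le _ _).trans ((add_le_add h1 h2).trans ?_)
    have : 0 ≤ K₀ * E J * (r ^ J * Real.exp |x|) := mul_nonneg (mul_nonneg hK₀.le (hE0 _)) hpos
    nlinarith

theorem zpow_finset_sum {ι : Type*} {z : ℂ} (hz : z ≠ 0) (S : Finset ι) (m : ι → ℤ) :
    z ^ (∑ i ∈ S, m i) = ∏ i ∈ S, z ^ m i := by
  classical
  induction S using Finset.induction_on with
  | empty => simp
  | insert i S hi ih => rw [Finset.sum_insert hi, Finset.prod_insert hi, zpow_add₀ hz, ih]

/-- Telescoping, one factor exchanged at a time. -/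
theorem norm_sub_prod_le {ι : Type*} (S : Finset ι) {a b : ι → ℂ} {B : ι → ℝ} {δ : ℝ}
    (hδ : 0 ≤ δ) (ha : ∀ i, ‖a i‖ ≤ B i) (hb : ∀ i, ‖b i‖ ≤ B i)
    (hab : ∀ i, ‖a i - b i‖ ≤ δ * B i) :
    ‖∏ i ∈ S, a i - ∏ i ∈ S, b i‖ ≤ S.card * δ * ∏ i ∈ S, B i := by
  classical
  have hB : ∀ i, 0 ≤ B i := fun i => (norm_nonneg _).trans (ha i)
  induction S using Finset.induction_on with
  | empty => simp
  | insert i S hi ih =>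
    rw [Finset.prod_insert hi, Finset.prod_insert hi, Finset.prod_insert hi, Finset.card_insert_of_notMem hi,
      show a i * ∏ i ∈ S, a i - b i * ∏ i ∈ S, b i =
        (a i - b i) * ∏ i ∈ S, a i + b i * (∏ i ∈ S, a i - ∏ i ∈ S, b i) by ring]
    refine (norm_add_le _ _).trans ?_
    rw [norm_mul, norm_mul, norm_prod]
    have h1 : ∏ i ∈ S, ‖a i‖ ≤ ∏ i ∈ S, B i :=
      Finset.prod_le_prod (fun _ _ => norm_nonneg _) fun i _ => ha i
    have h2 := mul_le_mul (hab i) h1 (Finset.prod_nonneg fun _ _ => norm_nonneg _)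
      (mul_nonneg hδ (hB i))
    have h3 := mul_le_mul (hb i) ih (norm_nonneg _) (hB i)
    push_cast
    linarith

end OneVariable

/-! ### Gaussian moments and the expansion of the contour integrals -/

section Moments
variable {V : Type*} [Fintype V] [DecidableEq V] {A : Matrix V V ℝ}

theorem integrable_kernel_mul (hA : A.PosDef) (s : V → ℤˣ) {h : (V → ℂ) → ℂ} {B a : ℝ}
    (hc : Continuous fun ξ => h (contour s ξ))
    (hB : ∀ ξ, ‖h (contour s ξ)‖ ≤ B * Real.exp (a * ∑ v, |ξ v|)) :
    Integrable fun ξ : V → ℝ => cexp (-cform A (contour s ξ) (contour s ξ)) * h (contour s ξ) := by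
  obtain ⟨κ, hκ, C, hC, hk⟩ := exists_kernel_bound hA s
  refine ((integrable_gaussian_pi (V := V) hκ a).const_mul (C * B)).mono' ?_
    (Filter.Eventually.of_forall fun ξ => ?_)
  · exact (Continuous.mul (by fun_prop) hc).aestronglyMeasurable
  · rw [norm_mul, Real.exp_add]
    refine (mul_le_mul (hk ξ) (hB ξ) (norm_nonneg _) (by positivity)).trans (le_of_eq ?_)
    ring

theorem exists_norm_contourIntegral_le (hA : A.PosDef) (s : V → ℤˣ) :
    ∃ D : ℝ, 0 ≤ D ∧ ∀ (h : (V → ℂ) → ℂ) (B : ℝ),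
      (∀ ξ, ‖h (contour s ξ)‖ ≤ B * Real.exp (∑ v, |ξ v|)) → ‖contourIntegral A s h‖ ≤ D * B := by
  obtain ⟨κ, hκ, C, hC, hk⟩ := exists_kernel_bound hA s
  refine ⟨∫ ξ : V → ℝ, C * Real.exp (-κ * ∑ v, ξ v ^ 2 + 1 * ∑ v, |ξ v|),
    integral_nonneg fun ξ => by positivity, fun h B hB => ?_⟩
  rw [contourIntegral, ← integral_mul_const]
  refine norm_integral_le_of_norm_le
    (((integrable_gaussian_pi (V := V) hκ 1).const_mul C).mul_const B)
    (Filter.Eventually.of_forall fun ξ => ?_)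
  rw [norm_mul, Real.exp_add, one_mul]
  refine (mul_le_mul (hk ξ) (hB ξ) (norm_nonneg _) (by positivity)).trans (le_of_eq ?_)
  ring

theorem norm_zpow_contour_coord_le (x : ℝ) (σ : ℤˣ) {m : ℤ} {N : ℕ} (hm : m ≤ N) :
    ‖(I * ((x : ℂ) + ((σ : ℤ) : ℂ) * I)) ^ m‖ ≤ (N.factorial * Real.exp 1) * Real.exp |x| := by
  obtain ⟨h1, h2⟩ := norm_contour_coord x σ
  rw [norm_zpow, norm_mul, norm_I, one_mul]
  refine le_trans ?_ (one_add_abs_pow_le N x)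
  calc _ ≤ ‖(x : ℂ) + ((σ : ℤ) : ℂ) * I‖ ^ (N : ℤ) := zpow_le_zpow_right₀ h1 hm
    _ ≤ (1 + |x|) ^ N := by rw [zpow_natCast]; gcongr

theorem exists_norm_prod_zpow_le (s : V → ℤˣ) (m : V → ℤ) : ∃ B, 0 ≤ B ∧ ∀ ξ,
    ‖∏ v, (I * contour s ξ v) ^ m v‖ ≤ B * Real.exp (∑ v, |ξ v|) := by
  refine ⟨∏ v, (((m v).toNat.factorial : ℝ) * Real.exp 1),
    Finset.prod_nonneg fun _ _ => by positivity, fun ξ => ?_⟩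
  rw [norm_prod, Real.exp_sum, ← Finset.prod_mul_distrib]
  exact Finset.prod_le_prod (fun _ _ => norm_nonneg _) fun v _ =>
    norm_zpow_contour_coord_le _ _ (Int.self_le_toNat _)

theorem continuous_prod_zpow (s : V → ℤˣ) (m : V → ℤ) :
    Continuous fun ξ => ∏ v, (I * contour s ξ v) ^ m v := by
  refine continuous_finsetProd _ fun v _ => Continuous.zpow₀ ?_ _ fun ξ => Or.inl ?_
  · unfold contour; fun_prop
  · exact mul_ne_zero I_ne_zero (contour_coord_ne_zero _ _)

/-- The integral of the monomial `∏ (i ζ_v)^(m_v)` against the Gaussian kernel. -/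
def moment (A : Matrix V V ℝ) (s : V → ℤˣ) (m : V → ℤ) : ℂ :=
  contourIntegral A s fun ζ => ∏ v, (I * ζ v) ^ m v

theorem integrable_moment (hA : A.PosDef) (s : V → ℤˣ) (m : V → ℤ) :
    Integrable fun ξ : V → ℝ => cexp (-cform A (contour s ξ) (contour s ξ)) *
      ∏ v, (I * contour s ξ v) ^ m v := by
  obtain ⟨B, -, hB⟩ := exists_norm_prod_zpow_le s m
  exact integrable_kernel_mul hA s (h := fun ζ => ∏ v, (I * ζ v) ^ m v) (a := 1)
    (continuous_prod_zpow s m) (by simpa using hB)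

/-- The exponents of total degree `N` that are bounded below by `-n`. -/
def degreeSet (n : V → ℕ) (N : ℤ) : Finset (V → ℤ) :=
  (Fintype.piFinset fun v => Finset.Icc (-(n v : ℤ)) (N + ∑ u, (n u : ℤ))).filter
    fun m => ∑ v, m v = N

/-- The upper bound built into `degreeSet` only makes it visibly finite: it follows from the lower
bounds and the fixed total degree. -/
theorem mem_degreeSet {n : V → ℕ} {N : ℤ} {m : V → ℤ} :
    m ∈ degreeSet n N ↔ (∀ v, -(n v : ℤ) ≤ m v) ∧ ∑ v, m v = N := by
  simp only [degreeSet, Finset.mem_filter, Fintype.mem_piFinset, Finset.mem_Icc]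
  refine ⟨fun h => ⟨fun v => (h.1 v).1, h.2⟩, fun h => ⟨fun v => ⟨h.1 v, ?_⟩, h.2⟩⟩
  have h1 : 0 ≤ ∑ u ∈ Finset.univ.erase v, (m u + n u) :=
    Finset.sum_nonneg fun u _ => by have := h.1 u; omega
  have h2 := Finset.add_sum_erase Finset.univ (fun u => m u + (n u : ℤ)) (Finset.mem_univ v)
  have h3 : ∑ u, (m u + (n u : ℤ)) = N + ∑ u, (n u : ℤ) := by rw [Finset.sum_add_distrib, h.2]
  rw [h3] at h2
  omega

theorem degreeSet_eq_empty {n : V → ℕ} {N : ℤ} (h : N < -∑ v, (n v : ℤ)) : degreeSet n N = ∅ := by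
  refine Finset.eq_empty_of_forall_notMem fun m hm => ?_
  rw [mem_degreeSet] at hm
  have := Finset.sum_le_sum (s := Finset.univ) fun v _ => hm.1 v
  rw [Finset.sum_neg_distrib, hm.2] at this
  omega

theorem continuous_vertexFactor_contour (s : V → ℤˣ) (d : ℕ) {c : ℂ} (hc : ‖c‖ = 1) {r : ℝ}
    (hr : 0 < r) (v : V) :
    Continuous fun ξ => vertexFactor d (c * cexp (I * r * contour s ξ v)) := by
  have hc0 : c ≠ 0 := fun h => by simp [h] at hc
  have h1 : Continuous fun ξ => c * cexp (I * r * contour s ξ v) := by unfold contour; fun_prop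
  refine Continuous.zpow₀ (h1.sub (h1.inv₀ fun ξ => mul_ne_zero hc0 (Complex.exp_ne_zero _))) _
    fun ξ => Or.inl fun h => ?_
  have := (norm_sub_inv_bounds hc hr (ξ v) (s v)).1
  change (c * cexp (I * r * contour s ξ v)) - (c * cexp (I * r * contour s ξ v))⁻¹ = 0 at h
  change r ≤ ‖c * cexp (I * r * contour s ξ v) - (c * cexp (I * r * contour s ξ v))⁻¹‖ at this
  rw [h, norm_zero] at this
  linarith

/-- Replace every vertex factor by its Laurent cut, integrate the resulting Laurent polynomial
monomial by monomial, and collect by total degree. Monomials of degree above M go into the error. -/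
theorem exists_contour_expansion (hA : A.PosDef) (s : V → ℤˣ) (d : V → ℕ) {c : V → ℂ}
    (hc : ∀ v, ‖c v‖ = 1) (M : ℕ) : ∃ K : ℝ, 0 ≤ K ∧ ∀ r : ℝ, 0 < r → r < 1 →
      ‖contourIntegral A s (fun ζ => ∏ v, vertexFactor (d v) (c v * cexp (I * r * ζ v))) -
        ∑ N ∈ Finset.Icc (-((∑ v, (d v - 2) : ℕ) : ℤ)) M, (∑ m ∈ degreeSet (fun v => d v - 2) N,
          (∏ v, laurentCoeff (d v) (c v) (m v)) * moment A s m) * (r : ℂ) ^ N‖ ≤ K * r ^ (M + 1) := by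
  set n : V → ℕ := fun v => d v - 2 with hn
  set L : ℕ := ∑ v, n v with hL
  -- The factors may contribute poles of total order L, so each is cut L orders beyond M + 1.
  set J : ℕ := M + 1 + L with hJ
  choose K hK0 hK using fun v => exists_norm_vertexFactor_sub_le (d v) (hc v) J (s v)
  obtain ⟨D, hD0, hD⟩ := exists_norm_contourIntegral_le hA s
  set box : Finset (V → ℤ) := Fintype.piFinset fun v => Finset.Ico (-(n v : ℤ)) J with hbox
  set K' : ℝ := ∑ v, K v with hK'
  have hK'0 : 0 ≤ K' := Finset.sum_nonneg fun v _ => hK0 v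
  have hKK' : ∀ v, K v ≤ K' := fun v => Finset.single_le_sum (fun v _ => hK0 v) (Finset.mem_univ v)
  set co : (V → ℤ) → ℂ := fun m => ∏ v, laurentCoeff (d v) (c v) (m v) with hco
  refine ⟨D * (Fintype.card V * K' * (36 + K') ^ Fintype.card V) +
    ∑ m ∈ box, ‖co m * moment A s m‖, by positivity, fun r hr hr1 => ?_⟩
  have hr0 : (r : ℂ) ≠ 0 := by exact_mod_cast hr.ne'
  have hcut : ∀ ζ : V → ℂ, ∏ v, laurentCut (d v) (c v) J (I * r * ζ v) =
      ∑ m ∈ box, (co m * (r : ℂ) ^ (∑ v, m v)) * ∏ v, (I * ζ v) ^ m v := fun ζ => by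
    simp only [laurentCut]
    rw [Finset.prod_univ_sum]
    refine Finset.sum_congr rfl fun m _ => ?_
    simp only [hco]
    rw [zpow_finset_sum hr0, ← Finset.prod_mul_distrib, ← Finset.prod_mul_distrib]
    refine Finset.prod_congr rfl fun v _ => ?_
    rw [mul_assoc (laurentCoeff _ _ _), ← mul_zpow]
    congr 2; ring
  have hmain : contourIntegral A s (fun ζ => ∏ v, laurentCut (d v) (c v) J (I * r * ζ v)) =
      ∑ m ∈ box, co m * moment A s m * (r : ℂ) ^ (∑ v, m v) := by
    simp only [contourIntegral, hcut, Finset.mul_sum]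
    rw [integral_finsetSum]
    · refine Finset.sum_congr rfl fun m _ => ?_
      rw [moment, contourIntegral, mul_right_comm, ← integral_const_mul]
      refine integral_congr_ae (Filter.Eventually.of_forall fun ξ => ?_)
      simp only; ring
    · intro m _
      refine ((integrable_moment hA s m).const_mul (co m * (r : ℂ) ^ (∑ v, m v))).congr
        (Filter.Eventually.of_forall fun ξ => ?_)
      simp only; ring
  have herr : ∀ ξ : V → ℝ, ‖(∏ v, vertexFactor (d v) (c v * cexp (I * r * contour s ξ v))) -
      ∏ v, laurentCut (d v) (c v) J (I * r * contour s ξ v)‖ ≤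
      (Fintype.card V * K' * (36 + K') ^ Fintype.card V * r ^ (M + 1)) * Real.exp (∑ v, |ξ v|) := by
    intro ξ
    have hrn : ∀ v, 1 ≤ (r ^ n v)⁻¹ := fun v => by
      rw [one_le_inv₀ (by positivity)]; exact pow_le_one₀ hr.le hr1.le
    have hrJ : r ^ J ≤ 1 := pow_le_one₀ hr.le hr1.le
    have hex : ∀ v, 1 ≤ Real.exp |ξ v| := fun v => Real.one_le_exp (abs_nonneg _)
    have hd1 : ∀ v, ‖vertexFactor (d v) (c v * cexp (I * r * contour s ξ v)) -
        laurentCut (d v) (c v) J (I * r * contour s ξ v)‖ ≤ K' * r ^ J * Real.exp |ξ v| := fun v =>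
      (hK v r hr hr1 (ξ v)).trans (by gcongr; exact hKK' v)
    have ha1 : ∀ v, ‖vertexFactor (d v) (c v * cexp (I * r * contour s ξ v))‖ ≤
        36 * (r ^ n v)⁻¹ * Real.exp |ξ v| := fun v => by
      refine (norm_vertexFactor_le (d v) (hc v) hr hr1 (ξ v) (s v)).trans ?_
      exact le_mul_of_one_le_right (by positivity) (hex v)
    have hsm : ∀ v, K' * r ^ J * Real.exp |ξ v| ≤ K' * (r ^ n v)⁻¹ * Real.exp |ξ v| := fun v => by
      gcongr; exact hrJ.trans (hrn v)
    have h0 : ∀ v, 0 ≤ K' * (r ^ n v)⁻¹ * Real.exp |ξ v| := fun v => by positivity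
    have := norm_sub_prod_le Finset.univ
      (a := fun v => vertexFactor (d v) (c v * cexp (I * r * contour s ξ v)))
      (b := fun v => laurentCut (d v) (c v) J (I * r * contour s ξ v))
      (B := fun v => (36 + K') * (r ^ n v)⁻¹ * Real.exp |ξ v|) (δ := K' * r ^ J) (by positivity)
      (fun v => by have := h0 v; have := ha1 v; linarith)
      (fun v => by
        have h1 := norm_sub_norm_le (laurentCut (d v) (c v) J (I * r * contour s ξ v))
          (vertexFactor (d v) (c v * cexp (I * r * contour s ξ v)))
        rw [norm_sub_rev] at h1
        have := ha1 v; have := hd1 v; have := hsm v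
        linarith)
      (fun v => by
        refine (hd1 v).trans ?_
        have : 1 ≤ (36 + K') * (r ^ n v)⁻¹ := by nlinarith [hrn v]
        refine mul_le_mul_of_nonneg_left ?_ (by positivity)
        exact le_mul_of_one_le_left (by positivity) this)
    refine this.trans (le_of_eq ?_)
    rw [Finset.prod_mul_distrib, Finset.prod_mul_distrib, Finset.prod_const, ← Real.exp_sum,
      Finset.prod_inv_distrib, Finset.prod_pow_eq_pow_sum, ← hL, hJ, Finset.card_univ, pow_add r (M + 1)]
    field_simp
  have hsub : contourIntegral A s (fun ζ => ∏ v, vertexFactor (d v) (c v * cexp (I * r * ζ v))) -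
      contourIntegral A s (fun ζ => ∏ v, laurentCut (d v) (c v) J (I * r * ζ v)) =
      contourIntegral A s (fun ζ => (∏ v, vertexFactor (d v) (c v * cexp (I * r * ζ v))) -
        ∏ v, laurentCut (d v) (c v) J (I * r * ζ v)) := by
    simp only [contourIntegral]
    rw [← integral_sub]
    · simp only [mul_sub]
    · refine integrable_kernel_mul hA s
        (h := fun ζ => ∏ v, vertexFactor (d v) (c v * cexp (I * r * ζ v)))
        (B := ∏ v, (36 * (r ^ n v)⁻¹)) (a := 0)
        (continuous_finsetProd _ fun v _ => continuous_vertexFactor_contour s (d v) (hc v) hr v)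
        fun ξ => ?_
      rw [zero_mul, Real.exp_zero, mul_one, norm_prod]
      exact Finset.prod_le_prod (fun _ _ => norm_nonneg _) fun v _ =>
        norm_vertexFactor_le (d v) (hc v) hr hr1 (ξ v) (s v)
    · simp only [hcut, Finset.mul_sum]
      refine integrable_finsetSum _ fun m _ => ?_
      refine ((integrable_moment hA s m).const_mul (co m * (r : ℂ) ^ (∑ v, m v))).congr
        (Filter.Eventually.of_forall fun ξ => ?_)
      simp only; ring
  -- No exponent of total degree N ≤ M is lost by the box, because m ≥ -n forces m_v ≤ N + L < J.
  have hsplit : ∑ m ∈ box, co m * moment A s m * (r : ℂ) ^ (∑ v, m v) -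
      ∑ N ∈ Finset.Icc (-(L : ℤ)) M, (∑ m ∈ degreeSet n N, co m * moment A s m) * (r : ℂ) ^ N =
      ∑ m ∈ box.filter (fun m => ¬ ∑ v, m v ≤ (M : ℤ)), co m * moment A s m * (r : ℂ) ^ (∑ v, m v) := by
    rw [← Finset.sum_filter_add_sum_filter_not box (fun m => ∑ v, m v ≤ (M : ℤ)), add_sub_right_comm,
      add_eq_right, sub_eq_zero]
    rw [← Finset.sum_fiberwise_of_maps_to (t := Finset.Icc (-(L : ℤ)) M) (g := fun m => ∑ v, m v)]
    · refine Finset.sum_congr rfl fun N hN => ?_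
      rw [Finset.sum_mul]
      refine Finset.sum_congr ?_ fun m hm => ?_
      · ext m
        simp only [Finset.mem_filter, hbox, Fintype.mem_piFinset, Finset.mem_Ico, mem_degreeSet]
        rw [Finset.mem_Icc] at hN
        constructor
        · rintro ⟨⟨h1, -⟩, h2⟩
          exact ⟨fun v => (h1 v).1, h2⟩
        · rintro ⟨h1, h2⟩
          refine ⟨⟨fun v => ⟨h1 v, ?_⟩, by omega⟩, h2⟩
          have h3 : m ∈ degreeSet n N := mem_degreeSet.2 ⟨h1, h2⟩
          simp only [degreeSet, Finset.mem_filter, Fintype.mem_piFinset, Finset.mem_Icc] at h3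
          have h4 := (h3.1 v).2
          have h5 : (∑ u, (n u : ℤ)) = L := by rw [hL]; push_cast; rfl
          omega
      · rw [(mem_degreeSet.1 hm).2]
    · intro m hm
      simp only [Finset.mem_filter, hbox, Fintype.mem_piFinset, Finset.mem_Ico] at hm
      rw [Finset.mem_Icc]
      refine ⟨?_, hm.2⟩
      rw [hL]; push_cast
      rw [← Finset.sum_neg_distrib]
      exact Finset.sum_le_sum fun v _ => (hm.1 v).1
  have h1 := hD (fun ζ => (∏ v, vertexFactor (d v) (c v * cexp (I * r * ζ v))) -
    ∏ v, laurentCut (d v) (c v) J (I * r * ζ v)) _ herr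
  rw [← hsub] at h1
  calc _ = ‖(contourIntegral A s (fun ζ => ∏ v, vertexFactor (d v) (c v * cexp (I * r * ζ v))) -
      contourIntegral A s (fun ζ => ∏ v, laurentCut (d v) (c v) J (I * r * ζ v))) +
      ∑ m ∈ box.filter (fun m => ¬ ∑ v, m v ≤ (M : ℤ)), co m * moment A s m * (r : ℂ) ^ (∑ v, m v)‖ := by
        rw [← hsplit, hmain]; congr 1; ring
    _ ≤ D * (Fintype.card V * K' * (36 + K') ^ Fintype.card V * r ^ (M + 1)) +
        ∑ m ∈ box, ‖co m * moment A s m‖ * r ^ (M + 1) := by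
        refine (norm_add_le _ _).trans (add_le_add h1 ((norm_sum_le _ _).trans ?_))
        refine (Finset.sum_le_sum (g := fun m => ‖co m * moment A s m‖ * r ^ (M + 1))
          fun m hm => ?_).trans
          (Finset.sum_le_sum_of_subset_of_nonneg (Finset.filter_subset _ _) fun _ _ _ => by positivity)
        rw [norm_mul]
        refine mul_le_mul_of_nonneg_left ?_ (norm_nonneg _)
        rw [norm_zpow, Complex.norm_real, Real.norm_of_nonneg hr.le, ← zpow_natCast]
        refine zpow_le_zpow_right_of_le_one₀ hr hr1.le ?_
        have := (Finset.mem_filter.1 hm).2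
        push_cast; omega
    _ = _ := by rw [← Finset.sum_mul]; ring

end Moments


/-! ### Moments in the upper half-plane as mixed derivatives of the Gaussian -/

section MixedDerivative
variable {V : Type*} [Fintype V] [DecidableEq V] {A : Matrix V V ℝ}

/-- The function `x ↦ ∫ ∏ (i ζ_v)^(m_v) 𝑒^(i x·ζ)` against the Gaussian kernel on the contour
in the upper half-plane. -/
def shiftedMoment (A : Matrix V V ℝ) (m : V → ℤ) (x : V → ℝ) : ℂ :=
  contourIntegral A 1 fun ζ => (∏ v, (I * ζ v) ^ m v) * cexp (I * ∑ v, (x v : ℂ) * ζ v)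

theorem norm_cexp_linear_contour (x ξ : V → ℝ) :
    ‖cexp (I * ∑ v, (x v : ℂ) * contour 1 ξ v)‖ = Real.exp (-∑ v, x v) := by
  rw [Complex.norm_exp]
  congr 1
  simp [contour]

theorem integrable_shiftedMoment (hA : A.PosDef) (m : V → ℤ) (x : V → ℝ) :
    Integrable fun ξ : V → ℝ => cexp (-cform A (contour 1 ξ) (contour 1 ξ)) *
      ((∏ v, (I * contour 1 ξ v) ^ m v) * cexp (I * ∑ v, (x v : ℂ) * contour 1 ξ v)) := by
  obtain ⟨B, hB0, hB⟩ := exists_norm_prod_zpow_le (1 : V → ℤˣ) m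
  refine integrable_kernel_mul hA 1
    (h := fun ζ => (∏ v, (I * ζ v) ^ m v) * cexp (I * ∑ v, (x v : ℂ) * ζ v)) (a := 1)
    (B := B * Real.exp (-∑ v, x v)) ((continuous_prod_zpow 1 m).mul ?_) fun ξ => ?_
  · unfold contour; fun_prop
  · rw [norm_mul, norm_cexp_linear_contour, one_mul, mul_right_comm]
    exact mul_le_mul_of_nonneg_right (hB ξ) (Real.exp_pos _).le

theorem exists_norm_shiftedMoment_le (hA : A.PosDef) (m : V → ℤ) :
    ∃ C, 0 ≤ C ∧ ∀ x, ‖shiftedMoment A m x‖ ≤ C * Real.exp (-∑ v, x v) := by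
  obtain ⟨B, hB0, hB⟩ := exists_norm_prod_zpow_le (1 : V → ℤˣ) m
  obtain ⟨D, hD0, hD⟩ := exists_norm_contourIntegral_le hA 1
  refine ⟨D * B, by positivity, fun x => ?_⟩
  rw [mul_assoc]
  refine hD _ _ fun ξ => ?_
  rw [norm_mul, norm_cexp_linear_contour, mul_right_comm]
  exact mul_le_mul_of_nonneg_right (hB ξ) (Real.exp_pos _).le

theorem sum_update_mul (x : V → ℝ) (v : V) (s : ℝ) (ζ : V → ℂ) :
    ∑ u, ((Function.update x v s u : ℝ) : ℂ) * ζ u =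
      (s : ℂ) * ζ v + ∑ u ∈ Finset.univ.erase v, (x u : ℂ) * ζ u := by
  rw [← Finset.add_sum_erase _ _ (Finset.mem_univ v), Function.update_self]
  congr 1
  refine Finset.sum_congr rfl fun u hu => ?_
  rw [Function.update_of_ne (Finset.ne_of_mem_erase hu)]

theorem prod_zpow_add_single {ζ : V → ℂ} (hζ : ∀ v, ζ v ≠ 0) (m : V → ℤ) (v : V) (j : ℤ) :
    ∏ u, (I * ζ u) ^ (m + Pi.single v j : V → ℤ) u = (∏ u, (I * ζ u) ^ m u) * (I * ζ v) ^ j := by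
  have h0 : ∀ u, I * ζ u ≠ 0 := fun u => mul_ne_zero I_ne_zero (hζ u)
  simp only [Pi.add_apply, zpow_add₀ (h0 _), Finset.prod_mul_distrib]
  congr 1
  rw [Finset.prod_eq_single v]
  · simp
  · intro u _ hu; simp [hu]
  · simp

/-- Differentiation under the integral brings down iζ_v. Negative exponents are allowed because iζ_v
has no zero on the contour. -/
theorem hasDerivAt_shiftedMoment (hA : A.PosDef) (m : V → ℤ) (x : V → ℝ) (v : V) (s₀ : ℝ) :
    HasDerivAt (fun s : ℝ => shiftedMoment A m (Function.update x v s))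
      (shiftedMoment A (m + Pi.single v 1) (Function.update x v s₀)) s₀ := by
  have hne : ∀ (ξ : V → ℝ) u, contour 1 ξ u ≠ 0 := fun ξ u => contour_coord_ne_zero _ _
  set S := ∑ u ∈ Finset.univ.erase v, x u with hS
  have hsum : ∀ s, ∑ u, Function.update x v s u = s + S := fun s => by
    rw [← Finset.add_sum_erase _ _ (Finset.mem_univ v), Function.update_self]
    congr 1
    refine Finset.sum_congr rfl fun u hu => ?_
    rw [Function.update_of_ne (Finset.ne_of_mem_erase hu)]
  let F : (V → ℤ) → ℝ → (V → ℝ) → ℂ := fun m s ξ => cexp (-cform A (contour 1 ξ) (contour 1 ξ)) *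
      ((∏ u, (I * contour 1 ξ u) ^ m u) *
        cexp (I * ∑ u, (Function.update x v s u : ℂ) * contour 1 ξ u))
  have hF : ∀ m s, Integrable (F m s) := fun m s => integrable_shiftedMoment hA m _
  let B : (V → ℝ) → ℝ := fun ξ => ‖cexp (-cform A (contour 1 ξ) (contour 1 ξ)) *
      ∏ u, (I * contour 1 ξ u) ^ (m + Pi.single v 1 : V → ℤ) u‖ * Real.exp (-(s₀ - 1 + S))
  have hB : Integrable B := (integrable_moment hA 1 _).norm.mul_const _
  have h1 : ∀ ξ, ∀ s ∈ Metric.ball s₀ 1, ‖F (m + Pi.single v 1) s ξ‖ ≤ B ξ := fun ξ s hs => by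
    simp only [F, B]
    rw [← mul_assoc, norm_mul, norm_cexp_linear_contour, hsum]
    refine mul_le_mul_of_nonneg_left (Real.exp_le_exp.2 ?_) (norm_nonneg _)
    rw [Metric.mem_ball, Real.dist_eq, abs_lt] at hs
    linarith [hs.1]
  have h2 : ∀ ξ, ∀ s ∈ Metric.ball s₀ 1, HasDerivAt (fun s => F m s ξ) (F (m + Pi.single v 1) s ξ) s :=
    fun ξ s hs => by
    simp only [F, sum_update_mul]
    rw [prod_zpow_add_single (hne ξ), zpow_one]
    have h1 : HasDerivAt (fun s : ℝ => I * ((s : ℂ) * contour 1 ξ v +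
        ∑ u ∈ Finset.univ.erase v, (x u : ℂ) * contour 1 ξ u)) (I * contour 1 ξ v) s := by
      have := (((hasDerivAt_id s).ofReal_comp.mul_const (contour 1 ξ v)).add_const
        (∑ u ∈ Finset.univ.erase v, (x u : ℂ) * contour 1 ξ u)).const_mul I
      simpa using this
    refine ((h1.cexp.const_mul (∏ u, (I * contour 1 ξ u) ^ m u)).const_mul
      (cexp (-cform A (contour 1 ξ) (contour 1 ξ)))).congr_deriv ?_
    ring
  have h3 := hasDerivAt_integral_of_dominated_loc_of_deriv_le (μ := volume) (𝕜 := ℝ) (F := F m)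
    (F' := F (m + Pi.single v 1)) (bound := B)
    (x₀ := s₀) (s := Metric.ball s₀ 1) (Metric.ball_mem_nhds _ one_pos)
    (Filter.Eventually.of_forall fun s => (hF m s).aestronglyMeasurable)
    (hF m s₀) (hF _ _).aestronglyMeasurable (Filter.Eventually.of_forall h1) hB
    (Filter.Eventually.of_forall h2)
  exact h3.2

theorem partialDeriv_shiftedMoment (hA : A.PosDef) (v : V) (m : V → ℤ) :
    partialDeriv v (shiftedMoment A m) = shiftedMoment A (m + Pi.single v 1) := by
  ext x
  rw [partialDeriv, (hasDerivAt_shiftedMoment hA m x v (x v)).deriv, Function.update_eq_self]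

/-- Lowering the exponent at v gives a primitive by `hasDerivAt_shiftedMoment`, and it tends to 0 at
+∞ because |e^(ix·ζ)| = e^(-∑ x_v) when Im ζ_v = 1. This is the reason for singling out the sign
vector s = 1. -/
theorem partialAntideriv_shiftedMoment (hA : A.PosDef) (v : V) (m : V → ℤ) :
    partialAntideriv v (shiftedMoment A m) = shiftedMoment A (m - Pi.single v 1) := by
  ext x
  have hd : ∀ s, HasDerivAt (fun s : ℝ => shiftedMoment A (m - Pi.single v 1) (Function.update x v s))
      (shiftedMoment A m (Function.update x v s)) s := fun s => by
    have := hasDerivAt_shiftedMoment hA (m - Pi.single v 1) x v s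
    rwa [sub_add_cancel] at this
  have hd' : ∀ s, HasDerivAt (fun s : ℝ => shiftedMoment A m (Function.update x v s))
      (shiftedMoment A (m + Pi.single v 1) (Function.update x v s)) s :=
    fun s => hasDerivAt_shiftedMoment hA m x v s
  set S := ∑ u ∈ Finset.univ.erase v, x u with hS
  have hsum : ∀ s, ∑ u, Function.update x v s u = s + S := fun s => by
    rw [← Finset.add_sum_erase _ _ (Finset.mem_univ v), Function.update_self]
    congr 1
    refine Finset.sum_congr rfl fun u hu => ?_
    rw [Function.update_of_ne (Finset.ne_of_mem_erase hu)]
  obtain ⟨C, hC, hb⟩ := exists_norm_shiftedMoment_le hA m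
  obtain ⟨C', hC', hb'⟩ := exists_norm_shiftedMoment_le hA (m - Pi.single v 1)
  have hint : IntegrableOn (fun s => shiftedMoment A m (Function.update x v s)) (Set.Ioi (x v)) := by
    refine Integrable.mono' ((exp_neg_integrableOn_Ioi (x v) one_pos).const_mul (C * Real.exp (-S)))
      ?_ (Filter.Eventually.of_forall fun s => ?_)
    · exact (continuous_iff_continuousAt.2 fun s => (hd' s).continuousAt).aestronglyMeasurable
    · refine (hb _).trans (le_of_eq ?_)
      rw [hsum, mul_assoc, ← Real.exp_add]
      congr 2; ring
  have hlim : Filter.Tendsto (fun s : ℝ => shiftedMoment A (m - Pi.single v 1) (Function.update x v s))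
      Filter.atTop (𝓝 0) := by
    refine squeeze_zero_norm (a := fun s => C' * Real.exp (-(s + S))) (fun s => ?_) ?_
    · rw [← hsum]; exact hb' _
    · rw [← mul_zero C']
      refine Filter.Tendsto.const_mul C' (Real.tendsto_exp_neg_atTop_nhds_zero.comp ?_)
      exact Filter.tendsto_atTop_add_const_right _ _ Filter.tendsto_id
  rw [partialAntideriv, integral_Ioi_of_hasDerivAt_of_tendsto (hd _).continuousAt.continuousWithinAt
    (fun s _ => hd s) hint hlim, Function.update_eq_self]
  simp

theorem iterate_partialDeriv_shiftedMoment (hA : A.PosDef) (v : V) (n : ℕ) (m : V → ℤ) :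
    (partialDeriv v)^[n] (shiftedMoment A m) = shiftedMoment A (m + Pi.single v (n : ℤ)) := by
  induction n generalizing m with
  | zero => simp
  | succ n ih =>
    rw [Function.iterate_succ_apply, partialDeriv_shiftedMoment hA, ih, add_assoc, ← Pi.single_add]
    push_cast; rw [add_comm (1 : ℤ)]

theorem iterate_partialAntideriv_shiftedMoment (hA : A.PosDef) (v : V) (n : ℕ) (m : V → ℤ) :
    (partialAntideriv v)^[n] (shiftedMoment A m) = shiftedMoment A (m - Pi.single v (n : ℤ)) := by
  induction n generalizing m with
  | zero => simp
  | succ n ih =>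
    rw [Function.iterate_succ_apply, partialAntideriv_shiftedMoment hA, ih, sub_sub, ← Pi.single_add]
    push_cast; rw [add_comm (1 : ℤ)]

theorem foldr_partialDeriv_shiftedMoment (hA : A.PosDef) (a : V → ℕ) (m : V → ℤ) (l : List V) :
    l.foldr (fun v g => (partialDeriv v)^[a v] g) (shiftedMoment A m) =
      shiftedMoment A (m + (l.map fun v => Pi.single v (a v : ℤ)).sum) := by
  induction l with
  | nil => simp
  | cons v l ih =>
    rw [List.foldr_cons, ih, iterate_partialDeriv_shiftedMoment hA, List.map_cons, List.sum_cons]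
    congr 1; abel

theorem foldr_partialAntideriv_shiftedMoment (hA : A.PosDef) (a : V → ℕ) (m : V → ℤ) (l : List V) :
    l.foldr (fun v g => (partialAntideriv v)^[a v] g) (shiftedMoment A m) =
      shiftedMoment A (m - (l.map fun v => Pi.single v (a v : ℤ)).sum) := by
  induction l with
  | nil => simp
  | cons v l ih =>
    rw [List.foldr_cons, ih, iterate_partialAntideriv_shiftedMoment hA, List.map_cons, List.sum_cons]
    congr 1; abel

theorem sum_toList_single (a : V → ℤ) :
    ((Finset.univ : Finset V).toList.map fun v => (Pi.single v (a v) : V → ℤ)).sum = a := by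
  rw [Finset.sum_map_toList, Finset.univ_sum_single]

theorem mixedDeriv_shiftedMoment (hA : A.PosDef) (m : V → ℤ) :
    mixedDeriv m (shiftedMoment A 0) = shiftedMoment A m := by
  rw [mixedDeriv, foldr_partialDeriv_shiftedMoment hA (fun v => (m v).toNat),
    foldr_partialAntideriv_shiftedMoment hA (fun v => (-m v).toNat),
    sum_toList_single fun v => ((m v).toNat : ℤ), sum_toList_single fun v => ((-m v).toNat : ℤ)]
  congr 1
  ext v
  simp only [Pi.sub_apply, Pi.add_apply, Pi.zero_apply]
  omega

theorem partialDeriv_const_mul (v : V) (c : ℂ) (f : (V → ℝ) → ℂ) :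
    partialDeriv v (fun x => c * f x) = fun x => c * partialDeriv v f x := by
  ext x
  simp only [partialDeriv]
  exact deriv_const_mul_field c

theorem partialAntideriv_const_mul (v : V) (c : ℂ) (f : (V → ℝ) → ℂ) :
    partialAntideriv v (fun x => c * f x) = fun x => c * partialAntideriv v f x := by
  ext x
  simp only [partialAntideriv]
  rw [integral_const_mul, mul_neg]

theorem iterate_const_mul {T : ((V → ℝ) → ℂ) → (V → ℝ) → ℂ} {c : ℂ}
    (hT : ∀ f, T (fun x => c * f x) = fun x => c * T f x) (n : ℕ) (f : (V → ℝ) → ℂ) :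
    T^[n] (fun x => c * f x) = fun x => c * T^[n] f x := by
  induction n generalizing f with
  | zero => rfl
  | succ n ih => rw [Function.iterate_succ_apply, hT, ih, Function.iterate_succ_apply]

theorem foldr_const_mul {T : V → ((V → ℝ) → ℂ) → (V → ℝ) → ℂ} {c : ℂ}
    (hT : ∀ v f, T v (fun x => c * f x) = fun x => c * T v f x) (f : (V → ℝ) → ℂ) (l : List V) :
    l.foldr (fun v g => T v g) (fun x => c * f x) = fun x => c * l.foldr (fun v g => T v g) f x := by
  induction l with
  | nil => rfl
  | cons v l ih => rw [List.foldr_cons, ih, hT, List.foldr_cons]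

theorem mixedDeriv_const_mul (m : V → ℤ) (c : ℂ) (f : (V → ℝ) → ℂ) :
    mixedDeriv m (fun x => c * f x) = fun x => c * mixedDeriv m f x := by
  rw [mixedDeriv, foldr_const_mul (T := fun v => (partialDeriv v)^[(m v).toNat])
      (fun v f => iterate_const_mul (partialDeriv_const_mul v c) _ f),
    foldr_const_mul (T := fun v => (partialAntideriv v)^[(-m v).toNat])
      (fun v f => iterate_const_mul (partialAntideriv_const_mul v c) _ f)]
  rfl

/-- By Fourier inversion the Gaussian is a multiple of the shifted moment of exponent 0, and each
derivative or antiderivative moves one exponent by ±1. -/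
theorem mixedDeriv_gaussian {W : Matrix V V ℤ} (hW : (-(realMatrix W)).PosDef) (m : V → ℤ) :
    mixedDeriv m (fun x => ((Real.exp (-Q W x / 4) : ℝ) : ℂ)) 0 =
      (gaussConst (-(realMatrix W)))⁻¹ * moment (-(realMatrix W)) 1 m := by
  have h1 : (fun x => ((Real.exp (-Q W x / 4) : ℝ) : ℂ)) =
      fun x => (gaussConst (-(realMatrix W)))⁻¹ * shiftedMoment (-(realMatrix W)) 0 x := by
    ext x
    have := integral_contour_Q hW 1 x
    rw [shiftedMoment]
    simp only [Pi.zero_apply, zpow_zero, Finset.prod_const_one, one_mul, this]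
    rw [← mul_assoc, inv_mul_cancel₀ (gaussConst_ne_zero hW), one_mul]
  rw [h1, mixedDeriv_const_mul, mixedDeriv_shiftedMoment hW]
  simp [shiftedMoment, moment]

end MixedDerivative

/-! ### Coefficients of φ and of the Hadamard product -/

section Coefficients
variable {V : Type*} [Fintype V] [DecidableEq V]

theorem coeff_inVariable_single (v : V) (φ : LaurentSeries ℂ) (j : ℤ) :
    (inVariable v φ).coeff (Pi.single v j) = φ.coeff j :=
  HahnSeries.embDomain_coeff

theorem exists_of_coeff_inVariable_ne_zero {v : V} {φ : LaurentSeries ℂ} {m : V → ℤ}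
    (h : (inVariable v φ).coeff m ≠ 0) : ∃ j, m = Pi.single v j := by
  by_contra hne
  refine h (HahnSeries.embDomain_of_notMem_range ?_)
  rintro ⟨j, hj⟩
  exact hne ⟨j, hj.symm⟩

/-- The factors involve different variables, so one term of each convolution survives. Partial
products are treated for the sake of the induction. -/
theorem coeff_prod_inVariable (φ : V → LaurentSeries ℂ) (S : Finset V) (m : V → ℤ) :
    (∏ v ∈ S, inVariable v (φ v)).coeff m =
      if ∀ v, v ∉ S → m v = 0 then ∏ v ∈ S, (φ v).coeff (m v) else 0 := by
  classical
  induction S using Finset.induction_on generalizing m with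
  | empty =>
    simp only [Finset.prod_empty, HahnSeries.coeff_one]
    congr 1
    simp [funext_iff]
  | insert a S ha ih =>
    rw [Finset.prod_insert ha, HahnSeries.coeff_mul]
    rw [Finset.sum_eq_single (Pi.single a (m a), m - Pi.single a (m a))]
    · rw [coeff_inVariable_single, ih, Finset.prod_insert ha]
      have hP : ∏ v ∈ S, (φ v).coeff ((m - Pi.single a (m a) : V → ℤ) v) = ∏ v ∈ S, (φ v).coeff (m v) :=
        Finset.prod_congr rfl fun v hv => by
          have : v ≠ a := fun h => ha (h ▸ hv)
          simp [this]
      have hiff : (∀ v, v ∉ S → (m - Pi.single a (m a) : V → ℤ) v = 0) ↔ ∀ v, v ∉ insert a S → m v = 0 := by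
        constructor
        · intro h v hv
          rw [Finset.mem_insert, not_or] at hv
          simpa [hv.1] using h v hv.2
        · intro h v hv
          by_cases hva : v = a
          · subst hva; simp
          · simpa [hva] using h v (by simp [hva, hv])
      simp only [hP, hiff]
      split_ifs <;> simp
    · rintro ⟨i, j⟩ hij hne
      rw [Finset.mem_antidiagonal] at hij
      obtain ⟨-, hj, hsum⟩ := hij
      by_contra hprod
      obtain ⟨b, hb⟩ := exists_of_coeff_inVariable_ne_zero (left_ne_zero_of_mul hprod)
      simp only at hb hj hsum
      have h1 : j a = 0 := by
        have h2 := right_ne_zero_of_mul hprod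
        simp only [ih] at h2
        exact (ite_ne_right_iff.1 h2).1 a ha
      refine hne ?_
      subst hb
      have h3 : b = m a := by rw [← hsum]; simp [h1]
      rw [← h3, ← hsum]
      simp
    · intro hnot
      rw [Finset.mem_antidiagonal] at hnot
      by_contra hprod
      exact hnot ⟨left_ne_zero_of_mul hprod, right_ne_zero_of_mul hprod, by simp⟩

variable {G : SimpleGraph V} [DecidableRel G.Adj] {w : V → ℤ}

/-- The coefficients of the Laurent expansion of `φ_{Γ,k}`. -/
def phiCoeff (G : SimpleGraph V) [DecidableRel G.Adj] (w : V → ℤ) (k : ℕ) (m : V → ℤ) : ℂ :=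
  ∑ μ : V → Fin (2 * k), gaussPhase (linkingMatrix G w) k μ *
    ∏ v, laurentCoeff (G.degree v) (unityRoot k (μ v)) (m v)

theorem coeff_phi (k : ℕ) (m : V → ℤ) : (phi G w k).coeff m = phiCoeff G w k m := by
  rw [phi, HahnSeries.coeff_sum]
  refine Finset.sum_congr rfl fun μ _ => ?_
  rw [HahnSeries.C_mul_eq_smul, HahnSeries.coeff_smul, coeff_prod_inVariable]
  simp [gaussPhase, laurentCoeff, unityRoot]

theorem unityRoot_ne_zero (k m : ℕ) : unityRoot k m ≠ 0 := fun h => by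
  have := norm_unityRoot k m
  simp [h] at this

theorem phiCoeff_eq_zero {k : ℕ} {m : V → ℤ} {v : V} (h : m v < -((G.degree v - 2 : ℕ) : ℤ)) :
    phiCoeff G w k m = 0 :=
  Finset.sum_eq_zero fun μ _ => by
    rw [Finset.prod_eq_zero (Finset.mem_univ v) (laurentCoeff_eq_zero (unityRoot_ne_zero _ _) h), mul_zero]

/-- The pole orders bound the exponents of φ from below by 2 - deg v or 0, so `degreeSet` contains
the support of the defining sum. -/
theorem hadamardCoeff_phi (hW : (-(realMatrix (linkingMatrix G w))).PosDef) (k : ℕ) (N : ℤ) :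
    hadamardCoeff (phi G w k) (fun x => ((Real.exp (-Q (linkingMatrix G w) x / 4) : ℝ) : ℂ)) N =
      (gaussConst (-(realMatrix (linkingMatrix G w))))⁻¹ *
        ∑ m ∈ degreeSet (fun v => G.degree v - 2) N,
          phiCoeff G w k m * moment (-(realMatrix (linkingMatrix G w))) 1 m := by
  rw [hadamardCoeff, Finset.mul_sum]
  simp only [coeff_phi, mixedDeriv_gaussian hW]
  rw [← finsum_mem_finset_eq_sum]
  have : ∀ m : V → ℤ, (∑ᶠ (_ : ∑ v, m v = N), phiCoeff G w k m *
      ((gaussConst (-(realMatrix (linkingMatrix G w))))⁻¹ *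
        moment (-(realMatrix (linkingMatrix G w))) 1 m)) =
      ∑ᶠ (_ : m ∈ degreeSet (fun v => G.degree v - 2) N),
        (gaussConst (-(realMatrix (linkingMatrix G w))))⁻¹ * (phiCoeff G w k m *
        moment (-(realMatrix (linkingMatrix G w))) 1 m) := fun m => by
    rw [finsum_eq_if, finsum_eq_if, mul_left_comm]
    simp only [mem_degreeSet]
    by_cases h : ∀ v, -((G.degree v - 2 : ℕ) : ℤ) ≤ m v
    · simp only [h, implies_true, true_and]
    · push Not at h
      obtain ⟨v, hv⟩ := h
      rw [phiCoeff_eq_zero hv]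
      simp
  simp only [this]

end Coefficients


/-! ### The jump of a one-variable contour integral across the origin -/

section Line

/-- The one-dimensional contour integral of `(i z)^m` against `𝑒^(-a z² + 2 b z)`. -/
def lineIntegral (a : ℝ) (σ : ℤˣ) (m : ℤ) (b : ℂ) : ℂ :=
  ∫ x : ℝ, cexp (-a * ((x : ℂ) + ((σ : ℤ) : ℂ) * I) ^ 2 + 2 * b * ((x : ℂ) + ((σ : ℤ) : ℂ) * I)) *
    (I * ((x : ℂ) + ((σ : ℤ) : ℂ) * I)) ^ m

theorem norm_cexp_quadratic_le (a : ℝ) (σ : ℤˣ) {b : ℂ} {R : ℝ} (hb : ‖b‖ ≤ R) (x : ℝ) :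
    ‖cexp (-a * ((x : ℂ) + ((σ : ℤ) : ℂ) * I) ^ 2 + 2 * b * ((x : ℂ) + ((σ : ℤ) : ℂ) * I))‖ ≤
      Real.exp (a + 2 * R) * Real.exp (-a * x ^ 2 + 2 * R * |x|) := by
  rw [Complex.norm_exp, ← Real.exp_add]
  refine Real.exp_le_exp.2 ?_
  have hsq : ((σ : ℤ) : ℂ) ^ 2 = 1 := by
    rcases Int.units_eq_one_or σ with h | h <;> simp [h]
  have h1 : (-(a : ℂ) * ((x : ℂ) + ((σ : ℤ) : ℂ) * I) ^ 2).re = -a * x ^ 2 + a := by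
    have : -(a : ℂ) * ((x : ℂ) + ((σ : ℤ) : ℂ) * I) ^ 2 =
        ((-a * x ^ 2 + a : ℝ) : ℂ) + ((-2 * a * x * ((σ : ℤ) : ℝ) : ℝ) : ℂ) * I := by
      push_cast
      linear_combination (-(a : ℂ)) * ((σ : ℤ) : ℂ) ^ 2 * I_sq + (a : ℂ) * hsq
    rw [this, Complex.add_re, Complex.ofReal_re, Complex.re_ofReal_mul]
    simp
  have h2 : (2 * b * ((x : ℂ) + ((σ : ℤ) : ℂ) * I)).re ≤ 2 * R * (1 + |x|) := by
    refine (Complex.re_le_norm _).trans ?_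
    rw [norm_mul, norm_mul, Complex.norm_ofNat]
    have := (norm_contour_coord x σ).2
    have hR : 0 ≤ R := (norm_nonneg _).trans hb
    gcongr
  rw [Complex.add_re, h1]
  linarith

theorem integrable_exp_neg_sq_add_abs {a : ℝ} (ha : 0 < a) (c : ℝ) :
    Integrable fun x : ℝ => Real.exp (-a * x ^ 2 + c * |x|) := by
  have h := ((integrable_exp_neg_mul_sq (half_pos ha)).const_mul (Real.exp (c ^ 2 / (2 * a))))
  refine h.mono' (Continuous.aestronglyMeasurable (by fun_prop))
    (Filter.Eventually.of_forall fun x => ?_)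
  rw [Real.norm_of_nonneg (Real.exp_pos _).le, ← Real.exp_add]
  refine Real.exp_le_exp.2 ?_
  have h1 : c ^ 2 / (2 * a) + -(a / 2) * x ^ 2 - (-a * x ^ 2 + c * |x|) =
      (c - a * |x|) ^ 2 / (2 * a) := by
    rw [← sq_abs x]; field_simp; ring
  have : 0 ≤ (c - a * |x|) ^ 2 / (2 * a) := by positivity
  linarith

theorem norm_lineIntegrand_le (a : ℝ) (σ : ℤˣ) (m : ℤ) {b : ℂ} {R : ℝ} (hb : ‖b‖ ≤ R)
    (x : ℝ) :
    ‖cexp (-a * ((x : ℂ) + ((σ : ℤ) : ℂ) * I) ^ 2 + 2 * b * ((x : ℂ) + ((σ : ℤ) : ℂ) * I)) *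
      (I * ((x : ℂ) + ((σ : ℤ) : ℂ) * I)) ^ m‖ ≤
      Real.exp (a + 2 * R) * (m.toNat.factorial * Real.exp 1) *
        Real.exp (-a * x ^ 2 + (2 * R + 1) * |x|) := by
  rw [norm_mul]
  refine (mul_le_mul (norm_cexp_quadratic_le a σ hb x)
    (norm_zpow_contour_coord_le x σ (Int.self_le_toNat m)) (norm_nonneg _) (by positivity)).trans
    (le_of_eq ?_)
  rw [show -a * x ^ 2 + (2 * R + 1) * |x| = (-a * x ^ 2 + 2 * R * |x|) + |x| by ring,
    Real.exp_add (-a * x ^ 2 + 2 * R * |x|)]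
  ring

theorem integrable_lineIntegrand {a : ℝ} (ha : 0 < a) (σ : ℤˣ) (m : ℤ) (b : ℂ) :
    Integrable fun x : ℝ =>
      cexp (-a * ((x : ℂ) + ((σ : ℤ) : ℂ) * I) ^ 2 + 2 * b * ((x : ℂ) + ((σ : ℤ) : ℂ) * I)) *
      (I * ((x : ℂ) + ((σ : ℤ) : ℂ) * I)) ^ m := by
  refine ((integrable_exp_neg_sq_add_abs ha (2 * ‖b‖ + 1)).const_mul _).mono' ?_
    (Filter.Eventually.of_forall fun x => norm_lineIntegrand_le a σ m le_rfl x)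
  refine (Continuous.mul (by fun_prop) (Continuous.zpow₀ (by fun_prop) _ fun x =>
    Or.inl (mul_ne_zero I_ne_zero (contour_coord_ne_zero _ _)))).aestronglyMeasurable

/-- Differentiating in b brings down 2z = (2/i)(iz), which raises the exponent by one. This relation
replaces a residue computation. -/
theorem hasDerivAt_lineIntegral {a : ℝ} (ha : 0 < a) (σ : ℤˣ) (m : ℤ) (b : ℂ) :
    HasDerivAt (lineIntegral a σ m) (2 / I * lineIntegral a σ (m + 1) b) b := by
  let z : ℝ → ℂ := fun x => (x : ℂ) + ((σ : ℤ) : ℂ) * I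
  let F : ℤ → ℂ → ℝ → ℂ := fun m b x => cexp (-a * z x ^ 2 + 2 * b * z x) * (I * z x) ^ m
  have hF : ∀ m b, Integrable (F m b) := fun m b => integrable_lineIntegrand ha σ m b
  have h1 : ∀ x, ∀ b' ∈ Metric.ball b 1, ‖2 / I * F (m + 1) b' x‖ ≤
      ‖(2 / I : ℂ)‖ * (Real.exp (a + 2 * (‖b‖ + 1)) * ((m + 1).toNat.factorial * Real.exp 1) *
        Real.exp (-a * x ^ 2 + (2 * (‖b‖ + 1) + 1) * |x|)) := fun x b' hb' => by
    rw [norm_mul]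
    refine mul_le_mul_of_nonneg_left (norm_lineIntegrand_le a σ _ ?_ x) (norm_nonneg _)
    rw [Metric.mem_ball, dist_eq_norm] at hb'
    have := norm_sub_norm_le b' b
    linarith
  have h2 : ∀ x, ∀ b' ∈ Metric.ball b 1, HasDerivAt (fun b => F m b x) (2 / I * F (m + 1) b' x) b' :=
    fun x b' _ => by
    have hz : I * z x ≠ 0 := mul_ne_zero I_ne_zero (contour_coord_ne_zero _ _)
    have h3 : HasDerivAt (fun b : ℂ => -a * z x ^ 2 + 2 * b * z x) (2 * z x) b' := by
      have := (((hasDerivAt_id b').const_mul 2).mul_const (z x)).const_add (-a * z x ^ 2)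
      simpa using this
    refine (h3.cexp.mul_const ((I * z x) ^ m)).congr_deriv ?_
    simp only [F]
    rw [zpow_add_one₀ hz]
    field_simp
  have h3 := hasDerivAt_integral_of_dominated_loc_of_deriv_le (μ := volume) (𝕜 := ℂ) (F := F m)
    (F' := fun b x => 2 / I * F (m + 1) b x)
    (x₀ := b) (s := Metric.ball b 1) (Metric.ball_mem_nhds _ one_pos)
    (Filter.Eventually.of_forall fun s => (hF m s).aestronglyMeasurable)
    (hF m b) ((hF _ _).const_mul _).aestronglyMeasurable (Filter.Eventually.of_forall h1)
    (((integrable_exp_neg_sq_add_abs ha _).const_mul _).const_mul _)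
    (Filter.Eventually.of_forall h2)
  refine h3.2.congr_deriv ?_
  rw [integral_const_mul]
  rfl

theorem lineIntegral_zero {a : ℝ} (ha : 0 < a) (σ : ℤˣ) (b : ℂ) :
    lineIntegral a σ 0 b = (Real.pi / a : ℂ) ^ (1 / 2 : ℂ) * cexp (b ^ 2 / a) := by
  have ha' : (a : ℂ) ≠ 0 := by exact_mod_cast ha.ne'
  have h := integral_cexp_quadratic (b := -(a : ℂ)) (by simpa using ha)
    (2 * b - 2 * a * ((σ : ℤ) : ℂ) * I)
    (-a * (((σ : ℤ) : ℂ) * I) ^ 2 + 2 * b * (((σ : ℤ) : ℂ) * I))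
  rw [lineIntegral]
  simp only [zpow_zero, mul_one]
  rw [neg_neg] at h
  convert h using 1
  · congr 1; ext x; congr 1; ring
  · congr 2; field_simp; ring

/-- The jump of the line integral across the origin. -/
def lineJump (a : ℝ) (m : ℤ) (b : ℂ) : ℂ := lineIntegral a 1 m b - lineIntegral a (-1) m b

theorem hasDerivAt_lineJump {a : ℝ} (ha : 0 < a) (m : ℤ) (b : ℂ) :
    HasDerivAt (lineJump a m) (2 / I * lineJump a (m + 1) b) b := by
  refine ((hasDerivAt_lineIntegral ha 1 m b).sub (hasDerivAt_lineIntegral ha (-1) m b)).congr_deriv ?_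
  rw [lineJump]; ring

/-- For m = 0 both lines give the same explicit Gaussian value; larger m follow by differentiating
in b. -/
theorem lineJump_nonneg {a : ℝ} (ha : 0 < a) (m : ℕ) (b : ℂ) : lineJump a m b = 0 := by
  induction m generalizing b with
  | zero => rw [lineJump, Nat.cast_zero, lineIntegral_zero ha, lineIntegral_zero ha, sub_self]
  | succ m ih =>
    have h1 := hasDerivAt_lineJump ha m b
    have h2 : lineJump a m = fun _ => 0 := funext ih
    rw [h2] at h1
    have h3 := h1.unique (hasDerivAt_const b 0)
    push_cast
    simpa using h3

/-- This is the residue at z = 0, obtained by integrating in b: the jump at exponent -(p+1) is a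
primitive of a multiple of the jump at -p, and the jump at 0 vanishes. -/
theorem exists_polynomial_lineJump {a : ℝ} (ha : 0 < a) (p : ℕ) :
    ∃ c : ℕ → ℂ, ∀ b, lineJump a (-(p : ℤ)) b = ∑ i ∈ Finset.range p, c i * b ^ i := by
  induction p with
  | zero => exact ⟨0, fun b => by simpa using lineJump_nonneg ha 0 b⟩
  | succ p ih =>
    obtain ⟨c, hc⟩ := ih
    let g : ℂ → ℂ := fun b => ∑ i ∈ Finset.range p, 2 / I * c i / (i + 1) * b ^ (i + 1)
    have hg : ∀ b, HasDerivAt g (2 / I * lineJump a (-(p : ℤ)) b) b := fun b => by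
      rw [hc, Finset.mul_sum]
      refine HasDerivAt.fun_sum fun i _ => ?_
      refine ((hasDerivAt_pow (i + 1) b).const_mul (2 / I * c i / (i + 1))).congr_deriv ?_
      have : (i : ℂ) + 1 ≠ 0 := by exact_mod_cast Nat.succ_ne_zero i
      push_cast
      field_simp
    have hd : ∀ b, HasDerivAt (fun b => lineJump a (-((p + 1 : ℕ) : ℤ)) b - g b) 0 b := fun b => by
      refine ((hasDerivAt_lineJump ha _ b).sub (hg b)).congr_deriv ?_
      rw [show -((p + 1 : ℕ) : ℤ) + 1 = -(p : ℤ) by push_cast; ring, sub_self]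
    have hconst : ∀ b, lineJump a (-((p + 1 : ℕ) : ℤ)) b - g b =
        lineJump a (-((p + 1 : ℕ) : ℤ)) 0 - g 0 := fun b =>
      is_const_of_deriv_eq_zero (fun b => (hd b).differentiableAt) (fun b => (hd b).deriv) b 0
    refine ⟨fun i => if i = 0 then lineJump a (-((p + 1 : ℕ) : ℤ)) 0 - g 0 else
      2 / I * c (i - 1) / i, fun b => ?_⟩
    rw [Finset.sum_range_succ', eq_add_of_sub_eq (hconst b)]
    simp [g, add_comm]

theorem exists_coeff_lineJump {a : ℝ} (ha : 0 < a) : ∃ c : ℤ → ℕ → ℂ, ∀ m b,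
    lineJump a m b = ∑ i ∈ Finset.range (-m).toNat, c m i * b ^ i := by
  choose c hc using exists_polynomial_lineJump ha
  refine ⟨fun m => c (-m).toNat, fun m b => ?_⟩
  rcases le_or_gt 0 m with h | h
  · obtain ⟨n, rfl⟩ := Int.eq_ofNat_of_zero_le h
    rw [lineJump_nonneg ha]
    simp
  · rw [← hc, show -((-m).toNat : ℤ) = m by omega]

end Line

/-! ### Fubini for one distinguished coordinate -/

section Split
variable {V : Type*} [Fintype V] [DecidableEq V]

/-- The vector with coordinate `x` at `v` and the remaining coordinates `η`. -/
def glue (v : V) (x : ℝ) (η : {u // ¬u = v} → ℝ) : V → ℝ :=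
  fun u => if h : u = v then x else η ⟨u, h⟩

/-- Separating the coordinate at `v`. -/
def splitEquiv (v : V) : (V → ℝ) ≃ᵐ ℝ × ({u // ¬u = v} → ℝ) :=
  (MeasurableEquiv.piEquivPiSubtypeProd (fun _ : V => ℝ) (fun u => u = v)).trans
    ((MeasurableEquiv.funUnique {u // u = v} ℝ).prodCongr (MeasurableEquiv.refl _))

theorem measurePreserving_splitEquiv (v : V) : MeasurePreserving (splitEquiv v) := by
  refine MeasurePreserving.trans (volume_preserving_piEquivPiSubtypeProd (fun _ : V => ℝ) _) ?_
  have h := (volume_preserving_funUnique {u // u = v} ℝ).prod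
    (MeasurePreserving.id (volume : Measure ({u // ¬u = v} → ℝ)))
  rw [← Measure.volume_eq_prod, ← Measure.volume_eq_prod] at h
  convert h using 1
  · rfl
  · congr!

theorem splitEquiv_symm (v : V) (x : ℝ) (η : {u // ¬u = v} → ℝ) :
    (splitEquiv v).symm (x, η) = glue v x η := by
  ext u
  by_cases h : u = v
  · subst h
    simp only [glue, dif_pos]
    exact dif_pos rfl
  · simp only [glue, dif_neg h]
    exact dif_neg h

theorem integral_split (v : V) {Φ : (V → ℝ) → ℂ} (hΦ : Integrable Φ) :
    ∫ ξ, Φ ξ = ∫ η, ∫ x, Φ (glue v x η) ∧ Integrable (fun η => ∫ x, Φ (glue v x η)) := by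
  have h1 : Integrable (Φ ∘ (splitEquiv v).symm) :=
    (measurePreserving_splitEquiv v).symm.integrable_comp_emb
      (splitEquiv v).symm.measurableEmbedding |>.2 hΦ
  have h2 := (measurePreserving_splitEquiv v).symm.integral_comp
      (splitEquiv v).symm.measurableEmbedding Φ
  rw [← h2]
  refine ⟨?_, ?_⟩
  · rw [Measure.volume_eq_prod]
    refine (integral_prod_symm _ h1).trans ?_
    simp only [Function.comp_def, splitEquiv_symm]
  · have := h1.integral_prod_right
    simpa only [Function.comp_def, splitEquiv_symm] using this

end Split


/-! ### Decoupling a vertex: the change of a moment when one sign is flipped -/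

section Decouple
variable {V : Type*} [Fintype V] [DecidableEq V] {A : Matrix V V ℝ}

/-- The matrix obtained from `A` by removing the off-diagonal entries in the rows and columns
of `S`. -/
def decouple (A : Matrix V V ℝ) (S : Finset V) : Matrix V V ℝ :=
  fun i j => if i = j ∨ (i ∉ S ∧ j ∉ S) then A i j else 0

theorem decouple_empty : decouple A ∅ = A := by
  ext i j; simp [decouple]

theorem decouple_decouple (S : Finset V) (v : V) :
    decouple (decouple A S) {v} = decouple A (insert v S) := by
  ext i j
  simp only [decouple, Finset.mem_singleton, Finset.mem_insert, not_or]
  by_cases h : i = j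
  · simp [h]
  · simp only [h, false_or]
    rw [← ite_and]
    congr 1
    simp only [eq_iff_iff]
    tauto

theorem decouple_diag (S : Finset V) (v : V) : decouple A S v v = A v v := by simp [decouple]

theorem decouple_isSymm (hA : A.IsSymm) (S : Finset V) : (decouple A S).IsSymm := by
  ext i j
  simp only [decouple, Matrix.transpose_apply, hA.apply i j, eq_comm (a := j), and_comm]

/-- The form splits as A evaluated on x with its S-coordinates set to zero, plus the positive
diagonal terms A_vv x_v² for v in S. -/
theorem decouple_posDef (hA : A.PosDef) (S : Finset V) : (decouple A S).PosDef := by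
  have hsymm : A.IsSymm := by
    have := hA.isHermitian
    rwa [Matrix.IsHermitian, Matrix.conjTranspose_eq_transpose_of_trivial] at this
  refine Matrix.PosDef.of_dotProduct_mulVec_pos ?_ fun x hx => ?_
  · rw [Matrix.IsHermitian, Matrix.conjTranspose_eq_transpose_of_trivial]
    exact decouple_isSymm hsymm S
  let y : V → ℝ := fun v => if v ∈ S then 0 else x v
  have key : star x ⬝ᵥ (decouple A S).mulVec x =
      y ⬝ᵥ A.mulVec y + ∑ v ∈ S, A v v * x v ^ 2 := by
    rw [star_trivial]
    simp only [dotProduct, Matrix.mulVec, Finset.mul_sum]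
    rw [← Finset.sum_filter_add_sum_filter_not Finset.univ (fun v => v ∈ S),
      ← Finset.sum_filter_add_sum_filter_not (s := Finset.univ) (p := fun v => v ∈ S)
        (f := fun i => ∑ j, y i * (A i j * y j)), add_comm]
    have h1 : ∑ i with i ∈ S, ∑ j, y i * (A i j * y j) = 0 :=
      Finset.sum_eq_zero fun i hi => Finset.sum_eq_zero fun j _ => by
        simp [y, (Finset.mem_filter.1 hi).2]
    rw [h1, zero_add]
    congr 1
    · refine Finset.sum_congr rfl fun i hi => Finset.sum_congr rfl fun j _ => ?_
      have hi' := (Finset.mem_filter.1 hi).2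
      by_cases hj : j ∈ S
      · have : i ≠ j := fun h => hi' (h ▸ hj)
        simp [decouple, y, hi', hj, this]
      · simp [decouple, y, hi', hj]
    · rw [Finset.filter_mem_eq_inter, Finset.univ_inter]
      refine Finset.sum_congr rfl fun i hi => ?_
      rw [Finset.sum_eq_single i]
      · simp [decouple]; ring
      · intro j _ hj
        simp [decouple, hi, Ne.symm hj]
      · simp
  rw [key]
  have h0 : 0 ≤ ∑ v ∈ S, A v v * x v ^ 2 :=
    Finset.sum_nonneg fun v _ => mul_nonneg hA.diag_pos.le (sq_nonneg _)
  by_cases hy : y = 0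
  · rw [hy, zero_dotProduct, zero_add]
    obtain ⟨v, hv⟩ := Function.ne_iff.1 hx
    have hvS : v ∈ S := by
      by_contra h
      have := congrFun hy v
      simp only [y, h, if_false] at this
      exact hv this
    refine lt_of_lt_of_le ?_ (Finset.single_le_sum (f := fun v => A v v * x v ^ 2)
      (fun v _ => mul_nonneg hA.diag_pos.le (sq_nonneg _)) hvS)
    exact mul_pos hA.diag_pos (by have : x v ≠ 0 := hv; positivity)
  · have := hA.dotProduct_mulVec_pos hy
    rw [star_trivial] at this
    linarith

theorem cform_update (hA : A.IsSymm) (ζ : V → ℂ) (v : V) (z : ℂ) :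
    cform A (Function.update ζ v z) (Function.update ζ v z) =
      A v v * z ^ 2 + 2 * z * (∑ u, ((if u = v then 0 else A v u : ℝ) : ℂ) * ζ u) +
        cform A (Function.update ζ v 0) (Function.update ζ v 0) := by
  have h1 : Function.update ζ v z = Function.update ζ v 0 + z • Pi.single v 1 := by
    ext u
    by_cases h : u = v
    · subst h; simp
    · simp [h]
  have h2 : cform A (Pi.single v 1) (Function.update ζ v 0) =
      ∑ u, ((if u = v then 0 else A v u : ℝ) : ℂ) * ζ u := by
    rw [cform, Finset.sum_eq_single v]
    · refine Finset.sum_congr rfl fun u _ => ?_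
      by_cases h : u = v
      · subst h; simp
      · simp [h]
    · intro i _ hi; simp [hi]
    · simp
  have h3 : cform A (Pi.single v 1) (Pi.single v 1) = A v v := by
    rw [cform, Finset.sum_eq_single v, Finset.sum_eq_single v]
    · simp
    · intro i _ hi; simp [hi]
    · simp
    · intro i _ hi; simp [hi]
    · simp
  rw [h1, cform_add_left, cform_add_right, cform_add_right, cform_smul_left, cform_smul_right,
    cform_smul_left, cform_smul_right, cform_comm hA _ (Pi.single v 1), h2, h3]
  ring

theorem cform_decouple_singleton (ζ : V → ℂ) (v : V) :
    cform (decouple A {v}) (Function.update ζ v 0) (Function.update ζ v 0) =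
      cform A (Function.update ζ v 0) (Function.update ζ v 0) := by
  simp only [cform]
  refine Finset.sum_congr rfl fun i _ => Finset.sum_congr rfl fun j _ => ?_
  by_cases hi : i = v
  · subst hi; simp
  by_cases hj : j = v
  · subst hj; simp
  simp [decouple, hi, hj]

theorem contour_update_glue (s : V → ℤˣ) (v : V) (σ : ℤˣ) (x : ℝ) (η : {u // ¬u = v} → ℝ) :
    contour (Function.update s v σ) (glue v x η) =
      Function.update (contour s (glue v 0 η)) v ((x : ℂ) + ((σ : ℤ) : ℂ) * I) := by
  ext u
  by_cases h : u = v
  · subst h; simp [contour, glue]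
  · simp [contour, glue, h]

theorem prod_zpow_update (ζ : V → ℂ) (v : V) (z : ℂ) (m : V → ℤ) :
    ∏ u, (I * Function.update ζ v z u) ^ m u =
      (I * z) ^ m v * ∏ u ∈ Finset.univ.erase v, (I * ζ u) ^ m u := by
  rw [← Finset.mul_prod_erase _ _ (Finset.mem_univ v), Function.update_self]
  congr 1
  refine Finset.prod_congr rfl fun u hu => ?_
  rw [Function.update_of_ne (Finset.ne_of_mem_erase hu)]

/-- The multiplicities of the values of `f`. -/
def multiplicity {i : ℕ} (f : Fin i → V) : V → ℤ := fun u => (Finset.univ.filter fun t => f t = u).card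

theorem prod_zpow_multiplicity {i : ℕ} (f : Fin i → V) (z : V → ℂ) (S : Finset V)
    (hf : ∀ t, f t ∈ S) : ∏ u ∈ S, z u ^ multiplicity f u = ∏ t, z (f t) := by
  simp only [multiplicity, zpow_natCast]
  rw [← Finset.prod_fiberwise_of_maps_to (g := f) (t := S) (fun t _ => hf t)]
  refine Finset.prod_congr rfl fun u _ => ?_
  rw [Finset.prod_congr rfl (g := fun _ => z u), Finset.prod_const]
  intro t ht
  rw [(Finset.mem_filter.1 ht).2]

theorem isSymm_of_posDef_real (hA : A.PosDef) : A.IsSymm := by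
  have := hA.isHermitian
  rwa [Matrix.IsHermitian, Matrix.conjTranspose_eq_transpose_of_trivial] at this

/-- The part of the integrand of `moment A s m` that does not involve the coordinate at `v`. -/
def restFactor (A : Matrix V V ℝ) (v : V) (m : V → ℤ) (ζ : V → ℂ) : ℂ :=
  cexp (-cform A (Function.update ζ v 0) (Function.update ζ v 0)) *
    ∏ u ∈ Finset.univ.erase v, (I * ζ u) ^ m u

/-- The off-diagonal part of the row of `A` at `v`. -/
def offDiag (A : Matrix V V ℝ) (v u : V) : ℝ := if u = v then 0 else A v u

/-- Integrate over ζ_v first: the other coordinates enter that integral only through b = -∑_{u ≠ v}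
A_vu ζ_u. -/
theorem moment_update (hA : A.PosDef) (s : V → ℤˣ) (v : V) (σ : ℤˣ) (m : V → ℤ) :
    moment A (Function.update s v σ) m =
      ∫ η, restFactor A v m (contour s (glue v 0 η)) *
        lineIntegral (A v v) σ (m v) (-∑ u, (offDiag A v u : ℂ) * contour s (glue v 0 η) u) ∧
    Integrable (fun η => restFactor A v m (contour s (glue v 0 η)) *
        lineIntegral (A v v) σ (m v) (-∑ u, (offDiag A v u : ℂ) * contour s (glue v 0 η) u)) := by
  have h1 := integral_split v (integrable_moment hA (Function.update s v σ) m)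
  have h2 : ∀ η, ∫ x, cexp (-cform A (contour (Function.update s v σ) (glue v x η))
        (contour (Function.update s v σ) (glue v x η))) *
      ∏ u, (I * contour (Function.update s v σ) (glue v x η) u) ^ m u =
      restFactor A v m (contour s (glue v 0 η)) *
        lineIntegral (A v v) σ (m v) (-∑ u, (offDiag A v u : ℂ) * contour s (glue v 0 η) u) :=
    fun η => by
    rw [lineIntegral, ← integral_const_mul]
    refine integral_congr_ae (Filter.Eventually.of_forall fun x => ?_)
    simp only [contour_update_glue, prod_zpow_update, restFactor,
      cform_update (isSymm_of_posDef_real hA) _ v ((x : ℂ) + ((σ : ℤ) : ℂ) * I)]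
    rw [neg_add, Complex.exp_add]
    rw [show ∀ S : ℂ, -(((A v v : ℝ) : ℂ) * ((x : ℂ) + ((σ : ℤ) : ℂ) * I) ^ 2 +
      2 * ((x : ℂ) + ((σ : ℤ) : ℂ) * I) * S) = -((A v v : ℝ) : ℂ) * ((x : ℂ) + ((σ : ℤ) : ℂ) * I) ^ 2 +
      2 * (-S) * ((x : ℂ) + ((σ : ℤ) : ℂ) * I) from fun S => by ring]
    simp only [offDiag]
    ring
  simp only [h2] at h1
  exact h1

/-- The jump in ζ_v is a polynomial in b, and the maps f list the monomials of its powers. Since ζ_v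
has been integrated out, what remains is a moment for the decoupled matrix with exponent 0 at v. The
coefficients depend on m only through m_v, which later allows them to be taken out of sums over m.
-/
theorem exists_moment_flip {a : ℝ} (ha : 0 < a) : ∃ C : ℤ → ℕ → ℂ, ∀ (A : Matrix V V ℝ),
    A.PosDef → ∀ v : V, A v v = a → ∀ (s : V → ℤˣ) (m : V → ℤ),
      moment A (Function.update s v 1) m - moment A (Function.update s v (-1)) m =
        ∑ i ∈ Finset.range (-m v).toNat, ∑ f : Fin i → V,
          C (m v) i * (∏ t, (offDiag A v (f t) : ℂ)) *
            moment (decouple A {v}) s (Function.update m v 0 + multiplicity f) := by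
  obtain ⟨c, hc⟩ := exists_coeff_lineJump ha
  set g : ℂ := (Real.pi / a : ℂ) ^ (1 / 2 : ℂ) with hg
  have hg0 : g ≠ 0 := by
    rw [hg, Complex.cpow_ne_zero_iff]
    left
    have : (a : ℂ) ≠ 0 := by exact_mod_cast ha.ne'
    have : (Real.pi : ℂ) ≠ 0 := by exact_mod_cast Real.pi_ne_zero
    positivity
  -- Division by `g` compensates for the decoupled Gaussian integral over ζ_v that is inserted to
  -- form a full moment; I^i comes from b = i ∑ A_vu (iζ_u).
  refine ⟨fun m i => c m i * I ^ i / g, fun A hA v hav s m => ?_⟩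
  obtain ⟨h1, h1'⟩ := moment_update hA s v 1 m
  obtain ⟨h2, h2'⟩ := moment_update hA s v (-1) m
  have hD := decouple_posDef hA {v}
  have hM : ∀ (i : ℕ) (f : Fin i → V), (∀ t, f t ≠ v) →
      (Function.update m v 0 + multiplicity f) v = 0 := fun i f hf => by
    simp [multiplicity, hf]
  have hoff : ∀ u, offDiag (decouple A {v}) v u = 0 := fun u => by
    by_cases h : u = v
    · simp [offDiag, h]
    · simp [offDiag, decouple, h, Ne.symm h]
  have hrest : ∀ (i : ℕ) (f : Fin i → V), (∀ t, f t ≠ v) → ∀ ξ : V → ℝ,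
      restFactor (decouple A {v}) v (Function.update m v 0 + multiplicity f) (contour s ξ) =
        restFactor A v m (contour s ξ) * ∏ t, (I * contour s ξ (f t)) := fun i f hf ξ => by
    have hne : ∀ u, I * contour s ξ u ≠ 0 := fun u =>
      mul_ne_zero I_ne_zero (contour_coord_ne_zero _ _)
    rw [restFactor, restFactor, cform_decouple_singleton, mul_assoc,
      ← prod_zpow_multiplicity f (fun u => I * contour s ξ u) (Finset.univ.erase v)
        (fun t => Finset.mem_erase.2 ⟨hf t, Finset.mem_univ _⟩), ← Finset.prod_mul_distrib]
    congr 1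
    refine Finset.prod_congr rfl fun u hu => ?_
    rw [Pi.add_apply, Function.update_of_ne (Finset.ne_of_mem_erase hu), zpow_add₀ (hne u)]
  have hmom : ∀ (i : ℕ) (f : Fin i → V), (∀ t, f t ≠ v) →
      moment (decouple A {v}) s (Function.update m v 0 + multiplicity f) =
        ∫ η, (restFactor A v m (contour s (glue v 0 η)) *
          ∏ t, (I * contour s (glue v 0 η) (f t))) * g ∧
      Integrable (fun η => (restFactor A v m (contour s (glue v 0 η)) *
          ∏ t, (I * contour s (glue v 0 η) (f t))) * g) := fun i f hf => by
    have h := moment_update hD s v (s v) (Function.update m v 0 + multiplicity f)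
    rw [Function.update_eq_self] at h
    simp only [hrest i f hf, hM i f hf, hoff, decouple_diag, hav, lineIntegral_zero ha,
      Complex.ofReal_zero, zero_mul, Finset.sum_const_zero, neg_zero] at h
    simpa [hg] using h
  have hoff' : ∀ (i : ℕ) (f : Fin i → V), (¬∀ t, f t ≠ v) → ∏ t, (offDiag A v (f t) : ℂ) = 0 :=
    fun i f hf => by
    push Not at hf
    obtain ⟨t, ht⟩ := hf
    exact Finset.prod_eq_zero (Finset.mem_univ t) (by simp [offDiag, ht])
  rw [h1, h2, ← integral_sub h1' h2']
  have hpt : ∀ η : {u // ¬u = v} → ℝ, restFactor A v m (contour s (glue v 0 η)) *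
        lineIntegral (A v v) 1 (m v) (-∑ u, (offDiag A v u : ℂ) * contour s (glue v 0 η) u) -
      restFactor A v m (contour s (glue v 0 η)) *
        lineIntegral (A v v) (-1) (m v) (-∑ u, (offDiag A v u : ℂ) * contour s (glue v 0 η) u) =
      ∑ i ∈ Finset.range (-m v).toNat, ∑ f : Fin i → V,
        (c (m v) i * I ^ i / g * ∏ t, (offDiag A v (f t) : ℂ)) *
          ((restFactor A v m (contour s (glue v 0 η)) *
            ∏ t, (I * contour s (glue v 0 η) (f t))) * g) := fun η => by
    rw [← mul_sub, hav]
    change _ * lineJump a (m v) _ = _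
    rw [hc, Finset.mul_sum]
    refine Finset.sum_congr rfl fun i _ => ?_
    have hb : -∑ u, (offDiag A v u : ℂ) * contour s (glue v 0 η) u =
        I * ∑ u, (offDiag A v u : ℂ) * (I * contour s (glue v 0 η) u) := by
      rw [Finset.mul_sum, ← Finset.sum_neg_distrib]
      refine Finset.sum_congr rfl fun u _ => ?_
      linear_combination (-(offDiag A v u : ℂ) * contour s (glue v 0 η) u) * I_mul_I
    rw [hb, mul_pow, Fintype.sum_pow, Finset.mul_sum, Finset.mul_sum, Finset.mul_sum]
    refine Finset.sum_congr rfl fun f _ => ?_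
    rw [Finset.prod_mul_distrib]
    field_simp
  have hint : ∀ i ∈ Finset.range (-m v).toNat, ∀ f : Fin i → V, Integrable fun η =>
      (c (m v) i * I ^ i / g * ∏ t, (offDiag A v (f t) : ℂ)) *
          ((restFactor A v m (contour s (glue v 0 η)) *
            ∏ t, (I * contour s (glue v 0 η) (f t))) * g) := fun i _ f => by
    by_cases hf : ∀ t, f t ≠ v
    · exact (hmom i f hf).2.const_mul _
    · simp [hoff' i f hf]
  simp only [hpt]
  rw [integral_finsetSum _ fun i hi => integrable_finsetSum _ fun f _ => hint i hi f]
  refine Finset.sum_congr rfl fun i hi => ?_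
  rw [integral_finsetSum _ fun f _ => hint i hi f]
  refine Finset.sum_congr rfl fun f _ => ?_
  rw [integral_const_mul]
  by_cases hf : ∀ t, f t ≠ v
  · rw [(hmom i f hf).1]
  · simp [hoff' i f hf]

end Decouple

/-! ### Reflection of a decoupled set of variables -/

section Reflection
variable {V : Type*} [Fintype V] [DecidableEq V] {A : Matrix V V ℝ}

/-- The signs changed on `C`. -/
def flipOn (C : Finset V) (s : V → ℤˣ) : V → ℤˣ := fun v => if v ∈ C then -s v else s v

/-- The substitution ζ ↦ -ζ on C preserves the kernel, since no entry of A couples C to its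
complement. -/
theorem moment_flipOn (C : Finset V) (hC : ∀ i ∈ C, ∀ j ∉ C, A i j = 0)
    (hC' : ∀ i ∉ C, ∀ j ∈ C, A i j = 0) (s : V → ℤˣ) (m : V → ℤ) :
    moment A (flipOn C s) m = (-1) ^ (∑ v ∈ C, m v) * moment A s m := by
  let ε : V → ℝ := fun v => if v ∈ C then -1 else 1
  have hε : ∀ v, ε v = 1 ∨ ε v = -1 := fun v => by simp only [ε]; split_ifs <;> simp
  let T : (V → ℝ) → V → ℝ := fun ξ v => ε v * ξ v
  have hcont : ∀ ξ v, contour (flipOn C s) (T ξ) v = (ε v : ℂ) * contour s ξ v := fun ξ v => by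
    simp only [contour, flipOn, T, ε]
    split_ifs <;> simp <;> ring
  have hT : MeasurePreserving T := by
    refine volume_preserving_pi (f := fun v x => ε v * x) fun v => ?_
    rcases hε v with h | h
    · simp only [h, one_mul]; exact MeasurePreserving.id _
    · simp only [h, neg_one_mul]; exact Measure.measurePreserving_neg _
  have hTT : ∀ ξ, T (T ξ) = ξ := fun ξ => by
    ext v
    rcases hε v with h | h <;> simp [T, h]
  have hTe : MeasurableEmbedding T :=
    (⟨⟨T, T, hTT, hTT⟩, hT.measurable, hT.measurable⟩ : (V → ℝ) ≃ᵐ (V → ℝ)).measurableEmbedding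
  rw [moment, contourIntegral, ← hT.integral_comp hTe, moment, contourIntegral, ← integral_const_mul]
  refine integral_congr_ae (Filter.Eventually.of_forall fun ξ => ?_)
  simp only
  have h1 : cform A (contour (flipOn C s) (T ξ)) (contour (flipOn C s) (T ξ)) =
      cform A (contour s ξ) (contour s ξ) := by
    simp only [cform, hcont]
    refine Finset.sum_congr rfl fun i _ => Finset.sum_congr rfl fun j _ => ?_
    by_cases hi : i ∈ C <;> by_cases hj : j ∈ C
    · simp [ε, hi, hj]
    · simp [hC i hi j hj]
    · simp [hC' i hi j hj]
    · simp [ε, hi, hj]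
  have h2 : ∏ v, (I * contour (flipOn C s) (T ξ) v) ^ m v =
      (-1) ^ (∑ v ∈ C, m v) * ∏ v, (I * contour s ξ v) ^ m v := by
    rw [zpow_finset_sum (by simp), ← Finset.prod_filter_mul_prod_filter_not Finset.univ (· ∈ C),
      ← Finset.prod_filter_mul_prod_filter_not Finset.univ (· ∈ C) (fun v => (I * contour s ξ v) ^ m v),
      ← mul_assoc, Finset.filter_mem_eq_inter, Finset.univ_inter, ← Finset.prod_mul_distrib]
    congr 1
    · refine Finset.prod_congr rfl fun v hv => ?_
      rw [hcont, ← mul_zpow]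
      congr 1
      simp [ε, hv]
    · refine Finset.prod_congr rfl fun v hv => ?_
      rw [hcont]
      simp [ε, (Finset.mem_filter.1 hv).2]
  rw [h1, h2]
  ring

end Reflection


/-! ### Branches of a forest at a vertex -/

section Branches
variable {V : Type*} [Fintype V] [DecidableEq V] {G : SimpleGraph V}

/-- The set `C` is a connected component of the graph without the edge `{v, u}`, the one on the
side of `u`. -/
structure IsBranch (G : SimpleGraph V) (v u : V) (C : Finset V) : Prop where
  mem : u ∈ C
  notMem : v ∉ C
  adj : G.Adj v u
  boundary : ∀ x ∈ C, ∀ y ∉ C, G.Adj x y → x = u ∧ y = v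
  connected : ∀ D : Finset V, (∃ x ∈ C, x ∈ D) →
    (∀ x ∈ D, x ∈ C → ∀ y ∈ C, G.Adj x y → y ∈ D) → C ⊆ D

/-- In an acyclic graph every edge is a bridge; take the vertices reachable from u once the edge is
deleted. -/
theorem exists_isBranch (hG : G.IsAcyclic) {v u : V} (h : G.Adj v u) : ∃ C, IsBranch G v u C := by
  classical
  set H := G.deleteEdges {s(v, u)} with hH
  have hb : ¬ H.Reachable v u :=
    SimpleGraph.isBridge_iff.1 (SimpleGraph.isAcyclic_iff_forall_adj_isBridge.1 hG h)
  have hadj : ∀ x y, H.Adj x y ↔ G.Adj x y ∧ s(x, y) ≠ s(v, u) := fun x y => by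
    rw [hH, SimpleGraph.deleteEdges_adj, Set.mem_singleton_iff]
  refine ⟨Finset.univ.filter fun x => H.Reachable u x, by simp, ?_, h, ?_, ?_⟩
  · simp only [Finset.mem_filter, Finset.mem_univ, true_and]
    exact fun h => hb h.symm
  · intro x hx y hy hxy
    simp only [Finset.mem_filter, Finset.mem_univ, true_and] at hx hy
    by_cases he : s(x, y) = s(v, u)
    · rcases Sym2.eq_iff.1 he with ⟨rfl, rfl⟩ | ⟨rfl, rfl⟩
      · exact absurd hx.symm hb
      · exact ⟨rfl, rfl⟩
    · exact absurd (hx.trans ((hadj x y).2 ⟨hxy, he⟩).reachable) hy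
  · rintro D ⟨x, hx, hxD⟩ hD y hy
    simp only [Finset.mem_filter, Finset.mem_univ, true_and] at hx hy hD
    have hxy := (SimpleGraph.reachable_iff_reflTransGen _ _).1 (hx.symm.trans hy)
    induction hxy with
    | refl => exact hxD
    | tail h1 h2 ih =>
      have hb := hx.trans ((SimpleGraph.reachable_iff_reflTransGen _ _).2 h1)
      exact hD _ (ih hb) hb _ (hb.trans h2.reachable) ((hadj _ _).1 h2).1

namespace IsBranch
variable {v u : V} {C : Finset V}

/-- By connectedness a common point forces C₁ ⊆ C₂, because an edge leaving C₂ ends at v. Then u₁ is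
in C₂ and adjacent to v, hence is the exit vertex u₂. -/
theorem eq_of_mem {u₁ u₂ : V} {C₁ C₂ : Finset V} (h₁ : IsBranch G v u₁ C₁)
    (h₂ : IsBranch G v u₂ C₂) {x : V} (hx₁ : x ∈ C₁) (hx₂ : x ∈ C₂) : u₁ = u₂ := by
  have hsub : C₁ ⊆ C₂ := by
    refine h₁.connected C₂ ⟨x, hx₁, hx₂⟩ fun a ha _ b hb hab => ?_
    by_contra hb2
    exact h₁.notMem ((h₂.boundary a ha b hb2 hab).2 ▸ hb)
  exact (h₂.boundary u₁ (hsub h₁.mem) v h₂.notMem h₁.adj.symm).1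

/-- The only way out of C passes through v, which C' avoids. This gives the descent in
`constrainedSum_eq_zero`. -/
theorem subset {v' u' : V} {C' : Finset V} (h : IsBranch G v u C) (hv' : v' ∈ C)
    (h' : IsBranch G v' u' C') (hv : v ∉ C') : C' ⊂ C := by
  refine (Finset.ssubset_iff_of_subset ?_).2 ⟨v', hv', h'.notMem⟩
  refine h'.connected C ⟨u', h'.mem, ?_⟩ fun a ha ha' b hb hab => ?_
  · by_contra hu
    exact hv ((h.boundary v' hv' u' hu h'.adj).2 ▸ h'.mem)
  · by_contra hbC
    exact hv ((h.boundary a ha b hbC hab).2 ▸ hb)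

variable [DecidableRel G.Adj]

/-- Modulo 2 the edges inside C cancel in pairs, and only the edge {u, v} leaves C. -/
theorem odd_sum_degree (h : IsBranch G v u C) : Odd (∑ x ∈ C, G.degree x) := by
  rw [← ZMod.natCast_eq_one_iff_odd]
  have hdeg : ∀ x, (G.degree x : ZMod 2) = ∑ y, if G.Adj x y then (1 : ZMod 2) else 0 := fun x => by
    rw [← G.card_neighborFinset_eq_degree, G.neighborFinset_eq_filter]
    simp
  push_cast
  simp only [hdeg, ← Finset.sum_add_sum_compl C]
  rw [Finset.sum_add_distrib]
  have h1 : ∑ x ∈ C, ∑ y ∈ C, (if G.Adj x y then (1 : ZMod 2) else 0) = 0 := by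
    rw [← Finset.sum_product']
    refine Finset.sum_involution (fun p _ => p.swap) (fun p _ => ?_) (fun p _ hp hs => ?_)
      (fun p hp => ?_) (fun p _ => Prod.swap_swap p)
    · simp only [Prod.fst_swap, Prod.snd_swap, G.adj_comm p.2 p.1]
      exact CharTwo.add_self_eq_zero _
    · have : p.2 = p.1 := congrArg Prod.fst hs
      simp [this] at hp
    · simp only [Finset.mem_product, Prod.fst_swap, Prod.snd_swap] at hp ⊢
      exact hp.symm
  rw [h1, zero_add, Finset.sum_eq_single u, Finset.sum_eq_single v]
  · rw [if_pos h.adj.symm]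
  · intro y hy hyv
    rw [if_neg fun hadj => hyv (h.boundary u h.mem y (Finset.mem_compl.1 hy) hadj).2]
  · intro hv; exact absurd (Finset.mem_compl.2 h.notMem) hv
  · intro x hx hxu
    refine Finset.sum_eq_zero fun y hy => ?_
    rw [if_neg fun hadj => hxu (h.boundary x hx y (Finset.mem_compl.1 hy) hadj).1]
  · intro hu; exact absurd h.mem hu

end IsBranch

/-- At least two neighbours lie outside F. Their branches are disjoint, so z is in at most one of
them. -/
theorem exists_isBranch_avoiding [DecidableRel G.Adj] (hG : G.IsAcyclic) (v z : V) (F : Finset V)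
    (hF : F.card + 1 < G.degree v) : ∃ u C, IsBranch G v u C ∧ u ∉ F ∧ z ∉ C := by
  have h1 : 1 < (G.neighborFinset v \ F).card := by
    have := Finset.le_card_sdiff F (G.neighborFinset v)
    rw [G.card_neighborFinset_eq_degree] at this
    omega
  obtain ⟨u₁, hu₁, u₂, hu₂, hne⟩ := Finset.one_lt_card.1 h1
  rw [Finset.mem_sdiff, SimpleGraph.mem_neighborFinset] at hu₁ hu₂
  obtain ⟨C₁, hC₁⟩ := exists_isBranch hG hu₁.1
  obtain ⟨C₂, hC₂⟩ := exists_isBranch hG hu₂.1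
  by_cases hz : z ∈ C₁
  · exact ⟨u₂, C₂, hC₂, hu₂.2, fun hz2 => hne (hC₁.eq_of_mem hC₂ hz hz2)⟩
  · exact ⟨u₁, C₁, hC₁, hu₁.2, hz⟩

end Branches

/-! ### Parity of the exponents of φ on a branch -/

section Parity
variable {V : Type*} [Fintype V] [DecidableEq V] {G : SimpleGraph V} [DecidableRel G.Adj] {w : V → ℤ}

theorem e_eq_one_iff {z : ℂ} : e z = 1 ↔ ∃ n : ℤ, z = n := by
  rw [e, Complex.exp_eq_one_iff]
  have h : (2 * Real.pi * I : ℂ) ≠ 0 := Complex.two_pi_I_ne_zero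
  refine exists_congr fun n => ?_
  rw [mul_comm (n : ℂ)]
  exact mul_right_inj' h

theorem unityRoot_two_mul {k : ℕ} (hk : 0 < k) : unityRoot k (2 * k) = 1 := by
  have : (k : ℂ) ≠ 0 := by exact_mod_cast hk.ne'
  rw [unityRoot, e, ← Complex.exp_nat_mul]
  convert Complex.exp_two_pi_mul_I using 2
  push_cast
  field_simp

theorem dvd_of_unityRoot_sq {k : ℕ} (hk : 0 < k) {m : ℕ} (h : unityRoot k m ^ 2 = 1) : k ∣ m := by
  have hk' : (k : ℂ) ≠ 0 := by exact_mod_cast hk.ne'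
  have h1 : e ((m : ℂ) / k) = 1 := by
    rw [← h, unityRoot, ← pow_mul, e, e, ← Complex.exp_nat_mul]
    congr 1
    push_cast
    field_simp
  obtain ⟨n, hn⟩ := e_eq_one_iff.1 h1
  rw [div_eq_iff hk'] at hn
  have : (m : ℤ) = n * k := by exact_mod_cast hn
  exact Int.natCast_dvd_natCast.1 ⟨n, by rw [this]; ring⟩

theorem unityRoot_neg {k : ℕ} [NeZero (2 * k)] (hk : 0 < k) (a : Fin (2 * k)) :
    unityRoot k ((-a : Fin (2 * k)) : ℕ) = (unityRoot k a)⁻¹ := by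
  refine eq_inv_of_mul_eq_one_left ?_
  rw [Fin.val_neg]
  split_ifs with h
  · simp [h, unityRoot]
  · rw [unityRoot, unityRoot, ← pow_add, Nat.sub_add_cancel a.2.le]
    exact unityRoot_two_mul hk

/-- The residue vector negated on `C`. -/
def negOn {k : ℕ} [NeZero (2 * k)] (C : Finset V) (μ : V → Fin (2 * k)) : V → Fin (2 * k) :=
  fun x => if x ∈ C then -μ x else μ x

theorem negOn_negOn {k : ℕ} [NeZero (2 * k)] (C : Finset V) (μ : V → Fin (2 * k)) :
    negOn C (negOn C μ) = μ := by
  ext x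
  simp only [negOn]
  split_ifs <;> simp

theorem e_quadratic_congr {W : Matrix V V ℤ} (hW : W.IsSymm) {k : ℕ} (hk : 0 < k) (x y : V → ℤ) :
    e (((x + (2 * k : ℤ) • y) ⬝ᵥ W.mulVec (x + (2 * k : ℤ) • y) : ℤ) / (4 * k)) =
      e ((x ⬝ᵥ W.mulVec x : ℤ) / (4 * k)) := by
  have hs : y ⬝ᵥ W.mulVec x = x ⬝ᵥ W.mulVec y := by
    rw [Matrix.dotProduct_mulVec, ← Matrix.mulVec_transpose, hW.eq, dotProduct_comm]
  have hk' : (k : ℂ) ≠ 0 := by exact_mod_cast hk.ne'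
  refine Eq.trans ?_ (e_add_int _ (x ⬝ᵥ W.mulVec y + k * (y ⬝ᵥ W.mulVec y)))
  congr 1
  have : (x + (2 * k : ℤ) • y) ⬝ᵥ W.mulVec (x + (2 * k : ℤ) • y) =
      x ⬝ᵥ W.mulVec x + 4 * k * (x ⬝ᵥ W.mulVec y + k * (y ⬝ᵥ W.mulVec y)) := by
    simp only [Matrix.mulVec_add, Matrix.mulVec_smul, add_dotProduct, dotProduct_add, smul_dotProduct,
      dotProduct_smul, hs, smul_eq_mul]
    ring
  rw [this]
  push_cast
  field_simp

/-- With c the part of x = μ supported on C, the form changes by -4 ᵗc W(x - c) up to a multiple of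
4k. Only the edge {u, v} joins C to its complement, so this pairing is a multiple of μ_v, hence of
k. -/
theorem gaussPhase_negOn (hW : (linkingMatrix G w).IsSymm) {k : ℕ} [NeZero (2 * k)] (hk : 0 < k)
    {v u : V} {C : Finset V} (hC : IsBranch G v u C) (μ : V → Fin (2 * k))
    (hv : (k : ℤ) ∣ ((μ v : ℕ) : ℤ)) :
    gaussPhase (linkingMatrix G w) k (negOn C μ) = gaussPhase (linkingMatrix G w) k μ := by
  set W := linkingMatrix G w with hWdef
  set x : V → ℤ := fun y => ((μ y : ℕ) : ℤ) with hx
  set c : V → ℤ := fun y => if y ∈ C then x y else 0 with hc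
  -- In `Fin (2 * k)` the representative of -a is 2k - a, except at a = 0; the resulting multiple of
  -- 2k is harmless by `e_quadratic_congr`.
  have h1 : (fun y => ((negOn C μ y : ℕ) : ℤ)) =
      (x - (2 : ℤ) • c) + (2 * k : ℤ) • (fun y => if y ∈ C ∧ μ y ≠ 0 then (1 : ℤ) else 0) := by
    ext y
    simp only [negOn, hc, hx, Pi.add_apply, Pi.sub_apply, Pi.smul_apply, smul_eq_mul]
    by_cases hy : y ∈ C
    · simp only [hy, if_true, true_and]
      rw [Fin.val_neg]
      by_cases h0 : μ y = 0
      · simp [h0]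
      · simp only [h0, ne_eq, not_false_eq_true, if_true, if_false]
        have := (μ y).2
        push_cast [Nat.cast_sub this.le]
        ring
    · simp [hy]
  have hsymm : x ⬝ᵥ W.mulVec c = c ⬝ᵥ W.mulVec x := by
    rw [Matrix.dotProduct_mulVec, ← Matrix.mulVec_transpose, hW.eq, dotProduct_comm]
  have h2 : (x - (2 : ℤ) • c) ⬝ᵥ W.mulVec (x - (2 : ℤ) • c) =
      x ⬝ᵥ W.mulVec x - 4 * (c ⬝ᵥ W.mulVec (x - c)) := by
    simp only [Matrix.mulVec_sub, Matrix.mulVec_smul, sub_dotProduct, dotProduct_sub, smul_dotProduct,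
      dotProduct_smul, hsymm, smul_eq_mul]
    ring
  have h3 : (k : ℤ) ∣ c ⬝ᵥ W.mulVec (x - c) := by
    simp only [dotProduct, Matrix.mulVec, Finset.mul_sum]
    refine Finset.dvd_sum fun i _ => Finset.dvd_sum fun j _ => ?_
    by_cases hi : i ∈ C
    · by_cases hj : j ∈ C
      · simp [hc, hj]
      · have hij : i ≠ j := fun h => hj (h ▸ hi)
        by_cases hadj : G.Adj i j
        · obtain ⟨-, rfl⟩ := hC.boundary i hi j hj hadj
          simp only [Pi.sub_apply, hc, hj, if_false, sub_zero]
          exact (hv.mul_left _).mul_left _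
        · simp [hWdef, linkingMatrix, hij, hadj]
    · simp [hc, hi]
  obtain ⟨n, hn⟩ := h3
  have hk' : (k : ℂ) ≠ 0 := by exact_mod_cast hk.ne'
  rw [gaussPhase, h1, e_quadratic_congr hW hk, h2, hn, gaussPhase, ← e_add_int _ n]
  congr 1
  push_cast
  field_simp
  ring

/-- Apply the involution negating μ on C. Since m_v < 0, only terms with a pole at v matter, and
there k divides μ_v, so the phase is preserved while `laurentCoeff_inv` gives the sign ∏_{x ∈ C}
(-1)^(m_x + deg x). A nonzero coefficient forces this sign to be 1, and the degrees on C have odd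
sum. -/
theorem odd_sum_of_phiCoeff_ne_zero (hW : (linkingMatrix G w).IsSymm) {k : ℕ} (hk : 0 < k) {v u : V}
    {C : Finset V} (hC : IsBranch G v u C) {m : V → ℤ} (hv : m v < 0)
    (hm : phiCoeff G w k m ≠ 0) : Odd (∑ x ∈ C, m x) := by
  have : NeZero (2 * k) := ⟨by omega⟩
  let T : (V → Fin (2 * k)) ≃ (V → Fin (2 * k)) := ⟨negOn C, negOn C, negOn_negOn C, negOn_negOn C⟩
  have h1 : phiCoeff G w k m = (-1) ^ (∑ x ∈ C, (m x + G.degree x)) * phiCoeff G w k m := by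
    conv_lhs => rw [phiCoeff, ← T.sum_comp]
    rw [phiCoeff, Finset.mul_sum]
    refine Finset.sum_congr rfl fun μ _ => ?_
    change gaussPhase _ k (negOn C μ) * ∏ x, laurentCoeff _ (unityRoot k (negOn C μ x)) (m x) = _
    by_cases h0 : laurentCoeff (G.degree v) (unityRoot k (μ v)) (m v) = 0
    · rw [Finset.prod_eq_zero (Finset.mem_univ v) (by simpa [negOn, hC.notMem] using h0),
        Finset.prod_eq_zero (Finset.mem_univ v) h0]
      simp
    · have hd : k ∣ (μ v : ℕ) := dvd_of_unityRoot_sq hk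
        (sq_eq_one_of_laurentCoeff_ne_zero (unityRoot_ne_zero _ _) hv h0)
      rw [gaussPhase_negOn hW hk hC μ (Int.natCast_dvd_natCast.2 hd), mul_left_comm]
      congr 1
      rw [zpow_finset_sum (by simp), ← Finset.prod_filter_mul_prod_filter_not Finset.univ (· ∈ C),
        ← Finset.prod_filter_mul_prod_filter_not Finset.univ (· ∈ C)
          (fun x => laurentCoeff (G.degree x) (unityRoot k (μ x)) (m x)),
        ← mul_assoc, Finset.filter_mem_eq_inter, Finset.univ_inter, ← Finset.prod_mul_distrib]
      congr 1
      · refine Finset.prod_congr rfl fun x hx => ?_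
        rw [negOn, if_pos hx, unityRoot_neg hk, laurentCoeff_inv (unityRoot_ne_zero _ _)]
      · refine Finset.prod_congr rfl fun x hx => ?_
        rw [negOn, if_neg (Finset.mem_filter.1 hx).2]
  have h2 : ((-1 : ℂ)) ^ (∑ x ∈ C, (m x + (G.degree x : ℤ))) = 1 :=
    (mul_eq_right₀ hm).1 h1.symm
  have h3 : Even (∑ x ∈ C, (m x + (G.degree x : ℤ))) := by
    by_contra hodd
    rw [Int.not_even_iff_odd] at hodd
    rw [hodd.neg_one_zpow] at h2
    norm_num at h2
  have h4 := hC.odd_sum_degree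
  rw [Finset.sum_add_distrib, Int.even_add, ← Nat.cast_sum, Int.even_coe_nat] at h3
  rw [← Int.not_even_iff_odd, h3, Nat.not_even_iff_odd]
  exact h4

end Parity


/-! ### Independence of the coefficients from the choice of contours -/

section SignIndependence
variable {V : Type*} [Fintype V] [DecidableEq V] {A : Matrix V V ℝ} {B : (V → ℤ) → ℂ} {n : V → ℕ}
  {N : ℤ}

/-- The sum of `B_m` times the moments of degree `N`, where the exponents in `S` are prescribed and
the variables in `S` are decoupled, and the other exponents are shifted by `j`. -/
def constrainedSum (A : Matrix V V ℝ) (B : (V → ℤ) → ℂ) (n : V → ℕ) (N : ℤ) (S : Finset V)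
    (P j : V → ℤ) (s : V → ℤˣ) : ℂ :=
  ∑ m ∈ (degreeSet n N).filter (fun m => ∀ x ∈ S, m x = P x),
    B m * moment (decouple A S) s (fun x => if x ∈ S then 0 else m x + j x)

/-- Expand every difference by `exists_moment_flip` and group the exponents by the value q = m_v.
For fixed q and f the coefficients factor out, and the group is a constrained sum with v added to S
and the shift increased by the multiplicities of f, which `H` annihilates. -/
theorem constrainedSum_update (hA : A.PosDef) {S : Finset V} {P j : V → ℤ} {v : V} (hv : v ∉ S)
    (hj : j v = 0) (s : V → ℤˣ)
    (H : ∀ (p i : ℕ) (f : Fin i → V), i < p → p ≤ n v →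
      (∀ t, offDiag (decouple A S) v (f t) ≠ 0) →
      constrainedSum A B n N (insert v S) (Function.update P v (-(p : ℤ))) (j + multiplicity f) s = 0) :
    constrainedSum A B n N S P j (Function.update s v 1) =
      constrainedSum A B n N S P j (Function.update s v (-1)) := by
  obtain ⟨C, hC⟩ := exists_moment_flip (V := V) (a := A v v) hA.diag_pos
  set T := (degreeSet n N).filter (fun m => ∀ x ∈ S, m x = P x) with hT
  let Y : (i : ℕ) → (Fin i → V) → (V → ℤ) → ℂ := fun i f m =>
    B m * moment (decouple A (insert v S)) s
      (fun x => if x ∈ insert v S then 0 else m x + (j + multiplicity f) x)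
  let X : ℤ → (i : ℕ) → (Fin i → V) → ℂ := fun q i f =>
    C q i * ∏ t, (offDiag (decouple A S) v (f t) : ℂ)
  have hterm : ∀ m, B m * moment (decouple A S) (Function.update s v 1)
        (fun x => if x ∈ S then 0 else m x + j x) -
      B m * moment (decouple A S) (Function.update s v (-1))
        (fun x => if x ∈ S then 0 else m x + j x) =
      ∑ i ∈ Finset.range (-m v).toNat, ∑ f : Fin i → V, X (m v) i f * Y i f m := fun m => by
    have h := hC _ (decouple_posDef hA S) v (decouple_diag S v) s
      (fun x => if x ∈ S then 0 else m x + j x)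
    rw [← mul_sub, h, decouple_decouple]
    simp only [hv, if_false, hj, add_zero, Finset.mul_sum]
    refine Finset.sum_congr rfl fun i _ => Finset.sum_congr rfl fun f _ => ?_
    by_cases hf : ∏ t, (offDiag (decouple A S) v (f t) : ℂ) = 0
    · simp [X, hf]
    · have hf' : ∀ t, offDiag (decouple A S) v (f t) ≠ 0 := fun t ht =>
        hf (Finset.prod_eq_zero (Finset.mem_univ t) (by rw [ht, Complex.ofReal_zero]))
      have hfv : ∀ t, f t ≠ v := fun t ht => hf' t (by simp [offDiag, ht])
      have hfS : ∀ t, f t ∉ S := fun t ht => hf' t (by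
        rw [offDiag, if_neg (hfv t), decouple, if_neg]
        rintro (h | h)
        · exact hfv t h.symm
        · exact h.2 ht)
      have hexp : Function.update (fun x => if x ∈ S then 0 else m x + j x) v 0 + multiplicity f =
          fun x => if x ∈ insert v S then 0 else m x + (j + multiplicity f) x := by
        ext x
        by_cases hx : x = v
        · subst hx
          simp [multiplicity, hfv]
        · by_cases hxS : x ∈ S
          · have : ∀ t, f t ≠ x := fun t ht => hfS t (ht ▸ hxS)
            simp [hx, hxS, multiplicity, this]
          · simp [hx, hxS, add_assoc]
      rw [hexp]
      simp only [X, Y]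
      ring
  rw [← sub_eq_zero, constrainedSum, constrainedSum, ← Finset.sum_sub_distrib]
  simp only [hterm]
  rw [← Finset.sum_fiberwise_of_maps_to (t := T.image fun m => m v) (g := fun m => m v)
    fun m hm => Finset.mem_image_of_mem _ hm]
  refine Finset.sum_eq_zero fun q hq => ?_
  have h1 : ∑ m ∈ T with m v = q, ∑ i ∈ Finset.range (-m v).toNat, ∑ f : Fin i → V,
      X (m v) i f * Y i f m = ∑ i ∈ Finset.range (-q).toNat, ∑ f : Fin i → V,
        X q i f * ∑ m ∈ T with m v = q, Y i f m := by
    rw [Finset.sum_congr rfl (g := fun m => ∑ i ∈ Finset.range (-q).toNat, ∑ f : Fin i → V,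
      X q i f * Y i f m) fun m hm => by rw [(Finset.mem_filter.1 hm).2], Finset.sum_comm]
    refine Finset.sum_congr rfl fun i _ => ?_
    rw [Finset.sum_comm]
    simp only [Finset.mul_sum]
  rw [h1]
  refine Finset.sum_eq_zero fun i hi => Finset.sum_eq_zero fun f _ => ?_
  by_cases hf : ∏ t, (offDiag (decouple A S) v (f t) : ℂ) = 0
  · simp [X, hf]
  have hf' : ∀ t, offDiag (decouple A S) v (f t) ≠ 0 := fun t ht =>
    hf (Finset.prod_eq_zero (Finset.mem_univ t) (by rw [ht, Complex.ofReal_zero]))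
  obtain ⟨m₀, hm₀, rfl⟩ := Finset.mem_image.1 hq
  have hm₁ := (mem_degreeSet.1 (Finset.mem_filter.1 hm₀).1).1 v
  rw [Finset.mem_range] at hi
  have h2 := H (-m₀ v).toNat i f hi (by omega) hf'
  rw [show -((-m₀ v).toNat : ℤ) = m₀ v by omega, constrainedSum] at h2
  have h3 : T.filter (fun m => m v = m₀ v) = (degreeSet n N).filter
      (fun m => ∀ x ∈ insert v S, m x = Function.update P v (m₀ v) x) := by
    ext m
    simp only [hT, Finset.mem_filter, Finset.forall_mem_insert, Function.update_self, and_assoc]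
    refine and_congr_right fun _ => ?_
    rw [and_comm]
    refine and_congr_right fun _ => forall₂_congr fun x hx => ?_
    rw [Function.update_of_ne (show x ≠ v from fun h => hv (h ▸ hx))]
  rw [h3, h2, mul_zero]

theorem eq_of_forall_update {g : (V → ℤˣ) → ℂ} {C : Finset V}
    (hg : ∀ v ∈ C, ∀ s, g (Function.update s v 1) = g (Function.update s v (-1))) {s s' : V → ℤˣ}
    (h : ∀ v ∉ C, s v = s' v) : g s = g s' := by
  induction C using Finset.induction_on generalizing s with
  | empty => rw [funext fun v => h v (Finset.notMem_empty v)]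
  | insert a C ha ih =>
    have h1 : ∀ σ, g (Function.update s a σ) = g (Function.update s a 1) := fun σ => by
      rcases Int.units_eq_one_or σ with rfl | rfl
      · rfl
      · exact (hg a (Finset.mem_insert_self a C) s).symm
    have h2 : g s = g (Function.update s a (s' a)) := by
      rw [h1 (s' a), ← h1 (s a), Function.update_eq_self]
    rw [h2]
    refine ih (fun v hv => hg v (Finset.mem_insert_of_mem hv)) fun v hv => ?_
    by_cases hva : v = a
    · subst hva; simp
    · rw [Function.update_of_ne hva]
      exact h v (by simp [hva, hv])

variable {G : SimpleGraph V} [DecidableRel G.Adj]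

theorem adj_of_offDiag_ne_zero (hGA : ∀ i j, i ≠ j → ¬G.Adj i j → A i j = 0) {S : Finset V} {v u : V}
    (h : offDiag (decouple A S) v u ≠ 0) : G.Adj v u := by
  by_contra hadj
  refine h ?_
  rw [offDiag]
  split_ifs with hu
  · rfl
  · rw [decouple, hGA v u (Ne.symm hu) hadj, ite_self]

/-- Strong induction on C. Flipping the sign at a vertex of C produces constrained sums for strictly
smaller branches, zero by induction, so the sum is unchanged when all signs on C are flipped. But v
is decoupled and the exponents on C are unshifted with odd sum, so that flip also changes its sign.
-/
theorem constrainedSum_eq_zero (hG : G.IsAcyclic) (hA : A.PosDef)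
    (hGA : ∀ i j, i ≠ j → ¬G.Adj i j → A i j = 0)
    (hB : ∀ v u C, IsBranch G v u C → ∀ m : V → ℤ, m v < 0 → B m ≠ 0 → Odd (∑ x ∈ C, m x))
    (C : Finset V) : ∀ {v u : V} {S : Finset V} {P j : V → ℤ} (s : V → ℤˣ), IsBranch G v u C →
      v ∈ S → (∀ x ∈ C, x ∉ S) → (∀ x ∈ C, j x = 0) → P v < 0 →
      constrainedSum A B (fun v => G.degree v - 2) N S P j s = 0 := by
  induction C using Finset.strongInduction with
  | H C ih =>
    intro v u S P j s hC hvS hCS hj hP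
    have hinv : constrainedSum A B (fun v => G.degree v - 2) N S P j (flipOn C s) =
        constrainedSum A B (fun v => G.degree v - 2) N S P j s := by
      refine eq_of_forall_update (C := C) (fun v' hv' s => ?_) fun x hx => by simp [flipOn, hx]
      refine constrainedSum_update hA (hCS v' hv') (hj v' hv') s fun p i f hip hp hf => ?_
      have hadj : ∀ t, G.Adj v' (f t) := fun t => adj_of_offDiag_ne_zero hGA (hf t)
      -- At most i ≤ deg v' - 3 neighbours of v' occur in f, so enough remain to choose a branch at
      -- v' whose exponents are not shifted and which does not contain v.
      obtain ⟨u', C', hC', hu', hvC'⟩ := exists_isBranch_avoiding hG v' v (Finset.univ.image f) (by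
        have := Finset.card_image_le (s := Finset.univ) (f := f)
        rw [Finset.card_univ, Fintype.card_fin] at this
        omega)
      have hsub := hC.subset hv' hC' hvC'
      refine ih C' hsub s hC' (Finset.mem_insert_self _ _) (fun x hx => ?_) (fun x hx => ?_) ?_
      · rw [Finset.mem_insert, not_or]
        exact ⟨fun h => hC'.notMem (h ▸ hx), hCS x (hsub.1 hx)⟩
      · rw [Pi.add_apply, hj x (hsub.1 hx), zero_add]
        have : ∀ t, f t ≠ x := fun t ht => hu' (by
          have := (hC'.boundary x hx v' hC'.notMem (ht ▸ (hadj t).symm)).1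
          rw [← this, ← ht]
          exact Finset.mem_image_of_mem f (Finset.mem_univ t))
        simp [multiplicity, this]
      · rw [Function.update_self]; omega
    -- The prescribed exponent at v is negative, so `hB` makes each contributing term odd under
    -- reflection of C.
    have hanti : constrainedSum A B (fun v => G.degree v - 2) N S P j (flipOn C s) =
        -constrainedSum A B (fun v => G.degree v - 2) N S P j s := by
      rw [constrainedSum, constrainedSum, ← Finset.sum_neg_distrib]
      refine Finset.sum_congr rfl fun m hm => ?_
      by_cases hBm : B m = 0
      · simp [hBm]
      have hmv : m v < 0 := by rw [(Finset.mem_filter.1 hm).2 v hvS]; exact hP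
      have hodd := hB v u C hC m hmv hBm
      have hzero : ∀ i ∈ C, ∀ j ∉ C, decouple A S i j = 0 := fun i hi j hj => by
        rw [decouple]
        split_ifs with h
        · have hij : i ≠ j := fun h => hj (h ▸ hi)
          refine hGA i j hij fun hadj => ?_
          have := (hC.boundary i hi j hj hadj).2
          rcases h with h | h
          · exact hij h
          · exact h.2 (this ▸ hvS)
        · rfl
      rw [moment_flipOn C hzero (fun i hi j hj => by
        rw [← (decouple_isSymm (isSymm_of_posDef_real hA) S).apply i j]; exact hzero j hj i hi)]
      rw [Finset.sum_congr rfl (g := m) fun x hx => by rw [if_neg (hCS x hx), hj x hx, add_zero],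
        hodd.neg_one_zpow]
      ring
    rw [hinv] at hanti
    exact self_eq_neg.1 hanti

/-- This is the case S = ∅ of `constrainedSum_update`: a flip at v yields sums with S = {v}, which
`constrainedSum_eq_zero` kills along a branch at v missed by f. -/
theorem sum_moment_eq (hG : G.IsAcyclic) (hA : A.PosDef)
    (hGA : ∀ i j, i ≠ j → ¬G.Adj i j → A i j = 0)
    (hB : ∀ v u C, IsBranch G v u C → ∀ m : V → ℤ, m v < 0 → B m ≠ 0 → Odd (∑ x ∈ C, m x))
    (s : V → ℤˣ) :
    ∑ m ∈ degreeSet (fun v => G.degree v - 2) N, B m * moment A s m =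
      ∑ m ∈ degreeSet (fun v => G.degree v - 2) N, B m * moment A 1 m := by
  have h1 : ∀ s, constrainedSum A B (fun v => G.degree v - 2) N ∅ 0 0 s =
      ∑ m ∈ degreeSet (fun v => G.degree v - 2) N, B m * moment A s m := fun s => by
    simp [constrainedSum, decouple_empty]
  rw [← h1, ← h1]
  refine eq_of_forall_update (C := Finset.univ) (fun v _ s => ?_) fun x hx =>
    absurd (Finset.mem_univ x) hx
  refine constrainedSum_update hA (Finset.notMem_empty v) rfl s fun p i f hip hp hf => ?_
  have hadj : ∀ t, G.Adj v (f t) := fun t => adj_of_offDiag_ne_zero hGA (hf t)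
  obtain ⟨u, C, hC, hu, -⟩ := exists_isBranch_avoiding hG v v (Finset.univ.image f) (by
    have := Finset.card_image_le (s := Finset.univ) (f := f)
    rw [Finset.card_univ, Fintype.card_fin] at this
    omega)
  refine constrainedSum_eq_zero hG hA hGA hB C s hC (Finset.mem_insert_self _ _) (fun x hx => ?_)
    (fun x hx => ?_) ?_
  · rw [Finset.mem_insert, not_or]
    exact ⟨fun h => hC.notMem (h ▸ hx), Finset.notMem_empty x⟩
  · rw [Pi.add_apply, Pi.zero_apply, zero_add]
    have : ∀ t, f t ≠ x := fun t ht => hu (by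
      have := (hC.boundary x hx v hC.notMem (ht ▸ (hadj t).symm)).1
      rw [← this, ← ht]
      exact Finset.mem_image_of_mem f (Finset.mem_univ t))
    simp [multiplicity, this]
  · rw [Function.update_self]; omega

theorem sum_phiCoeff_moment_eq {w : V → ℤ} (hG : G.IsAcyclic)
    (hW : (-(realMatrix (linkingMatrix G w))).PosDef) {k : ℕ} (hk : 0 < k) (s : V → ℤˣ) :
    ∑ m ∈ degreeSet (fun v => G.degree v - 2) N,
        phiCoeff G w k m * moment (-(realMatrix (linkingMatrix G w))) s m =
      ∑ m ∈ degreeSet (fun v => G.degree v - 2) N,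
        phiCoeff G w k m * moment (-(realMatrix (linkingMatrix G w))) 1 m :=
  sum_moment_eq hG hW (fun i j hij hadj => by simp [realMatrix, linkingMatrix, hij, hadj])
    (fun _ _ _ hC _ hv hm => odd_sum_of_phiCoeff_ne_zero (isSymm_int_of_posDef hW) hk hC hv hm) s

end SignIndependence


/-! ### Assembly of the asymptotic expansion -/

section Expansion
variable {V : Type*} [Fintype V] [DecidableEq V] {G : SimpleGraph V} [DecidableRel G.Adj] {w : V → ℤ}

theorem exists_norm_weightedSum_sub_le (hG : G.IsAcyclic)
    (hW : (-(realMatrix (linkingMatrix G w))).PosDef) {k : ℕ} (hk : 0 < k) (M : ℕ) :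
    ∃ K : ℝ, 0 ≤ K ∧ ∀ t : ℝ, 0 < t → t < 1 →
      ‖weightedSum G w k (1 / k + I * t / (2 * Real.pi)) -
        ∑ N ∈ Finset.Icc (-((∑ v, (G.degree v - 2) : ℕ) : ℤ)) M,
          (e (1 / 8) ^ Fintype.card V * (Real.sqrt |((linkingMatrix G w).det : ℝ)| : ℂ) /
            (Real.sqrt (2 * k) : ℂ) ^ Fintype.card V *
          hadamardCoeff (phi G w k)
            (fun x => ((Real.exp (-Q (linkingMatrix G w) x / 4) : ℝ) : ℂ)) N) *
          (Real.sqrt t : ℂ) ^ N‖ ≤ K * Real.sqrt t ^ (M + 1) := by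
  set κ : ℂ := e (1 / 8) ^ Fintype.card V * (Real.sqrt |((linkingMatrix G w).det : ℝ)| : ℂ) /
            (Real.sqrt (2 * k) : ℂ) ^ Fintype.card V with hκ
  set A := -(realMatrix (linkingMatrix G w)) with hA
  set n : V → ℕ := fun v => G.degree v - 2 with hn
  set Ns := Finset.Icc (-((∑ v, (G.degree v - 2) : ℕ) : ℤ)) (M : ℤ) with hNs
  choose K hK0 hK using fun (s : V → ℤˣ) (μ : V → Fin (2 * k)) =>
    exists_contour_expansion hW s (fun v => G.degree v) (fun v => norm_unityRoot k (μ v)) M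
  set φ : (V → ℤˣ) → (V → Fin (2 * k)) → ℤ → ℂ := fun s μ N => ∑ m ∈ degreeSet n N,
    (∏ v, laurentCoeff (G.degree v) (unityRoot k (μ v)) (m v)) * moment A s m with hφ
  refine ⟨‖κ‖ * ((1 / 2) ^ Fintype.card V * ∑ s, ∑ μ, ‖gaussPhase (linkingMatrix G w) k μ‖ *
    (‖(gaussConst A)⁻¹‖ * K s μ)), ?_, fun t ht ht1 => ?_⟩
  · refine mul_nonneg (norm_nonneg _) (mul_nonneg (by positivity) (Finset.sum_nonneg fun s _ =>
      Finset.sum_nonneg fun μ _ => ?_))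
    exact mul_nonneg (norm_nonneg _) (mul_nonneg (norm_nonneg _) (hK0 s μ))
  have hr : 0 < Real.sqrt t := Real.sqrt_pos.2 ht
  have hr1 : Real.sqrt t < 1 := by rw [Real.sqrt_lt' one_pos]; simpa using ht1
  -- All 2^|V| sign vectors give the same value as s = 1, so the average over s is that value.
  have hcoef : ∀ N : ℤ, (1 / 2 : ℂ) ^ Fintype.card V * ∑ s : V → ℤˣ, ∑ μ : V → Fin (2 * k),
      gaussPhase (linkingMatrix G w) k μ * ((gaussConst A)⁻¹ * φ s μ N) =
      hadamardCoeff (phi G w k)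
        (fun x => ((Real.exp (-Q (linkingMatrix G w) x / 4) : ℝ) : ℂ)) N := fun N => by
    rw [hadamardCoeff_phi hW]
    have h1 : ∀ s : V → ℤˣ, ∑ μ : V → Fin (2 * k),
        gaussPhase (linkingMatrix G w) k μ * ((gaussConst A)⁻¹ * φ s μ N) =
        (gaussConst A)⁻¹ * ∑ m ∈ degreeSet n N, phiCoeff G w k m * moment A 1 m := fun s => by
      rw [← sum_phiCoeff_moment_eq hG hW hk s]
      simp only [hφ, phiCoeff, Finset.mul_sum, Finset.sum_mul]
      rw [Finset.sum_comm]
      refine Finset.sum_congr rfl fun m _ => Finset.sum_congr rfl fun μ _ => ?_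
      ring
    simp only [h1, Finset.sum_const, Finset.card_univ, Fintype.card_fun, Fintype.card_units_int,
      nsmul_eq_mul]
    rw [← mul_assoc]
    push_cast
    rw [← mul_pow]
    norm_num
    rfl
  have hsum : ∑ N ∈ Ns, (κ * hadamardCoeff (phi G w k)
        (fun x => ((Real.exp (-Q (linkingMatrix G w) x / 4) : ℝ) : ℂ)) N) * (Real.sqrt t : ℂ) ^ N =
      κ * ((1 / 2) ^ Fintype.card V * ∑ s : V → ℤˣ, ∑ μ : V → Fin (2 * k),
        gaussPhase (linkingMatrix G w) k μ * ((gaussConst A)⁻¹ *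
          ∑ N ∈ Ns, φ s μ N * (Real.sqrt t : ℂ) ^ N)) := by
    simp only [← hcoef, Finset.mul_sum, Finset.sum_mul]
    rw [Finset.sum_comm]
    refine Finset.sum_congr rfl fun s _ => ?_
    rw [Finset.sum_comm]
    refine Finset.sum_congr rfl fun μ _ => Finset.sum_congr rfl fun N _ => ?_
    ring
  rw [hsum, weightedSum_eq_contourIntegral hW hk ht, ← mul_sub, ← mul_sub,
    ← Finset.sum_sub_distrib, norm_mul, norm_mul, mul_assoc, mul_assoc]
  refine mul_le_mul_of_nonneg_left ?_ (norm_nonneg _)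
  rw [norm_pow, show ‖(1 / 2 : ℂ)‖ = 1 / 2 by norm_num, Finset.sum_mul]
  refine mul_le_mul_of_nonneg_left ((norm_sum_le _ _).trans (Finset.sum_le_sum fun s _ => ?_))
    (by positivity)
  rw [← Finset.sum_sub_distrib, Finset.sum_mul]
  refine (norm_sum_le _ _).trans (Finset.sum_le_sum fun μ _ => ?_)
  rw [← mul_sub, ← mul_sub, norm_mul, norm_mul, mul_assoc, mul_assoc]
  exact mul_le_mul_of_nonneg_left (mul_le_mul_of_nonneg_left (hK s μ _ hr hr1) (norm_nonneg _))
    (norm_nonneg _)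

theorem hasAsymptoticExpansion_weightedSum (hG : G.IsAcyclic)
    (hW : (-(realMatrix (linkingMatrix G w))).PosDef) {k : ℕ} (hk : 0 < k) :
    HasAsymptoticExpansion
      (fun t : ℝ => weightedSum G w k (1 / k + I * t / (2 * Real.pi))) Real.sqrt
      (fun N : ℤ => e (1 / 8) ^ Fintype.card V * (Real.sqrt |((linkingMatrix G w).det : ℝ)| : ℂ) /
            (Real.sqrt (2 * k) : ℂ) ^ Fintype.card V *
          hadamardCoeff (phi G w k)
            (fun x => ((Real.exp (-Q (linkingMatrix G w) x / 4) : ℝ) : ℂ)) N) := by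
  set L : ℕ := ∑ v, (G.degree v - 2) with hL
  have hzero : ∀ N : ℤ, N < -(L : ℤ) → hadamardCoeff (phi G w k)
      (fun x => ((Real.exp (-Q (linkingMatrix G w) x / 4) : ℝ) : ℂ)) N = 0 := fun N hN => by
    rw [hadamardCoeff_phi hW, degreeSet_eq_empty, Finset.sum_empty, mul_zero]
    rw [hL] at hN
    push_cast at hN
    exact_mod_cast hN
  -- The bound must be positive, whereas the total pole order `L` may be 0; the extra coefficient
  -- vanishes.
  refine ⟨L + 1, Nat.succ_pos _, fun N hN => ?_, fun M hM => ?_⟩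
  · simp only [hzero N (by push_cast at hN; omega), mul_zero]
  obtain ⟨K, hK0, hK⟩ := exists_norm_weightedSum_sub_le hG hW hk ⌊M⌋₊
  -- `K` may be 0. Cutting at ⌊M⌋ leaves an error of order √t^(⌊M⌋+1), which is at most √t^M for t <
  -- 1.
  refine ⟨K + 1, by positivity, 1, one_pos, fun t ht => ?_⟩
  have hr : 0 < Real.sqrt t := Real.sqrt_pos.2 ht.1
  have hr1 : Real.sqrt t ≤ 1 := Real.sqrt_le_one.2 ht.2.le
  have hfl : ((⌊M⌋₊ : ℕ) : ℤ) = ⌊M⌋ := Int.natCast_floor_eq_floor hM.le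
  have h1 := hK t ht.1 ht.2
  rw [hfl] at h1
  have hsub : Finset.Icc (-(L : ℤ)) ⌊M⌋ ⊆ Finset.Icc (-((L + 1 : ℕ) : ℤ)) ⌊M⌋ :=
    Finset.Icc_subset_Icc (by push_cast; omega) le_rfl
  rw [← Finset.sum_subset hsub fun N hN hN' => by
    rw [Finset.mem_Icc] at hN hN'
    simp only [hzero N (by omega), mul_zero, zero_mul]]
  refine h1.trans ?_
  have h2 : Real.sqrt t ^ (⌊M⌋₊ + 1) ≤ Real.sqrt t ^ M := by
    rw [← Real.rpow_natCast]
    refine Real.rpow_le_rpow_of_exponent_ge hr hr1 ?_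
    push_cast
    exact (Nat.lt_floor_add_one M).le
  have h3 : 0 ≤ Real.sqrt t ^ M := Real.rpow_nonneg hr.le M
  nlinarith

end Expansion

end GPPV

end

theorem proposition3 {V : Type*} [Fintype V] [DecidableEq V]
    (G : SimpleGraph V) [DecidableRel G.Adj] (hG : G.IsTree) (w : V → ℤ)
    (hW : (-((GPPV.linkingMatrix G w).map (Int.cast : ℤ → ℝ))).PosDef)
    (k : ℕ) (hk : 0 < k) :
    -- the theta series and the principal values that define the invariants converge
    (∀ (b : GPPV.Coker (2 • GPPV.linkingMatrix G w)) (τ : ℂ), 0 < τ.im →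
      (∀ z : V → ℂ, (∀ v, z v ≠ 0) →
        Summable fun l : {l : V → ℤ // GPPV.toCoker (2 • GPPV.linkingMatrix G w) l = b} =>
          GPPV.thetaTerm (GPPV.linkingMatrix G w) τ z l) ∧
      Filter.Tendsto (GPPV.symmetricIntegral (GPPV.integrand G w b τ)) (𝓝[>] (0 : ℝ))
        (𝓝 (GPPV.principalValue (GPPV.integrand G w b τ)))) ∧
    -- the asymptotic expansion of the weighted sum at `q = ζ_k e^(-t)`, in powers of `√t`
    GPPV.HasAsymptoticExpansion
      (fun t : ℝ => GPPV.weightedSum G w k (1 / k + Complex.I * t / (2 * Real.pi)))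
      Real.sqrt
      (fun n : ℤ =>
        GPPV.e (1 / 8) ^ Fintype.card V * (Real.sqrt |((GPPV.linkingMatrix G w).det : ℝ)| : ℂ) /
            (Real.sqrt (2 * k) : ℂ) ^ Fintype.card V *
          GPPV.hadamardCoeff (GPPV.phi G w k)
            (fun x => (Real.exp (-GPPV.Q (GPPV.linkingMatrix G w) x / 4) : ℂ)) n) := by
  refine ⟨fun b τ hτ => ⟨fun z hz => ?_, ?_⟩, ?_⟩
  · exact ((GPPV.summable_thetaTerm_norm hW hτ hz).of_norm).subtype _
  · rw [GPPV.principalValue_integrand hW b hτ]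
    exact GPPV.symmetricIntegral_integrand hW b hτ
  · exact GPPV.hasAsymptoticExpansion_weightedSum hG.isAcyclic hW hk
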